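/- Let $g$ be a smooth Riemannian metric on $S^2$ and let $\sigma$ be a symplectic form on $S^2$. Orient $S^2$ so that $\sigma$ is positive. Let $\mu$ be the positive Riemannian area form, let $\jmath$ be the rotation of the tangent planes by $+\pi/2$, and let $f:S^2\to(0,\infty)$ be defined by $\sigma=f\mu$. Let $\pi:SS^2\to S^2$ be the bundle of $g$-unit tangent vectors. On $SS^2$ let $X$ be the geodesic vector field, let $V$ be the generator of the rotation of the fibres (at $(x,v)$ it is the vertical lift of $\jmath_x v$), let $H$ be the vector field which at $(x,v)$ is the horizontal lift of $\jmath_x v$ for the Levi-Civita connection, and let $(\alpha,\psi,\eta)$ be the coframe dual to $(X,V,H)$; in particular $\alpha_{(x,v)}(\xi)=g_x(v,d\pi\,\xi)$. Let $\nu=\alpha\wedge\psi\wedge\eta$ be the Liouville volume form, which also orients $SS^2$. For $m>0$ put $$X^m=mX+fV,\qquad \omega_m=m\,d\alpha-\pi^*\sigma\in\Omega^2(SS^2).$$ The form $\nu$ defines a Borel measure on $SS^2$, with density $|\nu(\partial_1,\partial_2,\partial_3)|$ in local coordinates; let $\zeta$ be this measure divided by its total mass (the normalized Liouville measure). Then,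 for every $m>0$: 1. $\zeta$ is an $X^m$-invariant Borel probability measure: $\int_{SS^2} dh(X^m)\,d\zeta=0$ for every smooth $h:SS^2\to\mathbb R$. 2. $\zeta$ is null-homologous: $\int_{SS^2}\beta(X^m)\,d\zeta=0$ for every smooth closed one-form $\beta$ on $SS^2$. 3. $\zeta$ has positive action: $\omega_m$ is exact, and there is a number $A>0$ such that $\int_{SS^2}\tau(X^m)\,d\zeta=A$ for every smooth one-form $\tau$ on $SS^2$ with $d\tau=\omega_m$. 4. Hence $\omega_m$ is not of negative contact type: there is no contact form $\tau$ on $SS^2$ with $d\tau=\omega_m$ such that $-R^\tau$ is a positive section of $\ker\omega_m$, where $R^\tau$ is the Reeb vector field of $\tau$. Here a nonzero vector $Z\in\ker\omega_m$ is positive if $\nu(Z,a,b)>0$ whenever $\omega_m(a,b)>0$. -/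

import Mathlib

open scoped ContDiff RealInnerProductSpace
open MeasureTheory

noncomputable section

namespace MagneticSphere

/-- Euclidean three-space, in which the two-sphere is embedded. -/
abbrev E3 : Type := EuclideanSpace ℝ (Fin 3)

/-- The ambient space of the tangent bundle `TS² = {(x, v) | |x| = 1, ⟪x, v⟫ = 0}`. -/
abbrev E6 : Type := E3 × E3

/-- The two-sphere. -/
def S2 : Set E3 := Metric.sphere 0 1

/-- The tangent plane `T_x S² = x^⊥`. -/
def tangentS2 (x : E3) : Submodule ℝ E3 := (ℝ ∙ x)ᗮ

/-! ### Calculus on a closed embedded three-dimensional submanifold of `E6`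

`N` is a closed embedded submanifold and `TN p` is its tangent space at `p ∈ N`. Smooth functions
and smooth forms on `N` are exactly the restrictions of smooth functions and forms on the ambient
space. Pulling back to `N` commutes with the exterior derivative, so `d` on `N` is the ambient
`extDeriv` evaluated on vectors tangent to `N`; two ambient forms define the same form on `N` iff
they agree on such vectors. -/

/-- The space `𝒫^Ω` of the primitives of a two-form `Ω` on `N`: smooth one-forms `τ` on `N` with
`dτ = Ω` on `N`. -/
def Primitives (N : Set E6) (TN : E6 → Set E6) (Ω : E6 → E6 [⋀^Fin 2]→L[ℝ] ℝ) :
    Set (E6 → E6 [⋀^Fin 1]→L[ℝ] ℝ) :=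
  {τ | ContDiff ℝ ∞ τ ∧
    ∀ p ∈ N, ∀ a ∈ TN p, ∀ b ∈ TN p, extDeriv τ p ![a, b] = Ω p ![a, b]}

/-- `τ` is a contact form on `N`: `τ ∧ dτ` vanishes at no point of `N`. -/
def IsContactForm (N : Set E6) (TN : E6 → Set E6) (τ : E6 → E6 [⋀^Fin 1]→L[ℝ] ℝ) : Prop :=
  ContDiff ℝ ∞ τ ∧ ∀ p ∈ N, ∃ a ∈ TN p, ∃ b ∈ TN p, ∃ c ∈ TN p,
    τ p ![a] * extDeriv τ p ![b, c] - τ p ![b] * extDeriv τ p ![a, c]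
      + τ p ![c] * extDeriv τ p ![a, b] ≠ 0

/-- `R` is the Reeb vector field of `τ`: `ι_R dτ = 0` and `τ(R) = 1`. -/
def IsReebField (N : Set E6) (TN : E6 → Set E6) (τ : E6 → E6 [⋀^Fin 1]→L[ℝ] ℝ)
    (R : E6 → E6) : Prop :=
  ∀ p ∈ N, R p ∈ TN p ∧ (∀ b ∈ TN p, extDeriv τ p ![R p, b] = 0) ∧ τ p ![R p] = 1

/-- `Z` is a positive section of the line field `ker Ω`, where `N` is oriented by the volume form
`vol`: a vector `Z` of `ker Ω` is positive iff `(Z, a, b)` is a positive basis whenever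
`Ω(a, b) > 0`. -/
def IsPositiveSection (N : Set E6) (TN : E6 → Set E6) (vol : E6 → (Fin 3 → E6) → ℝ)
    (Ω : E6 → E6 [⋀^Fin 2]→L[ℝ] ℝ) (Z : E6 → E6) : Prop :=
  ∀ p ∈ N, Z p ∈ TN p ∧ Z p ≠ 0 ∧ (∀ b ∈ TN p, Ω p ![Z p, b] = 0) ∧
    ∀ a ∈ TN p, ∀ b ∈ TN p, 0 < Ω p ![a, b] → 0 < vol p ![Z p, a, b]

/-- `Ω` is of negative contact type on `N`, oriented by `vol`: there is a contact form `τ` with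
`dτ = Ω` whose Reeb field `R` is such that `-R` is a positive section of `ker Ω`. -/
def IsNegativeContactType (N : Set E6) (TN : E6 → Set E6) (vol : E6 → (Fin 3 → E6) → ℝ)
    (Ω : E6 → E6 [⋀^Fin 2]→L[ℝ] ℝ) : Prop :=
  ∃ τ ∈ Primitives N TN Ω, IsContactForm N TN τ ∧
    ∃ R, IsReebField N TN τ R ∧ IsPositiveSection N TN vol Ω (fun p ↦ -R p)

/-- A Borel probability measure `ζ` on `N` is `Z`-invariant if `∫_N dh(Z) ζ = 0` for all smooth
functions `h` on `N`. -/
def IsInvariantMeasure (N : Set E6) (Z : E6 → E6) (ζ : Measure E6) : Prop :=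
  IsProbabilityMeasure ζ ∧ ζ Nᶜ = 0 ∧
    ∀ h : E6 → ℝ, ContDiff ℝ ∞ h → ∫ p, fderiv ℝ h p (Z p) ∂ζ = 0

/-- `ζ` is null-homologous: `∫_N β(Z) ζ = 0` for all closed one-forms `β` on `N`. -/
def IsNullHomologous (N : Set E6) (TN : E6 → Set E6) (Z : E6 → E6) (ζ : Measure E6) : Prop :=
  ∀ β : E6 → E6 [⋀^Fin 1]→L[ℝ] ℝ, β ∈ Primitives N TN 0 → ∫ p, β p ![Z p] ∂ζ = 0

/-- The number `A` is the action of `ζ`: `Ω` is exact on `N`, and `∫_N τ(Z) ζ = A` for every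
primitive `τ` of `Ω`. -/
def HasAction (N : Set E6) (TN : E6 → Set E6) (Ω : E6 → E6 [⋀^Fin 2]→L[ℝ] ℝ) (Z : E6 → E6)
    (ζ : Measure E6) (A : ℝ) : Prop :=
  (Primitives N TN Ω).Nonempty ∧ ∀ τ ∈ Primitives N TN Ω, ∫ p, τ p ![Z p] ∂ζ = A

/-- `φ` is a smooth parametrization, defined on the open set `U` of `ℝ³`, of an open piece of the
three-manifold `N`. -/
def IsParametrization (N : Set E6) (U : Set (Fin 3 → ℝ)) (φ : (Fin 3 → ℝ) → E6) : Prop :=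
  IsOpen U ∧ ContDiffOn ℝ ∞ φ U ∧ Set.InjOn φ U ∧ Set.MapsTo φ U N ∧
    ∀ y ∈ U, Function.Injective (fderiv ℝ φ y)

/-- `ζ` is the Borel measure on `N` given by the volume form `vol`: in all local coordinates it is
`|vol(∂₁, ∂₂, ∂₃)| dy₁ dy₂ dy₃`. -/
def IsVolumeMeasure (N : Set E6) (vol : E6 → (Fin 3 → E6) → ℝ) (ζ : Measure E6) : Prop :=
  ζ Nᶜ = 0 ∧ ∀ U φ, IsParametrization N U φ → ∀ B ⊆ U, MeasurableSet B →
    ζ (φ '' B) =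
      ∫⁻ y in B, ENNReal.ofReal |vol (φ y) (fun i ↦ fderiv ℝ φ y (Pi.single i 1))|

/-! ### Symplectic magnetic systems on the two-sphere -/

/-- A symplectic magnetic system `(S², g, σ)`. The Riemannian metric `g` and the two-form `σ` on
the sphere are given as restrictions of smooth tensors on the ambient space; only their values on
tangent vectors matter. A two-form on a surface is closed, so `σ` is symplectic iff it is
non-degenerate. -/
structure MagneticSystem where
  /-- The Riemannian metric. -/
  g : E3 → E3 →L[ℝ] E3 →L[ℝ] ℝ
  g_smooth : ContDiff ℝ ∞ g
  g_symm : ∀ x u w, g x u w = g x w u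
  g_pos : ∀ x ∈ S2, ∀ u ∈ tangentS2 x, u ≠ 0 → 0 < g x u u
  /-- The magnetic form. -/
  σ : E3 → E3 [⋀^Fin 2]→L[ℝ] ℝ
  σ_smooth : ContDiff ℝ ∞ σ
  σ_nondeg : ∀ x ∈ S2, ∀ u ∈ tangentS2 x, u ≠ 0 → ∃ w ∈ tangentS2 x, σ x ![u, w] ≠ 0

namespace MagneticSystem

variable (M : MagneticSystem)

/-- The kinetic energy `E(x, v) = g_x(v, v) / 2`. -/
def energy (p : E6) : ℝ := M.g p.1 p.2 p.2 / 2

/-- The unit tangent bundle `SS² = {E = 1/2} ⊆ TS²`. -/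
def unitBundle : Set E6 :=
  {p | p.1 ∈ S2 ∧ p.2 ∈ tangentS2 p.1 ∧ M.energy p = 1 / 2}

/-- The tangent space of `TS² = {⟪x, x⟫ = 1, ⟪x, v⟫ = 0}` at `p = (x, v)`. -/
def tangentTS2 (p : E6) : Set E6 :=
  {ξ | ⟪p.1, ξ.1⟫ = 0 ∧ ⟪ξ.1, p.2⟫ + ⟪p.1, ξ.2⟫ = 0}

/-- The tangent space of the unit tangent bundle at `p`, the kernel of `dE` in `T_p TS²`. -/
def tangentUnitBundle (p : E6) : Set E6 :=
  {ξ | ξ ∈ tangentTS2 p ∧ fderiv ℝ M.energy p ξ = 0}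

/-- The rotation `ȷ_x` of `T_x S²` by `π/2`, where the sphere carries the orientation for which
`σ` is positive: `ȷ_x v` is the tangent vector which is orthogonal to `v`, has the same length and
makes `(v, ȷ_x v)` positive. -/
def rot (x v : E3) : E3 :=
  Classical.epsilon fun w ↦
    w ∈ tangentS2 x ∧ M.g x w v = 0 ∧ M.g x w w = M.g x v v ∧ 0 ≤ M.σ x ![v, w]

/-- The positive Riemannian area form, `μ_x(u, w) = g_x(ȷ_x u, w)`. -/
def area (x u w : E3) : ℝ := M.g x (M.rot x u) w

/-- The magnetic strength `f`, defined by `σ = f μ`. -/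
def strength (x : E3) : ℝ :=
  Classical.epsilon fun c ↦
    ∀ u ∈ tangentS2 x, ∀ w ∈ tangentS2 x, M.σ x ![u, w] = c * M.area x u w

/-- The connection map of the Levi-Civita connection: if `(x(t), v(t))` is a curve in `TS²` through
`p` with velocity `ξ`, the covariant derivative of `v(t)` along `x(t)` is the tangent vector `k`
such that, with `a = ξ.1` and `b = ξ.2`, for all tangent `w`,
`g(k, w) = g(b, w) + ((∂_a g)(v, w) + (∂_v g)(a, w) - (∂_w g)(a, v)) / 2`.
For vector fields on the sphere, this is Koszul's formula: the last three terms are the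
Christoffel symbols of the first kind, they are symmetric in `a` and `v` (no torsion), and adding
the formulas for `g(∇_a v, w)` and `g(v, ∇_a w)` gives the derivative of `g(v, w)`
(compatibility with the metric). The result does not depend on the ambient extension of `g`. -/
def connector (p ξ : E6) : E3 :=
  Classical.epsilon fun k ↦ k ∈ tangentS2 p.1 ∧ ∀ w ∈ tangentS2 p.1,
    M.g p.1 k w = M.g p.1 ξ.2 w +
      (fderiv ℝ M.g p.1 ξ.1 p.2 w + fderiv ℝ M.g p.1 p.2 ξ.1 w
        - fderiv ℝ M.g p.1 w ξ.1 p.2) / 2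

/-- The horizontal lift `T_x S² → T_{(x,v)} TS²`. -/
def horizontalLift (p : E6) (u : E3) : E6 :=
  Classical.epsilon fun ξ ↦ ξ ∈ tangentTS2 p ∧ ξ.1 = u ∧ M.connector p ξ = 0

/-- The geodesic vector field `X`. -/
def X (p : E6) : E6 := M.horizontalLift p p.2

/-- The generator `V` of the rotation of the fibres: the vertical lift of `ȷ_x v`. -/
def V (p : E6) : E6 := (0, M.rot p.1 p.2)

/-- The magnetic vector field `X^m = m X + f V` on the unit tangent bundle. -/
def magneticField (m : ℝ) (p : E6) : E6 := m • M.X p + M.strength p.1 • M.V p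

/-- The one-form `α_{(x,v)}(ξ) = g_x(v, dπ ξ)`, the pull-back of the standard Liouville form by
the duality isomorphism of `g`. -/
def α (p : E6) : E6 [⋀^Fin 1]→L[ℝ] ℝ :=
  ContinuousAlternatingMap.ofSubsingleton ℝ E6 ℝ (0 : Fin 1)
    ((M.g p.1 p.2).comp (ContinuousLinearMap.fst ℝ E3 E3))

/-- The Levi-Civita connection form `ψ`. Together with `α` and `η` it is the coframe of the unit
tangent bundle dual to `(X, V, H)`, where `H` is the horizontal lift of `ȷ_x v`. -/
def ψ (p ξ : E6) : ℝ := M.g p.1 (M.connector p ξ) (M.rot p.1 p.2)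

/-- The one-form `η_{(x,v)}(ξ) = g_x(ȷ_x v, dπ ξ)`. -/
def η (p ξ : E6) : ℝ := M.g p.1 (M.rot p.1 p.2) ξ.1

/-- The Liouville volume form `ν = α ∧ ψ ∧ η`, which also orients the unit tangent bundle. -/
def liouvilleForm (p : E6) (ξ : Fin 3 → E6) : ℝ :=
  Matrix.det !![M.α p ![ξ 0], M.α p ![ξ 1], M.α p ![ξ 2];
                M.ψ p (ξ 0), M.ψ p (ξ 1), M.ψ p (ξ 2);
                M.η p (ξ 0), M.η p (ξ 1), M.η p (ξ 2)]

/-- The two-form `ω_m = m dα - π^*σ` on the unit tangent bundle. -/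
def omega (m : ℝ) (p : E6) : E6 [⋀^Fin 2]→L[ℝ] ℝ :=
  m • extDeriv M.α p
    - (M.σ p.1).compContinuousLinearMap (ContinuousLinearMap.fst ℝ E3 E3)

/-- The Borel measure on the unit tangent bundle given by the Liouville volume form. -/
def liouvilleVolume : Measure E6 :=
  Classical.epsilon (IsVolumeMeasure M.unitBundle M.liouvilleForm)

/-- The Liouville measure, normalized to be a probability measure. -/
def liouvilleMeasure : Measure E6 := (M.liouvilleVolume Set.univ)⁻¹ • M.liouvilleVolume

end MagneticSystem

end MagneticSphere

end

/-! Everything rests on one identity: the contraction of `ν = α ∧ ψ ∧ η` with `X^m` is `ω_m`,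
because `dα = ψ ∧ η` and `π^*σ = f α ∧ η`. Hence `τ(X^m) ν = τ ∧ ω_m` for every one-form `τ`
(`magneticField_mul_liouvilleForm`), and integrals against `ζ` become integrals of wedge products
over a closed manifold. If `ω_m = dτ₀`, Stokes' theorem (`integral_wedge_sub_wedge`) gives `∫ β ∧
dτ₀ = ∫ τ₀ ∧ dβ`. So closed forms have integral zero, exact ones in particular (invariance), and all
primitives of `ω_m` have the same action.

For the sign of the action take `τ₀ = mα - θ` with `dθ = π^*σ`. Then `τ₀ ∧ dτ₀ = m² ν - m (α ∧ π^*σ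
+ θ ∧ dα) + θ ∧ π^*σ`. Here `α ∧ π^*σ` is zero pointwise, hence `θ ∧ dα` has integral zero by
Stokes, and `θ ∧ π^*σ = -f θ(V) ν` is positive once `θ(V) < 0`. Such a `θ` is built in
`exists_primitive_magnetic`. On the sphere, `σ` is `c` times the round area form plus `dκ`, where
`c` is the mean of the density of `σ`, and the round area form pulls back to the differential of
`roundConnection`; thus `θ` is `c` times `roundConnection` plus `π^*κ`. The splitting of `σ` comes
from averaging its density over rotations: each averaging changes the density by a derivative along
a rotation field, which is the density of an exact form.

If `ω_m` were of negative contact type with form `τ`, then `-R` would be a positive multiple of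
`X^m`, so `τ(X^m)` would be negative everywhere, against the positive action.

Euler angles make the Liouville measure explicit: they parametrize the bundle by an open box up to a
null set, and the push-forward of the density is the only measure with the required values in all
charts. Stokes' theorem then reduces to the divergence theorem on the closed box. -/

open scoped ContDiff RealInnerProductSpace
open MeasureTheory

noncomputable section

namespace MagneticSphere

open Set Filter Topology

/-! ### Smoothness of integrals depending on a parameter -/

section ParametricIntegral

universe u
variable {H E : Type u} [NormedAddCommGroup H] [NormedSpace ℝ H]
  [NormedAddCommGroup E] [NormedSpace ℝ E]

theorem hasFDerivAt_intervalIntegral_param [LocallyCompactSpace H] {f : H → ℝ → E} {f' : H → ℝ → H →L[ℝ] E}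
    (hf : Continuous f.uncurry) (hf' : Continuous f'.uncurry)
    (h : ∀ x t, HasFDerivAt (fun y ↦ f y t) (f' x t) x) (a b : ℝ) (x₀ : H) :
    HasFDerivAt (fun x ↦ ∫ t in a..b, f x t) (∫ t in a..b, f' x₀ t) x₀ := by
  rcases exists_compact_mem_nhds x₀ with ⟨U, hU, hU'⟩
  rcases (hU.prod (isCompact_uIcc (a := a) (b := b))).bddAbove_image
    hf'.norm.continuousOn with ⟨M, hM⟩
  have hs : ∀ x, Continuous (f x) := fun x ↦ hf.comp (by fun_prop : Continuous fun t ↦ (x, t))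
  have hs' : ∀ x, Continuous (f' x) := fun x ↦ hf'.comp (by fun_prop : Continuous fun t ↦ (x, t))
  refine intervalIntegral.hasFDerivAt_integral_of_dominated_of_fderiv_le (bound := fun _ ↦ M) hU'
    (.of_forall fun x ↦ (hs x).aestronglyMeasurable) ((hs _).intervalIntegrable _ _)
    (hs' _).aestronglyMeasurable (.of_forall fun t ht x hx ↦ ?_) (by simp) (.of_forall fun t _ x _ ↦ h x t)
  exact hM (mem_image_of_mem (f := fun p : H × ℝ ↦ ‖f'.uncurry p‖)
    (show (x, t) ∈ U ×ˢ uIcc a b from ⟨hx, uIoc_subset_uIcc ht⟩))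

theorem hasFDerivAt_left {f : H → ℝ → E} (hf : ContDiff ℝ ∞ f.uncurry) (x : H) (t : ℝ) :
    HasFDerivAt (fun y ↦ f y t)
      ((fderiv ℝ f.uncurry (x, t)).comp (ContinuousLinearMap.inl ℝ H ℝ)) x := by
  have h := (hf.differentiable (by simp) (x, t)).hasFDerivAt
  exact HasFDerivAt.comp (f := fun y ↦ (y, t)) x h (hasFDerivAt_prodMk_left x t)

theorem contDiff_fderiv_left {f : H → ℝ → E} (hf : ContDiff ℝ ∞ f.uncurry) :
    ContDiff ℝ ∞ (Function.uncurry fun x t ↦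
      (fderiv ℝ f.uncurry (x, t)).comp (ContinuousLinearMap.inl ℝ H ℝ)) :=
  (hf.fderiv_right (m := ∞) (by simp)).clm_comp contDiff_const

theorem hasFDerivAt_intervalIntegral_of_contDiff [LocallyCompactSpace H] {f : H → ℝ → E} (hf : ContDiff ℝ ∞ f.uncurry)
    (a b : ℝ) (x : H) :
    HasFDerivAt (fun x ↦ ∫ t in a..b, f x t) (∫ t in a..b,
      (fderiv ℝ f.uncurry (x, t)).comp (ContinuousLinearMap.inl ℝ H ℝ)) x :=
  hasFDerivAt_intervalIntegral_param hf.continuous (contDiff_fderiv_left hf).continuous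
    (fun x t ↦ hasFDerivAt_left hf x t) a b x

theorem fderiv_intervalIntegral_apply [LocallyCompactSpace H] {f : H → ℝ → E}
    (hf : ContDiff ℝ ∞ f.uncurry) (a b : ℝ) (x v : H) :
    fderiv ℝ (fun x ↦ ∫ t in a..b, f x t) x v = ∫ t in a..b, fderiv ℝ (fun y ↦ f y t) x v := by
  rw [(hasFDerivAt_intervalIntegral_of_contDiff hf a b x).fderiv]
  rw [ContinuousLinearMap.intervalIntegral_apply]
  · exact intervalIntegral.integral_congr fun t _ ↦ by
      simp only [(hasFDerivAt_left hf x t).fderiv]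
  · have := (contDiff_fderiv_left hf).continuous.comp (by fun_prop : Continuous fun t : ℝ ↦ (x, t))
    exact this.intervalIntegrable _ _

end ParametricIntegral

-- The derivative of such an integral is again one, with values in `H →L[ℝ] E`. The induction on `n`
-- therefore quantifies over the codomain, and `H` and `E` share a universe so that it does not
-- leave it.
universe u in
theorem contDiff_intervalIntegral_aux {H : Type u} [NormedAddCommGroup H] [NormedSpace ℝ H]
    [LocallyCompactSpace H] (a b : ℝ) (n : ℕ) :
    ∀ {E : Type u} [NormedAddCommGroup E] [NormedSpace ℝ E] {f : H → ℝ → E},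
      ContDiff ℝ ∞ f.uncurry → ContDiff ℝ n (fun x ↦ ∫ t in a..b, f x t) := by
  induction n with
  | zero =>
    intro E _ _ f hf
    refine contDiff_zero.2 (continuous_iff_continuousAt.2 fun x ↦ ?_)
    exact (hasFDerivAt_intervalIntegral_of_contDiff hf a b x).continuousAt
  | succ n ih =>
    intro E _ _ f hf
    have h := hasFDerivAt_intervalIntegral_of_contDiff hf a b
    rw [Nat.cast_succ, contDiff_succ_iff_fderiv]
    refine ⟨fun x ↦ (h x).differentiableAt, by simp, ?_⟩
    rw [show fderiv ℝ (fun x ↦ ∫ t in a..b, f x t) = _ from funext fun x ↦ (h x).fderiv]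
    exact ih (contDiff_fderiv_left hf)

theorem contDiff_intervalIntegral {H E : Type} [NormedAddCommGroup H] [NormedSpace ℝ H]
    [LocallyCompactSpace H] [NormedAddCommGroup E] [NormedSpace ℝ E] [CompleteSpace E]
    {f : H → ℝ → E} (hf : ContDiff ℝ ∞ f.uncurry) (a b : ℝ) :
    ContDiff ℝ ∞ (fun x ↦ ∫ t in a..b, f x t) :=
  contDiff_infty.2 fun n ↦ contDiff_intervalIntegral_aux a b n hf

/-! ### Averages over one-parameter groups of rotations -/

/-- The rotation by the angle `t` with the infinitesimal generator `J`. -/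
def rotation (J : E3 →L[ℝ] E3) (t : ℝ) : E3 →L[ℝ] E3 :=
  ContinuousLinearMap.id ℝ E3 + Real.sin t • J + (1 - Real.cos t) • J.comp J

theorem rotation_apply (J : E3 →L[ℝ] E3) (t : ℝ) (p : E3) :
    rotation J t p = p + Real.sin t • J p + (1 - Real.cos t) • J (J p) := by
  simp [rotation]

theorem rotation_zero (J : E3 →L[ℝ] E3) (p : E3) : rotation J 0 p = p := by
  simp [rotation_apply]

theorem rotation_two_pi (J : E3 →L[ℝ] E3) (p : E3) : rotation J (2 * Real.pi) p = p := by
  simp [rotation_apply]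

theorem contDiff_rotation (J : E3 →L[ℝ] E3) : ContDiff ℝ ∞ (rotation J) := by
  unfold rotation
  have h1 : ContDiff ℝ ∞ Real.sin := Real.contDiff_sin
  have h2 : ContDiff ℝ ∞ Real.cos := Real.contDiff_cos
  fun_prop

theorem generator_rotation (J : E3 →L[ℝ] E3) (t : ℝ) (p : E3) :
    J (rotation J t p) = rotation J t (J p) := by
  simp [rotation_apply]

theorem hasDerivAt_rotation {J : E3 →L[ℝ] E3} (hJ : ∀ p, J (J (J p)) = -J p) (t : ℝ) (p : E3) :
    HasDerivAt (fun t ↦ rotation J t p) (rotation J t (J p)) t := by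
  simp only [rotation_apply]
  have h := (((Real.hasDerivAt_sin t).smul_const (J p)).const_add p).fun_add
    (((Real.hasDerivAt_cos t).const_sub 1).smul_const (J (J p)))
  refine h.congr_deriv ?_
  rw [hJ]
  module

/-- The weighted average of a function over rotations. -/
def average (w : ℝ → ℝ) (T : ℝ) (J : E3 →L[ℝ] E3) (F : E3 → ℝ) (p : E3) : ℝ :=
  ∫ t in (0)..T, w t * F (rotation J t p)

section Average

variable {J : E3 →L[ℝ] E3} {F : E3 → ℝ} {w : ℝ → ℝ}

theorem contDiff_average_integrand (hF : ContDiff ℝ ∞ F) (hw : ContDiff ℝ ∞ w) :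
    ContDiff ℝ ∞ (Function.uncurry fun p t ↦ w t * F (rotation J t p)) := by
  have h := contDiff_rotation J
  have : ContDiff ℝ ∞ fun q : E3 × ℝ ↦ rotation J q.2 q.1 :=
    (h.comp contDiff_snd).clm_apply contDiff_fst
  exact (hw.comp contDiff_snd).mul (hF.comp this)

theorem contDiff_average (hF : ContDiff ℝ ∞ F) (hw : ContDiff ℝ ∞ w) (T : ℝ) :
    ContDiff ℝ ∞ (average w T J F) :=
  contDiff_intervalIntegral (contDiff_average_integrand hF hw) 0 T

theorem fderiv_average_apply (hF : ContDiff ℝ ∞ F) (hw : ContDiff ℝ ∞ w) (T : ℝ) (p v : E3) :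
    fderiv ℝ (average w T J F) p v =
      ∫ t in (0)..T, w t * fderiv ℝ F (rotation J t p) (rotation J t v) := by
  unfold average
  rw [fderiv_intervalIntegral_apply (contDiff_average_integrand hF hw)]
  refine intervalIntegral.integral_congr fun t _ ↦ ?_
  have h := (((hF.differentiable (by simp) (rotation J t p)).hasFDerivAt.comp p
    (rotation J t).hasFDerivAt).const_mul (w t)).fderiv
  simp only [Function.comp_def] at h
  simp [h]

/-- Along the generator the derivative of `F (rotation J t p)` in `p` equals its derivative in `t`,
and integration by parts moves it onto the weight. -/
theorem fderiv_average_generator (hJ : ∀ p, J (J (J p)) = -J p) (hF : ContDiff ℝ ∞ F)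
    (hw : ContDiff ℝ ∞ w) (T : ℝ) (p : E3) :
    fderiv ℝ (average w T J F) p (J p) =
      w T * F (rotation J T p) - w 0 * F p - average (deriv w) T J F p := by
  rw [fderiv_average_apply hF hw]
  have hd : ∀ t, HasDerivAt (fun t ↦ F (rotation J t p))
      (fderiv ℝ F (rotation J t p) (rotation J t (J p))) t := fun t ↦
    (hF.differentiable (by simp) (rotation J t p)).hasFDerivAt.comp_hasDerivAt t
      (hasDerivAt_rotation hJ t p)
  have hw' : ∀ t, HasDerivAt w (deriv w t) t := fun t ↦
    (hw.differentiable (by simp) t).hasDerivAt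
  have hr : Continuous fun t ↦ rotation J t p :=
    continuous_iff_continuousAt.2 fun t ↦ (hasDerivAt_rotation hJ t p).continuousAt
  have hr' : Continuous fun t ↦ rotation J t (J p) :=
    continuous_iff_continuousAt.2 fun t ↦ (hasDerivAt_rotation hJ t (J p)).continuousAt
  have hc : Continuous fun t ↦ fderiv ℝ F (rotation J t p) (rotation J t (J p)) :=
    ((hF.continuous_fderiv (by simp)).comp hr).clm_apply hr'
  have hcw : Continuous (deriv w) := hw.continuous_deriv (by simp)
  rw [intervalIntegral.integral_mul_deriv_eq_deriv_mul (u := w) (fun t _ ↦ hw' t) (fun t _ ↦ hd t)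
    (hcw.intervalIntegrable _ _) (hc.intervalIntegrable _ _), rotation_zero]
  rfl

/-- Averaging over rotations changes a function by a derivative along the generator. -/
theorem average_sub_eq_fderiv (hJ : ∀ p, J (J (J p)) = -J p) (hF : ContDiff ℝ ∞ F)
    {W : ℝ → ℝ} (hW : ContDiff ℝ ∞ W) {T : ℝ} (h0 : W 0 = 1) (hT : W T = 0) (p : E3) :
    average (fun t ↦ -deriv W t) T J F p - F p = fderiv ℝ (average W T J F) p (J p) := by
  rw [fderiv_average_generator hJ hF hW, h0, hT]
  simp only [average, neg_mul, intervalIntegral.integral_neg]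
  ring

theorem apply_rotation_of_fderiv_eq_zero (hJ : ∀ p, J (J (J p)) = -J p) (hF : ContDiff ℝ ∞ F)
    (h : ∀ p, fderiv ℝ F p (J p) = 0) (t : ℝ) (p : E3) : F (rotation J t p) = F p := by
  have hd : ∀ t, HasDerivAt (fun t ↦ F (rotation J t p)) 0 t := fun t ↦ by
    have := (hF.differentiable (by simp) (rotation J t p)).hasFDerivAt.comp_hasDerivAt t
      (hasDerivAt_rotation hJ t p)
    rwa [← generator_rotation, h] at this
  have := is_const_of_deriv_eq_zero (fun t ↦ (hd t).differentiableAt) (fun t ↦ (hd t).deriv) t 0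
  simpa [rotation_zero] using this

end Average

/-! ### The mean over all rotations in Euler angles -/

/-- The cross product. -/
def cross (a b : E3) : E3 :=
  !₂[a 1 * b 2 - a 2 * b 1, a 2 * b 0 - a 0 * b 2, a 0 * b 1 - a 1 * b 0]

@[simp] theorem cross_zero_coord (a b : E3) : cross a b 0 = a 1 * b 2 - a 2 * b 1 := rfl
@[simp] theorem cross_one_coord (a b : E3) : cross a b 1 = a 2 * b 0 - a 0 * b 2 := rfl
@[simp] theorem cross_two_coord (a b : E3) : cross a b 2 = a 0 * b 1 - a 1 * b 0 := rfl

/-- The determinant of three vectors. -/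
def det3 (a b c : E3) : ℝ :=
  a 0 * (b 1 * c 2 - b 2 * c 1) + a 1 * (b 2 * c 0 - b 0 * c 2) + a 2 * (b 0 * c 1 - b 1 * c 0)

theorem inner_eq_coord (a b : E3) : ⟪a, b⟫ = a 0 * b 0 + a 1 * b 1 + a 2 * b 2 := by
  simp [PiLp.inner_apply, Fin.sum_univ_three, mul_comm]

theorem ext_coord {a b : E3} (h0 : a 0 = b 0) (h1 : a 1 = b 1) (h2 : a 2 = b 2) : a = b := by
  ext i; fin_cases i <;> assumption

/-- The cross product with a fixed vector, as a continuous linear map. -/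
def crossL (e : E3) : E3 →L[ℝ] E3 :=
  LinearMap.toContinuousLinearMap
    { toFun := cross e
      map_add' := fun a b ↦ by apply ext_coord <;> simp <;> ring
      map_smul' := fun c a ↦ by apply ext_coord <;> simp <;> ring }

@[simp] theorem crossL_apply (e a : E3) : crossL e a = cross e a := rfl

/-- The unit vector of the second coordinate axis. -/
def ey : E3 := !₂[0, 1, 0]
/-- The unit vector of the third coordinate axis. -/
def ez : E3 := !₂[0, 0, 1]

@[simp] theorem ey_zero : ey 0 = 0 := rfl
@[simp] theorem ey_one : ey 1 = 1 := rfl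
@[simp] theorem ey_two : ey 2 = 0 := rfl
@[simp] theorem ez_zero : ez 0 = 0 := rfl
@[simp] theorem ez_one : ez 1 = 0 := rfl
@[simp] theorem ez_two : ez 2 = 1 := rfl

theorem crossL_ey_cube (p : E3) : crossL ey (crossL ey (crossL ey p)) = -crossL ey p := by
  apply ext_coord <;> simp

theorem crossL_ez_cube (p : E3) : crossL ez (crossL ez (crossL ez p)) = -crossL ez p := by
  apply ext_coord <;> simp

theorem intervalIntegral_swap {f : ℝ → ℝ → ℝ} (hf : Continuous f.uncurry) {a b c d : ℝ}
    (hab : a ≤ b) (hcd : c ≤ d) :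
    ∫ x in a..b, ∫ y in c..d, f x y = ∫ y in c..d, ∫ x in a..b, f x y := by
  simp only [intervalIntegral.integral_of_le hab, intervalIntegral.integral_of_le hcd]
  apply integral_integral_swap
  rw [Measure.prod_restrict]
  exact (hf.continuousOn.integrableOn_compact (isCompact_Icc.prod isCompact_Icc)).mono_set
    (prod_mono Ioc_subset_Icc_self Ioc_subset_Icc_self)

/-- The first two terms on the right are multiples of the velocities of `rotation (crossL ey) b
(rotation (crossL ez) c p)` in `b` and in `c`. The third is along the `z`-rotation field and is
killed by the differential of a `z`-invariant function. -/
theorem rotation_ey_rotation_ez_ey (b c : ℝ) (p : E3) :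
    Real.sin b • rotation (crossL ey) b (rotation (crossL ez) c (crossL ey p)) =
      (Real.cos c * Real.sin b) •
          rotation (crossL ey) b (crossL ey (rotation (crossL ez) c p))
        - (Real.sin c * Real.cos b) •
          rotation (crossL ey) b (rotation (crossL ez) c (crossL ez p))
        + Real.sin c • crossL ez (rotation (crossL ey) b (rotation (crossL ez) c p)) := by
  apply ext_coord <;> simp [rotation_apply] <;> ring_nf <;> simp only [Real.sin_sq] <;> ring_nf

/-- The invariance of Haar measure in Euler angles: by the rotation identity the integrand is a
divergence in the angles `b` and `c`, with no boundary contribution. -/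
theorem fderiv_spherical_average_ey {F : E3 → ℝ} (hF : ContDiff ℝ ∞ F)
    (h : ∀ p, fderiv ℝ F p (crossL ez p) = 0) (p : E3) :
    fderiv ℝ (average (fun _ ↦ (2 * Real.pi)⁻¹) (2 * Real.pi) (crossL ez)
      (average (fun t ↦ Real.sin t / 2) Real.pi (crossL ey) F)) p (crossL ey p) = 0 := by
  have hs : ContDiff ℝ ∞ fun t ↦ Real.sin t / 2 := Real.contDiff_sin.div_const 2
  rw [fderiv_average_apply (contDiff_average hF hs _) contDiff_const]
  simp only [fderiv_average_apply hF hs]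
  rw [intervalIntegral.integral_const_mul]
  set Y := rotation (crossL ey) with hY
  set Z := rotation (crossL ez) with hZ
  have cY : Continuous Y := (contDiff_rotation _).continuous
  have cZ : Continuous Z := (contDiff_rotation _).continuous
  have cF := hF.continuous
  have cF' := hF.continuous_fderiv (by simp)
  have hd := hF.differentiable (by simp)
  -- With `F` taken at `Y b (Z c p)`, `P` is the `b`-derivative of `cos c * sin b * F` and `Q` the
  -- `c`-derivative of `sin c * cos b * F`. The terms without `fderiv` complete these derivatives
  -- and cancel in `P - Q`.
  let P : ℝ → ℝ → ℝ := fun c b ↦ Real.cos c * Real.cos b * F (Y b (Z c p))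
    + Real.cos c * Real.sin b * fderiv ℝ F (Y b (Z c p)) (Y b (crossL ey (Z c p)))
  let Q : ℝ → ℝ → ℝ := fun c b ↦ Real.cos c * Real.cos b * F (Y b (Z c p))
    + Real.sin c * Real.cos b * fderiv ℝ F (Y b (Z c p)) (Y b (Z c (crossL ez p)))
  have cP : Continuous P.uncurry := by
    simp only [P, Function.uncurry_def]; fun_prop
  have cQ : Continuous Q.uncurry := by
    simp only [Q, Function.uncurry_def]; fun_prop
  have hPQ : ∀ c b, Real.sin b / 2 * fderiv ℝ F (Y b (Z c p)) (Y b (Z c (crossL ey p)))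
      = (P c b - Q c b) / 2 := fun c b ↦ by
    have := congrArg (fderiv ℝ F (Y b (Z c p))) (rotation_ey_rotation_ez_ey b c p)
    simp only [map_add, map_sub, map_smul, smul_eq_mul, ← hY, ← hZ, h] at this
    simp only [P, Q]
    linear_combination this / 2
  simp only [hPQ, intervalIntegral.integral_div]
  have hP : ∀ c, ∫ b in (0)..Real.pi, P c b = 0 := fun c ↦ by
    have hd' : ∀ b, HasDerivAt (fun b ↦ Real.cos c * Real.sin b * F (Y b (Z c p))) (P c b) b :=
      fun b ↦ ((Real.hasDerivAt_sin b).const_mul (Real.cos c)).mul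
        ((hd _).hasFDerivAt.comp_hasDerivAt b (hasDerivAt_rotation crossL_ey_cube b (Z c p)))
    rw [intervalIntegral.integral_eq_sub_of_hasDerivAt (fun b _ ↦ hd' b)
      (Continuous.intervalIntegrable (by fun_prop) _ _)]
    simp
  have hQ : ∀ b, ∫ c in (0)..2 * Real.pi, Q c b = 0 := fun b ↦ by
    have hd' : ∀ c, HasDerivAt (fun c ↦ Real.sin c * Real.cos b * F (Y b (Z c p))) (Q c b) c :=
      fun c ↦ ((Real.hasDerivAt_sin c).mul_const (Real.cos b)).mul
        ((hd _).hasFDerivAt.comp_hasDerivAt c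
          ((Y b).hasFDerivAt.comp_hasDerivAt c (hasDerivAt_rotation crossL_ez_cube c p)))
    rw [intervalIntegral.integral_eq_sub_of_hasDerivAt (fun c _ ↦ hd' c)
      (Continuous.intervalIntegrable (by fun_prop) _ _)]
    simp
  have hpi := Real.pi_pos
  have key : ∫ c in (0)..2 * Real.pi, ∫ b in (0)..Real.pi, (P c b - Q c b) = 0 := by
    have : ∀ c, ∫ b in (0)..Real.pi, (P c b - Q c b) = - ∫ b in (0)..Real.pi, Q c b := fun c ↦ by
      rw [intervalIntegral.integral_sub (Continuous.intervalIntegrable (by fun_prop) _ _)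
        (Continuous.intervalIntegrable (by fun_prop) _ _), hP, zero_sub]
    simp only [this, intervalIntegral.integral_neg]
    rw [intervalIntegral_swap cQ (by positivity) hpi.le]
    simp [hQ]
  rw [key]
  simp

theorem exists_rotation_ez_coord_eq_zero (p : E3) : ∃ t, rotation (crossL ez) t p 1 = 0 := by
  refine ⟨-Complex.arg ⟨p 0, p 1⟩, ?_⟩
  have h1 := Complex.norm_mul_cos_arg ⟨p 0, p 1⟩
  have h2 := Complex.norm_mul_sin_arg ⟨p 0, p 1⟩
  simp only at h1 h2
  simp [rotation_apply]
  linear_combination Real.sin (Complex.arg ⟨p 0, p 1⟩) * h1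
    - Real.cos (Complex.arg ⟨p 0, p 1⟩) * h2

theorem exists_rotation_ey_eq_ez {p : E3} (hp : p ∈ S2) (h : p 1 = 0) :
    ∃ t, rotation (crossL ey) t p = ez := by
  have hn : p 0 * p 0 + p 2 * p 2 = 1 := by
    have : ⟪p, p⟫ = 1 := by rw [real_inner_self_eq_norm_sq]; simp [mem_sphere_zero_iff_norm.1 hp]
    rw [inner_eq_coord, h] at this
    linarith
  refine ⟨-Complex.arg ⟨p 2, p 0⟩, ?_⟩
  have hz : ‖(⟨p 2, p 0⟩ : ℂ)‖ = 1 := by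
    rw [Complex.norm_def, Complex.normSq_mk, add_comm, hn, Real.sqrt_one]
  have h1 := Complex.norm_mul_cos_arg ⟨p 2, p 0⟩
  have h2 := Complex.norm_mul_sin_arg ⟨p 2, p 0⟩
  simp only [hz, one_mul] at h1 h2
  apply ext_coord <;> simp [rotation_apply, h, h1, h2] <;> linarith

theorem rotation_ez_mem_S2 {p : E3} (hp : p ∈ S2) (t : ℝ) : rotation (crossL ez) t p ∈ S2 := by
  have h : ∀ q : E3, q ∈ S2 ↔ ⟪q, q⟫ = 1 := fun q ↦ by
    rw [real_inner_self_eq_norm_sq, S2, mem_sphere_zero_iff_norm]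
    constructor
    · intro h; simp [h]
    · intro h; nlinarith [norm_nonneg q]
  rw [h, inner_eq_coord] at *
  have := Real.sin_sq_add_cos_sq t
  simp [rotation_apply]
  linear_combination hp + (p 0 * p 0 + p 1 * p 1) * this

theorem mem_S2_iff_inner {p : E3} : p ∈ S2 ↔ ⟪p, p⟫ = 1 := by
  rw [real_inner_self_eq_norm_sq, S2, mem_sphere_zero_iff_norm]
  constructor
  · intro h; simp [h]
  · intro h; nlinarith [norm_nonneg p]

theorem mem_S2_iff {p : E3} : p ∈ S2 ↔ p 0 * p 0 + p 1 * p 1 + p 2 * p 2 = 1 := by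
  rw [mem_S2_iff_inner, inner_eq_coord]

theorem mem_tangentS2 {x u : E3} : u ∈ tangentS2 x ↔ ⟪x, u⟫ = 0 :=
  Submodule.mem_orthogonal_singleton_iff_inner_right

theorem mem_tangentS2_iff {x u : E3} :
    u ∈ tangentS2 x ↔ x 0 * u 0 + x 1 * u 1 + x 2 * u 2 = 0 := by
  rw [mem_tangentS2, inner_eq_coord]

theorem rotation_ey_mem_S2 {p : E3} (hp : p ∈ S2) (t : ℝ) : rotation (crossL ey) t p ∈ S2 := by
  rw [mem_S2_iff] at *
  have := Real.sin_sq_add_cos_sq t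
  simp [rotation_apply]
  linear_combination hp + (p 0 * p 0 + p 2 * p 2) * this

theorem average_pos {F : E3 → ℝ} (hF : Continuous F) {w : ℝ → ℝ} (hw : Continuous w)
    {J : E3 →L[ℝ] E3} {T : ℝ} (hT : 0 < T) (hw0 : ∀ t ∈ Ioo 0 T, 0 < w t) {p : E3}
    (h : ∀ t, 0 < F (rotation J t p)) : 0 < average w T J F p := by
  have := (contDiff_rotation J).continuous
  refine intervalIntegral.intervalIntegral_pos_of_pos_on
    (Continuous.intervalIntegrable (by fun_prop) _ _) (fun t ht ↦ mul_pos (hw0 t ht) (h t)) hT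

theorem average_neg (w : ℝ → ℝ) (T : ℝ) (J : E3 →L[ℝ] E3) (F : E3 → ℝ) :
    average w T J (-F) = -average w T J F := by
  ext p; simp [average, intervalIntegral.integral_neg]

/-- The average of a function over the rotation group, in Euler angles. -/
def sphericalMean (F : E3 → ℝ) : E3 → ℝ :=
  average (fun _ ↦ (2 * Real.pi)⁻¹) (2 * Real.pi) (crossL ez)
    (average (fun t ↦ Real.sin t / 2) Real.pi (crossL ey)
      (average (fun _ ↦ (2 * Real.pi)⁻¹) (2 * Real.pi) (crossL ez) F))

theorem sphericalMean_neg (F : E3 → ℝ) : sphericalMean (-F) = -sphericalMean F := by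
  simp [sphericalMean, average_neg]

theorem sphericalMean_pos {F : E3 → ℝ} (hF : ContDiff ℝ ∞ F) (h : ∀ p ∈ S2, 0 < F p) {p : E3}
    (hp : p ∈ S2) : 0 < sphericalMean F p := by
  have hs : ContDiff ℝ ∞ fun t ↦ Real.sin t / 2 := Real.contDiff_sin.div_const 2
  have hpi := Real.pi_pos
  have h1 := contDiff_average (J := crossL ez) hF
    (contDiff_const (c := (2 * Real.pi)⁻¹)) (2 * Real.pi)
  have h2 := contDiff_average (J := crossL ey) h1 hs Real.pi
  refine average_pos h2.continuous continuous_const (by positivity) (fun _ _ ↦ by positivity)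
    fun t ↦ ?_
  refine average_pos h1.continuous hs.continuous hpi
    (fun t ht ↦ div_pos (Real.sin_pos_of_pos_of_lt_pi ht.1 ht.2) two_pos) fun s ↦ ?_
  refine average_pos hF.continuous continuous_const (by positivity) (fun _ _ ↦ by positivity)
    fun r ↦ h _ ?_
  exact rotation_ez_mem_S2 (rotation_ey_mem_S2 (rotation_ez_mem_S2 hp _) _) _

theorem fderiv_average_ez (F : E3 → ℝ) (hF : ContDiff ℝ ∞ F) (p : E3) :
    fderiv ℝ (average (fun _ ↦ (2 * Real.pi)⁻¹) (2 * Real.pi) (crossL ez) F) p (crossL ez p)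
      = 0 := by
  rw [fderiv_average_generator crossL_ez_cube hF contDiff_const, rotation_two_pi]
  simp [average]

/-- The mean is invariant under rotations about both axes, and a `z`-rotation followed by a
`y`-rotation carries any point of the sphere to `ez`. -/
theorem sphericalMean_eq_const {F : E3 → ℝ} (hF : ContDiff ℝ ∞ F) {p : E3} (hp : p ∈ S2) :
    sphericalMean F p = sphericalMean F ez := by
  have hs : ContDiff ℝ ∞ fun t ↦ Real.sin t / 2 := Real.contDiff_sin.div_const 2
  have h1 := contDiff_average (J := crossL ez) hF
    (contDiff_const (c := (2 * Real.pi)⁻¹)) (2 * Real.pi)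
  have h2 := contDiff_average (J := crossL ey) h1 hs Real.pi
  have h3 : ContDiff ℝ ∞ (sphericalMean F) := contDiff_average h2 contDiff_const _
  obtain ⟨t, ht⟩ := exists_rotation_ez_coord_eq_zero p
  obtain ⟨s, hs⟩ := exists_rotation_ey_eq_ez (rotation_ez_mem_S2 hp t) ht
  rw [← apply_rotation_of_fderiv_eq_zero crossL_ez_cube h3 (fderiv_average_ez _ h2) t p,
    ← apply_rotation_of_fderiv_eq_zero crossL_ey_cube h3
      (fderiv_spherical_average_ey h1 (fderiv_average_ez F hF)) s, hs]

/-- A smooth function on the sphere differs from its mean by derivatives along rotations. -/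
theorem exists_sphericalMean_sub_eq {F : E3 → ℝ} (hF : ContDiff ℝ ∞ F) :
    ∃ G H : E3 → ℝ, ContDiff ℝ ∞ G ∧ ContDiff ℝ ∞ H ∧ ∀ p ∈ S2,
      sphericalMean F ez - F p = fderiv ℝ G p (crossL ez p) + fderiv ℝ H p (crossL ey p) := by
  have hpi := Real.pi_pos
  -- `W` and `U` are the antiderivatives of minus the weights which fall from `1` to `0`. The three
  -- averages in `sphericalMean` each contribute one derivative, and the differences telescope.
  let W : ℝ → ℝ := fun t ↦ 1 - (2 * Real.pi)⁻¹ * t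
  let U : ℝ → ℝ := fun t ↦ (1 + Real.cos t) / 2
  have hW : ContDiff ℝ ∞ W := by fun_prop
  have hU : ContDiff ℝ ∞ U := by
    have : ContDiff ℝ ∞ Real.cos := Real.contDiff_cos
    fun_prop
  have dW : (fun t ↦ -deriv W t) = fun _ ↦ (2 * Real.pi)⁻¹ := by
    ext t; simp [W]
  have dU : (fun t ↦ -deriv U t) = fun t ↦ Real.sin t / 2 := by
    ext t; simp [U, neg_div]
  have hs : ContDiff ℝ ∞ fun t ↦ Real.sin t / 2 := Real.contDiff_sin.div_const 2
  have W0 : W 0 = 1 := by simp [W]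
  have WT : W (2 * Real.pi) = 0 := by simp only [W]; field_simp; simp
  have U0 : U 0 = 1 := by simp [U]
  have UT : U Real.pi = 0 := by simp [U]
  have h1 := contDiff_average (J := crossL ez) hF
    (contDiff_const (c := (2 * Real.pi)⁻¹)) (2 * Real.pi)
  have h2 := contDiff_average (J := crossL ey) h1 hs Real.pi
  have e1 := average_sub_eq_fderiv crossL_ez_cube hF hW W0 WT
  have e2 := average_sub_eq_fderiv crossL_ey_cube h1 hU U0 UT
  have e3 := average_sub_eq_fderiv crossL_ez_cube h2 hW W0 WT
  rw [dW] at e1 e3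
  rw [dU] at e2
  have g1 := contDiff_average (J := crossL ez) hF hW (2 * Real.pi)
  have g3 := contDiff_average (J := crossL ez) h2 hW (2 * Real.pi)
  refine ⟨_, _, g1.add g3, contDiff_average (J := crossL ey) h1 hU Real.pi, fun p hp ↦ ?_⟩
  rw [← sphericalMean_eq_const hF hp, fderiv_fun_add (g1.differentiable (by simp) p)
    (g3.differentiable (by simp) p), add_apply, ← e1, ← e2, ← e3]
  simp only [sphericalMean]
  ring

/-! ### One-forms -/

section OneForm

variable {E : Type*} [NormedAddCommGroup E] [NormedSpace ℝ E]

/-- Covectors as alternating forms of degree one. -/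
def oneForm : (E →L[ℝ] ℝ) →L[ℝ] E [⋀^Fin 1]→L[ℝ] ℝ :=
  (ContinuousAlternatingMap.ofSubsingletonLIE (𝕜 := ℝ) (E := E) (F := ℝ)
    (0 : Fin 1)).toContinuousLinearEquiv.toContinuousLinearMap

@[simp] theorem oneForm_apply (L : E →L[ℝ] ℝ) (v : Fin 1 → E) : oneForm L v = L (v 0) := rfl

theorem extDeriv_pair {τ : E → E [⋀^Fin 1]→L[ℝ] ℝ} {p : E} (h : DifferentiableAt ℝ τ p)
    (a b : E) : extDeriv τ p ![a, b] =
      fderiv ℝ (fun q ↦ τ q ![b]) p a - fderiv ℝ (fun q ↦ τ q ![a]) p b := by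
  rw [extDeriv_apply h, Fin.sum_univ_two]
  have e0 : Fin.removeNth (0 : Fin 2) ![a, b] = ![b] := by ext i; fin_cases i; rfl
  have e1 : Fin.removeNth (1 : Fin 2) ![a, b] = ![a] := by ext i; fin_cases i; rfl
  rw [e0, e1]
  simp [sub_eq_add_neg]

end OneForm

section TwoForm

variable {E : Type*} [NormedAddCommGroup E] [NormedSpace ℝ E]

theorem twoForm_swap (Ω : E [⋀^Fin 2]→L[ℝ] ℝ) (a b : E) : Ω ![a, b] = -Ω ![b, a] := by
  have h := Ω.toAlternatingMap.map_swap ![b, a] (i := 0) (j := 1) (by decide)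
  have e : ![b, a] ∘ Equiv.swap (0 : Fin 2) 1 = ![a, b] := by
    ext i; fin_cases i <;> simp
  rw [e] at h
  exact h

/-- The bilinear map of a two-form. -/
def twoFormBilin (Ω : E [⋀^Fin 2]→L[ℝ] ℝ) : E →ₗ[ℝ] E →ₗ[ℝ] ℝ :=
  have add_left (a b c) : Ω ![a + b, c] = Ω ![a, c] + Ω ![b, c] := Ω.map_vecCons_add _ a b
  have smul_left (r : ℝ) (a c) : Ω ![r • a, c] = r • Ω ![a, c] := Ω.map_vecCons_smul _ r a
  LinearMap.mk₂ ℝ (fun a b ↦ Ω ![a, b]) add_left smul_left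
    (fun a b c ↦ by rw [twoForm_swap, add_left, twoForm_swap Ω a b, twoForm_swap Ω a c]; ring)
    (fun r a b ↦ by rw [twoForm_swap, smul_left, twoForm_swap Ω a b]; simp)

theorem twoFormBilin_apply (Ω : E [⋀^Fin 2]→L[ℝ] ℝ) (a b : E) :
    twoFormBilin Ω a b = Ω ![a, b] := rfl

theorem twoForm_self (Ω : E [⋀^Fin 2]→L[ℝ] ℝ) (a : E) : Ω ![a, a] = 0 := by
  have := twoForm_swap Ω a a
  linarith

end TwoForm

/-! ### Two-forms on the sphere and their exact parts -/

/-- The unit vector of the first coordinate axis. -/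
def ex : E3 := !₂[1, 0, 0]

@[simp] theorem ex_zero : ex 0 = 1 := rfl
@[simp] theorem ex_one : ex 1 = 0 := rfl
@[simp] theorem ex_two : ex 2 = 0 := rfl

theorem eq_coord_sum (a : E3) : a = a 0 • ex + a 1 • ey + a 2 • ez := by
  apply ext_coord <;> simp

/-- The density of a two-form on the sphere with respect to the round area form. -/
def sphereDensity (Ω : E3 → E3 [⋀^Fin 2]→L[ℝ] ℝ) (x : E3) : ℝ :=
  x 0 * Ω x ![ey, ez] + x 1 * Ω x ![ez, ex] + x 2 * Ω x ![ex, ey]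

theorem contDiff_coord (i : Fin 3) : ContDiff ℝ ∞ fun x : E3 ↦ x i :=
  (EuclideanSpace.proj (𝕜 := ℝ) i).contDiff

theorem contDiff_sphereDensity {Ω : E3 → E3 [⋀^Fin 2]→L[ℝ] ℝ} (h : ContDiff ℝ ∞ Ω) :
    ContDiff ℝ ∞ (sphereDensity Ω) := by
  have h' : ∀ v : Fin 2 → E3, ContDiff ℝ ∞ fun x ↦ Ω x v := fun v ↦
    (ContinuousAlternatingMap.apply ℝ E3 ℝ v).contDiff.comp h
  exact (((contDiff_coord 0).mul (h' _)).add ((contDiff_coord 1).mul (h' _))).add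
    ((contDiff_coord 2).mul (h' _))

/-- Both vectors are orthogonal to the unit vector `x`, so their cross product is a multiple of `x`.
-/
theorem cross_eq_det3_smul {x a b : E3} (hx : x ∈ S2) (ha : a ∈ tangentS2 x)
    (hb : b ∈ tangentS2 x) : cross a b = det3 x a b • x := by
  rw [mem_S2_iff] at hx
  rw [mem_tangentS2_iff] at ha hb
  apply ext_coord <;> simp [det3]
  · linear_combination (-(a 1 * b 2 - a 2 * b 1)) * hx
      - (-(x 1 * b 2) + x 2 * b 1) * ha + (-(x 1 * a 2) + x 2 * a 1) * hb
  · linear_combination (-(a 2 * b 0 - a 0 * b 2)) * hx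
      - (-(x 2 * b 0) + x 0 * b 2) * ha + (-(x 2 * a 0) + x 0 * a 2) * hb
  · linear_combination (-(a 0 * b 1 - a 1 * b 0)) * hx
      - (-(x 0 * b 1) + x 1 * b 0) * ha + (-(x 0 * a 1) + x 1 * a 0) * hb

/-- A two-form on three-space is linear in `cross a b`, which here is a multiple of `x`. -/
theorem twoForm_eq_sphereDensity {Ω : E3 → E3 [⋀^Fin 2]→L[ℝ] ℝ} {x a b : E3} (hx : x ∈ S2)
    (ha : a ∈ tangentS2 x) (hb : b ∈ tangentS2 x) :
    Ω x ![a, b] = sphereDensity Ω x * det3 x a b := by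
  have hc := cross_eq_det3_smul hx ha hb
  have h0 : a 1 * b 2 - a 2 * b 1 = det3 x a b * x 0 := congrArg (fun v : E3 ↦ v 0) hc
  have h1 : a 2 * b 0 - a 0 * b 2 = det3 x a b * x 1 := congrArg (fun v : E3 ↦ v 1) hc
  have h2 : a 0 * b 1 - a 1 * b 0 = det3 x a b * x 2 := congrArg (fun v : E3 ↦ v 2) hc
  have : twoFormBilin (Ω x) a b = (a 1 * b 2 - a 2 * b 1) * Ω x ![ey, ez]
      + (a 2 * b 0 - a 0 * b 2) * Ω x ![ez, ex] + (a 0 * b 1 - a 1 * b 0) * Ω x ![ex, ey] := by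
    conv_lhs => rw [eq_coord_sum a, eq_coord_sum b]
    simp only [map_add, map_smul, LinearMap.add_apply, LinearMap.smul_apply, twoFormBilin_apply,
      twoForm_self, twoForm_swap (Ω x) ey ex, twoForm_swap (Ω x) ez ey, twoForm_swap (Ω x) ex ez,
      smul_eq_mul]
    ring
  rw [← twoFormBilin_apply, this, h0, h1, h2, sphereDensity]
  ring

/-- Non-degeneracy forbids zeros of the density, and the sphere is connected. -/
theorem sphereDensity_pos_or_neg {Ω : E3 → E3 [⋀^Fin 2]→L[ℝ] ℝ} (h : ContDiff ℝ ∞ Ω)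
    (hΩ : ∀ x ∈ S2, ∀ u ∈ tangentS2 x, u ≠ 0 → ∃ w ∈ tangentS2 x, Ω x ![u, w] ≠ 0) :
    (∀ x ∈ S2, 0 < sphereDensity Ω x) ∨ (∀ x ∈ S2, sphereDensity Ω x < 0) := by
  have h0 : ∀ x ∈ S2, sphereDensity Ω x ≠ 0 := fun x hx h0 ↦ by
    obtain ⟨u, hu, hu0⟩ : ∃ u ∈ tangentS2 x, u ≠ 0 := by
      by_cases h1 : x 0 = 0 ∧ x 1 = 0
      · exact ⟨ex, by rw [mem_tangentS2_iff]; simp [h1], fun h ↦ by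
          simpa using congrArg (fun v : E3 ↦ v 0) h⟩
      · refine ⟨cross ez x, by rw [mem_tangentS2_iff]; simp; ring, fun h ↦ h1 ⟨?_, ?_⟩⟩
        · simpa using congrArg (fun v : E3 ↦ v 1) h
        · simpa using congrArg (fun v : E3 ↦ v 0) h
    obtain ⟨w, hw, hne⟩ := hΩ x hx u hu hu0
    exact hne (by rw [twoForm_eq_sphereDensity hx hu hw, h0, zero_mul])
  have hc : IsPreconnected S2 := by
    refine isPreconnected_sphere ?_ 0 1
    rw [← Module.finrank_eq_rank]; simp
  by_contra hcon
  push Not at hcon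
  obtain ⟨⟨a, ha, ha'⟩, b, hb, hb'⟩ := hcon
  obtain ⟨c, hc, hc'⟩ := hc.intermediate_value ha hb
    (contDiff_sphereDensity h).continuous.continuousOn ⟨ha', hb'⟩
  exact h0 c hc hc'

/-- A two-form on the sphere is a multiple of the round area form up to the differential of a
one-form; for an area form, the multiple has the sign of the density. -/
theorem exists_sphere_primitive {Ω : E3 → E3 [⋀^Fin 2]→L[ℝ] ℝ} (h : ContDiff ℝ ∞ Ω)
    (hΩ : ∀ x ∈ S2, ∀ u ∈ tangentS2 x, u ≠ 0 → ∃ w ∈ tangentS2 x, Ω x ![u, w] ≠ 0) :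
    ∃ (c : ℝ) (κ : E3 → E3 →L[ℝ] ℝ), ContDiff ℝ ∞ κ ∧ (∀ x ∈ S2, 0 < c * sphereDensity Ω x) ∧
      ∀ x ∈ S2, ∀ a ∈ tangentS2 x, ∀ b ∈ tangentS2 x,
        Ω x ![a, b] = c * det3 x a b + (fderiv ℝ κ x a b - fderiv ℝ κ x b a) := by
  have hF := contDiff_sphereDensity h
  have hez : ez ∈ S2 := by rw [mem_S2_iff]; simp
  obtain ⟨G, H, hG, hH, hGH⟩ := exists_sphericalMean_sub_eq hF
  have hκ : ContDiff ℝ ∞ fun x ↦ -(G x • EuclideanSpace.proj (𝕜 := ℝ) (2 : Fin 3)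
      + H x • EuclideanSpace.proj (𝕜 := ℝ) (1 : Fin 3) : E3 →L[ℝ] ℝ) := by fun_prop
  refine ⟨sphericalMean (sphereDensity Ω) ez, _, hκ, fun x hx ↦ ?_, fun x hx a ha b hb ↦ ?_⟩
  · rcases sphereDensity_pos_or_neg h hΩ with hp | hn
    · exact mul_pos (sphericalMean_pos hF hp hez) (hp x hx)
    · have := sphericalMean_pos hF.neg (fun x hx ↦ neg_pos.2 (hn x hx)) hez
      have e : (fun x ↦ -sphereDensity Ω x) = -sphereDensity Ω := rfl
      rw [e, sphericalMean_neg, Pi.neg_apply] at this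
      exact mul_pos_of_neg_of_neg (by linarith) (hn x hx)
  · have dG := (hG.differentiable (by simp) x).hasFDerivAt
    have dH := (hH.differentiable (by simp) x).hasFDerivAt
    have hd := ((dG.smul_const (EuclideanSpace.proj (𝕜 := ℝ) (2 : Fin 3) : E3 →L[ℝ] ℝ)).fun_add
      (dH.smul_const (EuclideanSpace.proj (𝕜 := ℝ) (1 : Fin 3) : E3 →L[ℝ] ℝ))).fun_neg.fderiv
    rw [hd]
    -- For a function `G`, `d(G ⟪e, ·⟫)(a, b)` is `dG` on the left-hand vector. So the derivative of
    -- `G` along the rotation field of `e` is the density of an exact form.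
    have key : ∀ e : E3, ⟪b, e⟫ • a - ⟪a, e⟫ • b = det3 x a b • crossL e x := by
      intro e
      rw [← map_smul, ← cross_eq_det3_smul hx ha hb, inner_eq_coord, inner_eq_coord]
      apply ext_coord <;> simp <;> ring
    have kz := congrArg (fderiv ℝ G x) (key ez)
    have ky := congrArg (fderiv ℝ H x) (key ey)
    simp only [inner_eq_coord, map_sub, map_smul, smul_eq_mul, ez_zero, ez_one, ez_two, ey_zero,
      ey_one, ey_two] at kz ky
    have := hGH x hx
    rw [twoForm_eq_sphereDensity hx ha hb]
    simp
    linear_combination (-det3 x a b) * this + kz + ky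

/-! ### The round connection form and a primitive of `π^*σ` -/

theorem inner_cross_eq_det3 (x v w : E3) : ⟪cross x v, w⟫ = det3 x v w := by
  rw [inner_eq_coord]; simp [det3]; ring

/-- The cross product as a bilinear map. -/
def crossB : E3 →L[ℝ] E3 →L[ℝ] E3 :=
  LinearMap.toContinuousLinearMap
    { toFun := crossL
      map_add' := fun a b ↦ by ext1 c; apply ext_coord <;> simp <;> ring
      map_smul' := fun r a ↦ by ext1 c; apply ext_coord <;> simp <;> ring }

@[simp] theorem crossB_apply (a b : E3) : crossB a b = cross a b := rfl

theorem hasFDerivAt_det3 (p : E6) (w : E3) :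
    ∃ L : E6 →L[ℝ] ℝ, HasFDerivAt (fun q : E6 ↦ det3 q.1 q.2 w) L p ∧
      ∀ a, L a = det3 a.1 p.2 w + det3 p.1 a.2 w := by
  have h := ((innerSL ℝ w).hasFDerivAt.comp p
    ((crossB.hasFDerivAt.comp p (hasFDerivAt_fst (𝕜 := ℝ) (p := p))).clm_apply
      (hasFDerivAt_snd (𝕜 := ℝ) (p := p))))
  refine ⟨_, h.congr_of_eventuallyEq (.of_forall fun q ↦ ?_), fun a ↦ ?_⟩
  · simp [← inner_cross_eq_det3, real_inner_comm]
  · simp [← inner_cross_eq_det3, real_inner_comm, add_comm]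

/-- The differential of the round connection form, before normalization of the fibre vector. -/
theorem round_connection_identity {x v a₁ a₂ b₁ b₂ : E3} (hx : x ∈ S2) (hv : v ∈ tangentS2 x)
    (ha : a₁ ∈ tangentS2 x) (hb : b₁ ∈ tangentS2 x) (ha' : ⟪a₁, v⟫ + ⟪x, a₂⟫ = 0)
    (hb' : ⟪b₁, v⟫ + ⟪x, b₂⟫ = 0) :
    -(⟪v, v⟫ * (det3 a₁ v b₂ + det3 x a₂ b₂ - (det3 b₁ v a₂ + det3 x b₂ a₂)))
      + 2 * ⟪v, a₂⟫ * det3 x v b₂ - 2 * ⟪v, b₂⟫ * det3 x v a₂ = ⟪v, v⟫ ^ 2 * det3 x a₁ b₁ := by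
  have e1 : 2 * ⟪v, a₂⟫ * det3 x v b₂ - 2 * ⟪v, b₂⟫ * det3 x v a₂
      = 2 * ⟪v, v⟫ * det3 x a₂ b₂ := by
    have hv' := mem_tangentS2_iff.1 hv
    simp only [inner_eq_coord, det3]
    linear_combination 2 * (-(v 0 * (a₂ 1 * b₂ 2 - a₂ 2 * b₂ 1) + v 1 * (a₂ 2 * b₂ 0 - a₂ 0 * b₂ 2)
      + v 2 * (a₂ 0 * b₂ 1 - a₂ 1 * b₂ 0))) * hv'
  have e2 : det3 a₁ v b₂ = -(det3 x a₁ v * ⟪b₁, v⟫) := by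
    rw [← inner_cross_eq_det3, cross_eq_det3_smul hx ha hv, inner_smul_left, eq_neg_of_add_eq_zero_right hb']
    simp
  have e3 : det3 b₁ v a₂ = -(det3 x b₁ v * ⟪a₁, v⟫) := by
    rw [← inner_cross_eq_det3, cross_eq_det3_smul hx hb hv, inner_smul_left, eq_neg_of_add_eq_zero_right ha']
    simp
  have e4 : det3 x a₁ v * ⟪b₁, v⟫ - det3 x b₁ v * ⟪a₁, v⟫ = ⟪v, v⟫ * det3 x a₁ b₁ := by
    have : det3 x a₁ v * ⟪b₁, v⟫ - det3 x b₁ v * ⟪a₁, v⟫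
        = det3 x (cross v (cross a₁ b₁)) v := by
      simp only [inner_eq_coord, det3, cross_zero_coord, cross_one_coord, cross_two_coord]; ring
    rw [this, cross_eq_det3_smul hx ha hb]
    have hx' := mem_S2_iff.1 hx
    have hv' := mem_tangentS2_iff.1 hv
    rw [inner_eq_coord]
    generalize det3 x a₁ b₁ = D
    simp only [det3, cross_zero_coord, cross_one_coord, cross_two_coord, PiLp.smul_apply, smul_eq_mul]
    linear_combination D * (v 0 * v 0 + v 1 * v 1 + v 2 * v 2) * hx' - D * (x 0 * v 0 + x 1 * v 1 + x 2 * v 2) * hv'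
  have e5 : det3 x b₂ a₂ = -det3 x a₂ b₂ := by simp only [det3]; ring
  rw [e2, e3, e5]
  linear_combination e1 + ⟪v, v⟫ * e4

namespace MagneticSystem

variable (M : MagneticSystem)

theorem contDiff_energy : ContDiff ℝ ∞ M.energy := by
  have := M.g_smooth
  unfold energy
  fun_prop

/-- A smooth function without zeros which is the squared round norm of the fibre vector on the
unit tangent bundle. -/
def roundNormSq (p : E6) : ℝ := ⟪p.2, p.2⟫ + (1 - 2 * M.energy p) ^ 2

/-- Where `v ≠ 0` the first summand is positive; where `v = 0` the energy vanishes and the second is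
`1`. This keeps `roundConnection` smooth on the whole ambient space. -/
theorem roundNormSq_ne_zero (p : E6) : M.roundNormSq p ≠ 0 := by
  have h1 : 0 ≤ ⟪p.2, p.2⟫ := real_inner_self_nonneg
  have h2 := sq_nonneg (1 - 2 * M.energy p)
  intro h
  unfold roundNormSq at h
  have h3 : ⟪p.2, p.2⟫ = 0 := by linarith
  have h4 : p.2 = 0 := inner_self_eq_zero.1 h3
  rw [h3] at h
  simp [energy, h4] at h

theorem contDiff_roundNormSq : ContDiff ℝ ∞ M.roundNormSq := by
  have := M.contDiff_energy
  exact (contDiff_snd.inner ℝ contDiff_snd).add (by fun_prop)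

/-- The connection form of the round metric, up to sign. -/
def roundConnection (p : E6) : E6 →L[ℝ] ℝ :=
  -((M.roundNormSq p)⁻¹ • (innerSL ℝ (crossB p.1 p.2)).comp (ContinuousLinearMap.snd ℝ E3 E3))

theorem roundConnection_apply (p a : E6) :
    M.roundConnection p a = -((M.roundNormSq p)⁻¹ * det3 p.1 p.2 a.2) := by
  simp [roundConnection, ← inner_cross_eq_det3]

theorem contDiff_roundConnection : ContDiff ℝ ∞ M.roundConnection := by
  have h1 := M.contDiff_roundNormSq.inv M.roundNormSq_ne_zero
  have h2 : ContDiff ℝ ∞ fun p : E6 ↦ crossB p.1 p.2 := by fun_prop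
  have h3 : ContDiff ℝ ∞ fun p : E6 ↦ innerSL ℝ (crossB p.1 p.2) := (innerSL ℝ).contDiff.comp h2
  exact (h1.smul (h3.clm_comp contDiff_const)).neg

theorem mem_unitBundle {p : E6} : p ∈ M.unitBundle ↔
    p.1 ∈ S2 ∧ p.2 ∈ tangentS2 p.1 ∧ M.g p.1 p.2 p.2 = 1 := by
  simp only [unitBundle, energy, mem_ofPred_eq]
  refine and_congr_right fun _ ↦ and_congr_right fun _ ↦ ?_
  constructor <;> intro h <;> linarith

theorem mem_tangentUnitBundle {p ξ : E6} : ξ ∈ M.tangentUnitBundle p ↔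
    ξ.1 ∈ tangentS2 p.1 ∧ ⟪ξ.1, p.2⟫ + ⟪p.1, ξ.2⟫ = 0 ∧ fderiv ℝ M.energy p ξ = 0 := by
  simp only [tangentUnitBundle, tangentTS2, mem_tangentS2, mem_ofPred_eq, and_assoc]

theorem roundNormSq_eq {p : E6} (hp : p ∈ M.unitBundle) : M.roundNormSq p = ⟪p.2, p.2⟫ := by
  simp [roundNormSq, hp.2.2]

/-- The correction `(1 - 2E)²` vanishes to second order on the unit tangent bundle, so it does not
affect first derivatives there. -/
theorem hasFDerivAt_roundNormSq {p : E6} (hp : p ∈ M.unitBundle) :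
    ∃ L : E6 →L[ℝ] ℝ, HasFDerivAt M.roundNormSq L p ∧ ∀ a, L a = 2 * ⟪p.2, a.2⟫ := by
  have h1 := (hasFDerivAt_snd (𝕜 := ℝ) (p := p)).inner ℝ (hasFDerivAt_snd (𝕜 := ℝ) (p := p))
  have h2 := (((M.contDiff_energy.differentiable (by simp) p).hasFDerivAt.const_mul 2).const_sub
    1).pow 2
  refine ⟨_, h1.fun_add h2, fun a ↦ ?_⟩
  simp [hp.2.2, real_inner_comm, two_mul]

theorem fderiv_roundConnection {p : E6} (hp : p ∈ M.unitBundle) (a b : E6) :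
    fderiv ℝ M.roundConnection p a b = -(⟪p.2, p.2⟫⁻¹ * (det3 a.1 p.2 b.2 + det3 p.1 a.2 b.2)
      - (⟪p.2, p.2⟫ ^ 2)⁻¹ * (2 * ⟪p.2, a.2⟫) * det3 p.1 p.2 b.2) := by
  have hd := M.contDiff_roundConnection.differentiable (by simp) p
  have e : fderiv ℝ M.roundConnection p a b = fderiv ℝ (fun q ↦ M.roundConnection q b) p a := by
    rw [(hd.hasFDerivAt.clm_apply (hasFDerivAt_const b p)).fderiv]
    simp
  rw [e]
  simp only [roundConnection_apply]
  obtain ⟨L, hL, hL'⟩ := hasFDerivAt_det3 p b.2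
  obtain ⟨K, hK, hK'⟩ := M.hasFDerivAt_roundNormSq hp
  have hq := (hasDerivAt_inv (M.roundNormSq_ne_zero p)).comp_hasFDerivAt p hK
  have h := (hq.mul hL).neg.fderiv
  have e2 : (fun q : E6 ↦ -((M.roundNormSq q)⁻¹ * det3 q.1 q.2 b.2)) =
      -(((fun y ↦ y⁻¹) ∘ M.roundNormSq) * fun q : E6 ↦ det3 q.1 q.2 b.2) := rfl
  rw [e2, h]
  simp [hL', hK', M.roundNormSq_eq hp]
  ring

/-- The round sphere has curvature one. As `v` has `g`-length one, not round length one, the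
derivative of the factor `⟪v, v⟫⁻¹` also enters. -/
theorem roundConnection_curvature {p : E6} (hp : p ∈ M.unitBundle) {a b : E6}
    (ha : a ∈ M.tangentUnitBundle p) (hb : b ∈ M.tangentUnitBundle p) :
    fderiv ℝ M.roundConnection p a b - fderiv ℝ M.roundConnection p b a = det3 p.1 a.1 b.1 := by
  rw [mem_tangentUnitBundle] at ha hb
  have h := round_connection_identity hp.1 hp.2.1 ha.1 hb.1 ha.2.1 hb.2.1
  have hq : ⟪p.2, p.2⟫ ≠ 0 := by
    rw [← M.roundNormSq_eq hp]; exact M.roundNormSq_ne_zero p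
  rw [M.fderiv_roundConnection hp, M.fderiv_roundConnection hp]
  field_simp
  linear_combination h

/-- The pull-back of the magnetic form to the unit tangent bundle is exact, with a primitive which
is negative on positively oriented vertical vectors. -/
theorem exists_primitive_magnetic : ∃ θ : E6 → E6 [⋀^Fin 1]→L[ℝ] ℝ, ContDiff ℝ ∞ θ ∧
    (∀ p ∈ M.unitBundle, ∀ a ∈ M.tangentUnitBundle p, ∀ b ∈ M.tangentUnitBundle p,
      extDeriv θ p ![a, b] = M.σ p.1 ![a.1, b.1]) ∧
    ∀ p ∈ M.unitBundle, ∀ w ∈ tangentS2 p.1, 0 < M.σ p.1 ![p.2, w] → θ p ![(0, w)] < 0 := by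
  obtain ⟨c, κ, hκ, hc, hσ⟩ := exists_sphere_primitive M.σ_smooth M.σ_nondeg
  have hκ' : ContDiff ℝ ∞ fun p : E6 ↦ (κ p.1).comp (ContinuousLinearMap.fst ℝ E3 E3) :=
    (hκ.comp contDiff_fst).clm_comp contDiff_const
  have hL : ContDiff ℝ ∞ fun p : E6 ↦ c • M.roundConnection p
      + (κ p.1).comp (ContinuousLinearMap.fst ℝ E3 E3) :=
    (M.contDiff_roundConnection.const_smul c).add hκ'
  have hθ : ContDiff ℝ ∞ fun p : E6 ↦ oneForm (c • M.roundConnection p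
      + (κ p.1).comp (ContinuousLinearMap.fst ℝ E3 E3)) :=
    hL.continuousLinearMap_comp oneForm
  refine ⟨fun p ↦ oneForm (c • M.roundConnection p
    + (κ p.1).comp (ContinuousLinearMap.fst ℝ E3 E3)), hθ,
    fun p hp a ha b hb ↦ ?_, fun p hp w hw hpos ↦ ?_⟩
  · rw [extDeriv_pair (hθ.differentiable (by simp) p)]
    have hd : ∀ a b : E6, fderiv ℝ (fun q : E6 ↦ oneForm (c • M.roundConnection q
        + (κ q.1).comp (ContinuousLinearMap.fst ℝ E3 E3)) ![b]) p a =
        c * fderiv ℝ M.roundConnection p a b + fderiv ℝ κ p.1 a.1 b.1 := fun a b ↦ by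
      have h1 := (M.contDiff_roundConnection.differentiable (by simp) p).hasFDerivAt
      have h2 := (hκ.differentiable (by simp) p.1).hasFDerivAt.comp p
        (hasFDerivAt_fst (𝕜 := ℝ) (p := p))
      have h3 := ((h1.clm_apply (hasFDerivAt_const b p)).const_mul c).fun_add
        (h2.clm_apply (hasFDerivAt_const b.1 p))
      have e : (fun q : E6 ↦ oneForm (c • M.roundConnection q
        + (κ q.1).comp (ContinuousLinearMap.fst ℝ E3 E3)) ![b]) =
        fun q ↦ c * M.roundConnection q b + (κ ∘ Prod.fst) q b.1 := by ext q; simp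
      rw [e, h3.fderiv]
      simp
    rw [hd, hd]
    have h := M.roundConnection_curvature hp ha hb
    rw [mem_tangentUnitBundle] at ha hb
    rw [hσ p.1 hp.1 a.1 ha.1 b.1 hb.1]
    linear_combination c * h
  · have hq : 0 < ⟪p.2, p.2⟫ := lt_of_le_of_ne real_inner_self_nonneg
      (by rw [← M.roundNormSq_eq hp]; exact (M.roundNormSq_ne_zero p).symm)
    rw [twoForm_eq_sphereDensity hp.1 hp.2.1 hw] at hpos
    have h1 := hc p.1 hp.1
    -- The constant `c` has the sign of the density of `σ`, so the sign of `c * det3` is that of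
    -- `σ(v, w)`; the pulled-back `κ` does not see vertical vectors.
    have h2 : 0 < c * det3 p.1 p.2 w := by
      rcases pos_and_pos_or_neg_and_neg_of_mul_pos hpos with h | h
      · exact mul_pos ((pos_iff_pos_of_mul_pos h1).2 h.1) h.2
      · exact mul_pos_of_neg_of_neg ((neg_iff_neg_of_mul_pos h1).2 h.1) h.2
    have h3 := mul_pos (inv_pos.2 hq) h2
    simp only [oneForm_apply, Matrix.cons_val_zero, add_apply, smul_apply, smul_eq_mul,
      roundConnection_apply, M.roundNormSq_eq hp, ContinuousLinearMap.comp_apply,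
      ContinuousLinearMap.coe_fst', map_zero, add_zero]
    linarith

end MagneticSystem

/-! ### Orthonormal frames of the tangent planes and the Levi-Civita connection -/

theorem plucker_tangentS2 {x u w r : E3} (hx : x ∈ S2) (hu : u ∈ tangentS2 x)
    (hw : w ∈ tangentS2 x) (hr : r ∈ tangentS2 x) :
    det3 x u w • r = det3 x u r • w - det3 x w r • u := by
  -- The three vectors lie in the plane `x^⊥`, so the linear relation among `x, u, w, r` in
  -- three-space loses its `x`-term.
  have h : det3 u w r = 0 := by
    rw [← inner_cross_eq_det3, cross_eq_det3_smul hx hu hw, inner_smul_left, mem_tangentS2.1 hr,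
      mul_zero]
  have h' : det3 u w r • x - det3 x w r • u + det3 x u r • w - det3 x u w • r = 0 := by
    apply ext_coord <;> simp [det3] <;> ring
  rw [h, zero_smul] at h'
  rw [eq_comm, ← sub_eq_zero, ← h']
  module

theorem cross_mem_tangentS2 (x u : E3) : cross x u ∈ tangentS2 x := by
  rw [mem_tangentS2_iff]; simp; ring

theorem smul_eq_add_cross {x u w : E3} (hx : x ∈ S2) (hu : u ∈ tangentS2 x)
    (hw : w ∈ tangentS2 x) : ⟪u, u⟫ • w = ⟪u, w⟫ • u + det3 x u w • cross x u := by
  have hx' := mem_S2_iff_inner.1 hx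
  have hu' := mem_tangentS2.1 hu
  have h := plucker_tangentS2 hx hu (cross_mem_tangentS2 x u) hw
  have e1 : det3 x u (cross x u) = ⟪x, x⟫ * ⟪u, u⟫ - ⟪x, u⟫ ^ 2 := by
    simp only [det3, inner_eq_coord, cross_zero_coord, cross_one_coord, cross_two_coord]; ring
  have e2 : det3 x (cross x u) w = ⟪x, u⟫ * ⟪x, w⟫ - ⟪x, x⟫ * ⟪u, w⟫ := by
    simp only [det3, inner_eq_coord, cross_zero_coord, cross_one_coord, cross_two_coord]; ring
  rw [e1, e2, hx', hu'] at h
  simp only [one_mul, zero_mul, zero_sub, ne_eq, OfNat.ofNat_ne_zero, not_false_eq_true, zero_pow,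
    sub_zero, neg_smul, sub_neg_eq_add] at h
  rw [h]; module

namespace MagneticSystem

variable (M : MagneticSystem)

theorem eq_zero_of_g_self {x u : E3} (hx : x ∈ S2) (hu : u ∈ tangentS2 x) (h : M.g x u u = 0) :
    u = 0 := by
  by_contra h0
  exact (M.g_pos x hx u hu h0).ne' h

/-- Pairing the Plücker relation with `r` gives `det3 x u w * g(r, r) = 0`. If the determinant
vanished, `u` and `w` would be parallel as well as `g`-orthogonal, and one of them would be zero. -/
theorem eq_zero_of_orthogonal {x u w r : E3} (hx : x ∈ S2) (hu : u ∈ tangentS2 x)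
    (hw : w ∈ tangentS2 x) (hr : r ∈ tangentS2 x) (hu0 : u ≠ 0) (hw0 : w ≠ 0)
    (huw : M.g x u w = 0) (hur : M.g x u r = 0) (hwr : M.g x w r = 0) : r = 0 := by
  have h1 := congrArg (M.g x r) (plucker_tangentS2 hx hu hw hr)
  simp only [map_smul, map_sub, smul_eq_mul, M.g_symm x r u, M.g_symm x r w, hur, hwr] at h1
  rcases mul_eq_zero.1 (h1.trans (by ring)) with h | h
  · have h2 := congrArg (M.g x w) (smul_eq_add_cross hx hu hw)
    rw [h, zero_smul, add_zero, map_smul, map_smul, M.g_symm x w u, huw] at h2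
    have h4 := (M.g_pos x hx w hw hw0).ne'
    simp [h4] at h2
    exact absurd h2 hu0
  · exact M.eq_zero_of_g_self hx hr h

/-- Gram–Schmidt applied to `u` and `cross x u` gives the direction, rescaling the length, and `σ`
selects one of the two signs. -/
theorem rot_spec {x u : E3} (hx : x ∈ S2) (hu : u ∈ tangentS2 x) :
    M.rot x u ∈ tangentS2 x ∧ M.g x (M.rot x u) u = 0 ∧
      M.g x (M.rot x u) (M.rot x u) = M.g x u u ∧ 0 ≤ M.σ x ![u, M.rot x u] := by
  suffices h : ∃ w, w ∈ tangentS2 x ∧ M.g x w u = 0 ∧ M.g x w w = M.g x u u ∧ 0 ≤ M.σ x ![u, w] from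
    Classical.epsilon_spec h
  suffices h : ∃ w, w ∈ tangentS2 x ∧ M.g x w u = 0 ∧ M.g x w w = M.g x u u by
    obtain ⟨w, h1, h2, h3⟩ := h
    rcases le_total 0 (M.σ x ![u, w]) with h | h
    · exact ⟨w, h1, h2, h3, h⟩
    · refine ⟨-w, neg_mem h1, by simp [h2], by simp [h3], ?_⟩
      rw [← twoFormBilin_apply, map_neg, twoFormBilin_apply]
      linarith
  by_cases hu0 : u = 0
  · exact ⟨0, zero_mem _, by simp, by simp [hu0]⟩
  have hg := M.g_pos x hx u hu hu0
  set w₀ := cross x u with hw₀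
  have hw₀' : w₀ ∈ tangentS2 x := cross_mem_tangentS2 x u
  set w₁ := w₀ - (M.g x w₀ u / M.g x u u) • u with hw₁
  have hm : w₁ ∈ tangentS2 x := sub_mem hw₀' (Submodule.smul_mem _ _ hu)
  have h1 : M.g x w₁ u = 0 := by simp [hw₁]; field_simp; ring
  have h2 : w₁ ≠ 0 := fun h ↦ by
    have : det3 x u w₁ = ⟪u, u⟫ := by
      have hx' := mem_S2_iff.1 hx
      have hu' := mem_tangentS2_iff.1 hu
      rw [hw₁, inner_eq_coord]
      simp only [det3, hw₀, cross_zero_coord, cross_one_coord, cross_two_coord, PiLp.sub_apply,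
        PiLp.smul_apply, smul_eq_mul]
      linear_combination (u 0 * u 0 + u 1 * u 1 + u 2 * u 2) * hx'
        - (x 0 * u 0 + x 1 * u 1 + x 2 * u 2) * hu'
    rw [h] at this
    exact hu0 (inner_self_eq_zero.1 (this.symm.trans (by simp [det3])))
  have hg1 := M.g_pos x hx w₁ hm h2
  refine ⟨Real.sqrt (M.g x u u / M.g x w₁ w₁) • w₁, Submodule.smul_mem _ _ hm, by simp [h1], ?_⟩
  simp only [map_smul, smul_apply, smul_eq_mul]
  rw [← mul_assoc, Real.mul_self_sqrt (by positivity)]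
  field_simp

section Frame

variable {M} {p : E6} (hp : p ∈ M.unitBundle)

theorem snd_ne_zero (hp : p ∈ M.unitBundle) : p.2 ≠ 0 := fun h ↦ by
  have := (M.mem_unitBundle.1 hp).2.2
  simp [h] at this

theorem g_snd_snd (hp : p ∈ M.unitBundle) : M.g p.1 p.2 p.2 = 1 := (M.mem_unitBundle.1 hp).2.2

theorem rot_mem (hp : p ∈ M.unitBundle) : M.rot p.1 p.2 ∈ tangentS2 p.1 :=
  (M.rot_spec hp.1 hp.2.1).1

theorem g_rot_snd (hp : p ∈ M.unitBundle) : M.g p.1 (M.rot p.1 p.2) p.2 = 0 :=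
  (M.rot_spec hp.1 hp.2.1).2.1

theorem g_snd_rot (hp : p ∈ M.unitBundle) : M.g p.1 p.2 (M.rot p.1 p.2) = 0 := by
  rw [M.g_symm, g_rot_snd hp]

theorem g_rot_rot (hp : p ∈ M.unitBundle) : M.g p.1 (M.rot p.1 p.2) (M.rot p.1 p.2) = 1 := by
  rw [(M.rot_spec hp.1 hp.2.1).2.2.1, g_snd_snd hp]

theorem rot_ne_zero (hp : p ∈ M.unitBundle) : M.rot p.1 p.2 ≠ 0 := fun h ↦ by
  have := g_rot_rot hp
  simp [h] at this

theorem eq_zero_of_g_eq_zero (hp : p ∈ M.unitBundle) {a : E3} (ha : a ∈ tangentS2 p.1)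
    (h1 : M.g p.1 p.2 a = 0) (h2 : M.g p.1 (M.rot p.1 p.2) a = 0) : a = 0 :=
  M.eq_zero_of_orthogonal hp.1 hp.2.1 (rot_mem hp) ha (snd_ne_zero hp) (rot_ne_zero hp)
    (g_snd_rot hp) h1 h2

theorem tangent_decomp (hp : p ∈ M.unitBundle) {a : E3} (ha : a ∈ tangentS2 p.1) :
    a = M.g p.1 p.2 a • p.2 + M.g p.1 (M.rot p.1 p.2) a • M.rot p.1 p.2 := by
  have hm : a - (M.g p.1 p.2 a • p.2 + M.g p.1 (M.rot p.1 p.2) a • M.rot p.1 p.2)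
      ∈ tangentS2 p.1 :=
    sub_mem ha (add_mem (Submodule.smul_mem _ _ hp.2.1) (Submodule.smul_mem _ _ (rot_mem hp)))
  exact sub_eq_zero.1 (eq_zero_of_g_eq_zero hp hm
    (by simp [g_snd_snd hp, g_snd_rot hp]) (by simp [g_rot_snd hp, g_rot_rot hp]))

theorem sigma_snd_rot_pos (hp : p ∈ M.unitBundle) : 0 < M.σ p.1 ![p.2, M.rot p.1 p.2] := by
  refine lt_of_le_of_ne (M.rot_spec hp.1 hp.2.1).2.2.2 fun h ↦ ?_
  obtain ⟨w, hw, hne⟩ := M.σ_nondeg p.1 hp.1 p.2 hp.2.1 (snd_ne_zero hp)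
  apply hne
  rw [← twoFormBilin_apply, tangent_decomp hp hw]
  simp only [map_add, map_smul, twoFormBilin_apply, twoForm_self, ← h]
  simp

theorem sigma_apply (hp : p ∈ M.unitBundle) {a b : E3} (ha : a ∈ tangentS2 p.1)
    (hb : b ∈ tangentS2 p.1) : M.σ p.1 ![a, b] = M.σ p.1 ![p.2, M.rot p.1 p.2] *
      (M.g p.1 p.2 a * M.g p.1 (M.rot p.1 p.2) b - M.g p.1 (M.rot p.1 p.2) a * M.g p.1 p.2 b) := by
  rw [← twoFormBilin_apply]
  conv_lhs => rw [tangent_decomp hp ha, tangent_decomp hp hb]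
  simp only [map_add, map_smul, LinearMap.add_apply, LinearMap.smul_apply, twoFormBilin_apply,
    twoForm_self, twoForm_swap (M.σ p.1) (M.rot p.1 p.2) p.2, smul_eq_mul]
  ring

theorem g_apply (hp : p ∈ M.unitBundle) {a b : E3} (ha : a ∈ tangentS2 p.1) :
    M.g p.1 a b = M.g p.1 p.2 a * M.g p.1 p.2 b
      + M.g p.1 (M.rot p.1 p.2) a * M.g p.1 (M.rot p.1 p.2) b := by
  conv_lhs => rw [tangent_decomp hp ha]
  simp

/-- In the orthonormal basis `(v, ȷv)` the rotated vector `w` is orthogonal to `a`, has its length,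
and satisfies `a₁w₂ - a₂w₁ ≥ 0`. Lagrange's identity makes this number equal to `|a|²`, which forces
`w = (-a₂, a₁)`. -/
theorem rot_apply (hp : p ∈ M.unitBundle) {a : E3} (ha : a ∈ tangentS2 p.1) :
    M.g p.1 p.2 (M.rot p.1 a) = -M.g p.1 (M.rot p.1 p.2) a ∧
      M.g p.1 (M.rot p.1 p.2) (M.rot p.1 a) = M.g p.1 p.2 a := by
  obtain ⟨h1, h2, h3, h4⟩ := M.rot_spec hp.1 ha
  rw [g_apply hp h1] at h2 h3
  rw [g_apply hp ha] at h3
  rw [sigma_apply hp ha h1] at h4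
  have h5 := (mul_nonneg_iff_of_pos_left (sigma_snd_rot_pos hp)).1 h4
  generalize M.g p.1 p.2 (M.rot p.1 a) = w₁ at *
  generalize M.g p.1 (M.rot p.1 p.2) (M.rot p.1 a) = w₂ at *
  generalize M.g p.1 p.2 a = a₁ at *
  generalize M.g p.1 (M.rot p.1 p.2) a = a₂ at *
  have hk : (a₁ * w₂ - a₂ * w₁) ^ 2 = (a₁ * a₁ + a₂ * a₂) ^ 2 := by
    linear_combination (a₁ * a₁ + a₂ * a₂) * h3 - (w₁ * a₁ + w₂ * a₂) * h2
  have hk' := (sq_eq_sq₀ h5 (add_nonneg (mul_self_nonneg _) (mul_self_nonneg _))).1 hk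
  have hs : (w₁ + a₂) ^ 2 + (w₂ - a₁) ^ 2 = 0 := by linear_combination h3 - 2 * hk'
  constructor <;> nlinarith [sq_nonneg (w₁ + a₂), sq_nonneg (w₂ - a₁)]

/-- The number `σ(v, ȷv)` satisfies the condition defining the strength, and that condition at the
pair `(v, ȷv)`, of area one, leaves no other choice. -/
theorem strength_eq (hp : p ∈ M.unitBundle) :
    M.strength p.1 = M.σ p.1 ![p.2, M.rot p.1 p.2] := by
  have h : ∃ c, ∀ u ∈ tangentS2 p.1, ∀ w ∈ tangentS2 p.1, M.σ p.1 ![u, w] = c * M.area p.1 u w := by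
    refine ⟨M.σ p.1 ![p.2, M.rot p.1 p.2], fun u hu w hw ↦ ?_⟩
    obtain ⟨h1, h2⟩ := rot_apply hp hu
    rw [sigma_apply hp hu hw, area, g_apply hp (M.rot_spec hp.1 hu).1, h1, h2]
    ring
  have := Classical.epsilon_spec h p.2 hp.2.1 _ (rot_mem hp)
  rw [area, g_rot_rot hp, mul_one] at this
  exact this.symm

theorem exists_riesz (hp : p ∈ M.unitBundle) (l : E3 →ₗ[ℝ] ℝ) :
    ∃ k ∈ tangentS2 p.1, ∀ w ∈ tangentS2 p.1, M.g p.1 k w = l w := by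
  refine ⟨l p.2 • p.2 + l (M.rot p.1 p.2) • M.rot p.1 p.2,
    add_mem (Submodule.smul_mem _ _ hp.2.1) (Submodule.smul_mem _ _ (rot_mem hp)), fun w hw ↦ ?_⟩
  conv_rhs => rw [tangent_decomp hp hw]
  simp [mul_comm]

end Frame

/-- The Christoffel symbols of the first kind. -/
def christoffel (p : E6) : E3 →ₗ[ℝ] E3 →ₗ[ℝ] ℝ :=
  LinearMap.mk₂ ℝ (fun a w ↦ (fderiv ℝ M.g p.1 a p.2 w + fderiv ℝ M.g p.1 p.2 a w
    - fderiv ℝ M.g p.1 w a p.2) / 2)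
    (fun a b w ↦ by simp; ring) (fun c a w ↦ by simp; ring)
    (fun a b w ↦ by simp; ring) (fun c a w ↦ by simp; ring)

theorem fderiv_g_symm (x a u w : E3) : fderiv ℝ M.g x a u w = fderiv ℝ M.g x a w u := by
  have hd := (M.g_smooth.differentiable (by simp) x).hasFDerivAt
  have h : ∀ u w : E3, fderiv ℝ (fun y ↦ M.g y u w) x a = fderiv ℝ M.g x a u w := fun u w ↦ by
    rw [((hd.clm_apply (hasFDerivAt_const u x)).clm_apply (hasFDerivAt_const w x)).fderiv]
    simp
  rw [← h, ← h]
  simp only [M.g_symm _ u w]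

theorem fderiv_energy (p ξ : E6) :
    fderiv ℝ M.energy p ξ = fderiv ℝ M.g p.1 ξ.1 p.2 p.2 / 2 + M.g p.1 ξ.2 p.2 := by
  have h1 := (M.g_smooth.differentiable (by simp) p.1).hasFDerivAt.comp p
    (hasFDerivAt_fst (𝕜 := ℝ) (p := p))
  have h2 := hasFDerivAt_snd (𝕜 := ℝ) (p := p)
  have h3 := ((h1.clm_apply h2).clm_apply h2).mul_const (2⁻¹ : ℝ)
  have e : M.energy = fun q : E6 ↦ (M.g ∘ Prod.fst) q q.2 q.2 * 2⁻¹ := by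
    ext q; simp [energy, div_eq_mul_inv]
  rw [e, h3.fderiv]
  simp [M.g_symm p.1 p.2 ξ.2]
  ring

section Frame

variable {M} {p : E6}

theorem connector_spec (hp : p ∈ M.unitBundle) (ξ : E6) : M.connector p ξ ∈ tangentS2 p.1 ∧
    ∀ w ∈ tangentS2 p.1, M.g p.1 (M.connector p ξ) w = M.g p.1 ξ.2 w + M.christoffel p ξ.1 w :=
  Classical.epsilon_spec (exists_riesz hp ((M.g p.1 ξ.2).toLinearMap + M.christoffel p ξ.1))

/-- Compatibility with the metric: paired with `v`, two Christoffel terms cancel and half the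
derivative of `g(v, v)` remains. -/
theorem fderiv_energy_eq_connector (hp : p ∈ M.unitBundle) (ξ : E6) :
    fderiv ℝ M.energy p ξ = M.g p.1 (M.connector p ξ) p.2 := by
  rw [(connector_spec hp ξ).2 p.2 hp.2.1, fderiv_energy, christoffel, LinearMap.mk₂_apply]
  ring

theorem horizontalLift_spec (hp : p ∈ M.unitBundle) {u : E3} (hu : u ∈ tangentS2 p.1) :
    M.horizontalLift p u ∈ M.tangentUnitBundle p ∧ (M.horizontalLift p u).1 = u ∧
      M.connector p (M.horizontalLift p u) = 0 := by
  suffices h : ∃ ξ : E6, ξ ∈ tangentTS2 p ∧ ξ.1 = u ∧ M.connector p ξ = 0 by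
    obtain ⟨h1, h2, h3⟩ := Classical.epsilon_spec h
    exact ⟨⟨h1, by rw [fderiv_energy_eq_connector hp]; erw [h3]; simp⟩, h2, h3⟩
  -- The normal part of the fibre component is forced by tangency to `TS²`; `t` is the tangential
  -- part which makes the covariant derivative vanish.
  obtain ⟨t, ht, ht'⟩ := exists_riesz hp
    (-(M.g p.1 (-⟪u, p.2⟫ • p.1)).toLinearMap - M.christoffel p u)
  refine ⟨(u, -⟪u, p.2⟫ • p.1 + t), ⟨mem_tangentS2.1 hu, ?_⟩, rfl, ?_⟩
  · simp only [inner_add_right, inner_smul_right, mem_S2_iff_inner.1 hp.1, mem_tangentS2.1 ht]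
    ring
  · obtain ⟨h1, h2⟩ := connector_spec hp (u, -⟪u, p.2⟫ • p.1 + t)
    refine M.eq_zero_of_g_self hp.1 h1 ?_
    rw [h2 _ h1, map_add, add_apply, ht' _ h1]
    simp
    ring

theorem psi_eq (hp : p ∈ M.unitBundle) (ξ : E6) :
    M.ψ p ξ = M.g p.1 ξ.2 (M.rot p.1 p.2) + M.christoffel p ξ.1 (M.rot p.1 p.2) :=
  (connector_spec hp ξ).2 _ (rot_mem hp)

/-- The energy is constant along the bundle, so the covariant derivative has no component along `v`.
-/
theorem connector_eq (hp : p ∈ M.unitBundle) {ξ : E6} (hξ : ξ ∈ M.tangentUnitBundle p) :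
    M.connector p ξ = M.ψ p ξ • M.rot p.1 p.2 := by
  have h := fderiv_energy_eq_connector hp ξ
  rw [hξ.2, M.g_symm] at h
  rw [tangent_decomp hp (connector_spec hp ξ).1, ← h, zero_smul, zero_add, ψ, M.g_symm]

theorem eq_zero_of_coframe (hp : p ∈ M.unitBundle) {ξ : E6} (hξ : ξ ∈ M.tangentUnitBundle p)
    (h1 : M.α p ![ξ] = 0) (h2 : M.ψ p ξ = 0) (h3 : M.η p ξ = 0) : ξ = 0 := by
  have hξ' := M.mem_tangentUnitBundle.1 hξ
  have e1 : ξ.1 = 0 := eq_zero_of_g_eq_zero hp hξ'.1 h1 h3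
  have h4 := hξ'.2.1
  have h5 := hξ'.2.2
  rw [psi_eq hp, e1] at h2
  rw [fderiv_energy, e1] at h5
  simp only [e1, inner_zero_left, zero_add] at h4
  simp only [map_zero, LinearMap.zero_apply, add_zero] at h2
  simp only [map_zero, zero_apply, zero_div, zero_add] at h5
  have e2 : ξ.2 = 0 := eq_zero_of_g_eq_zero hp (mem_tangentS2.2 h4) (by rw [M.g_symm, h5])
    (by rw [M.g_symm, h2])
  exact Prod.ext e1 e2

end Frame

end MagneticSystem

/-! ### The frame `(X, V, H)` and its structure equations -/

namespace MagneticSystem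

variable (M : MagneticSystem)

/-- The tangent space of the unit tangent bundle as a submodule. -/
def tangentSubmodule (p : E6) : Submodule ℝ E6 where
  carrier := M.tangentUnitBundle p
  zero_mem' := by rw [mem_tangentUnitBundle]; simp
  add_mem' := fun {a b} ha hb ↦ by
    rw [mem_tangentUnitBundle] at *
    refine ⟨add_mem ha.1 hb.1, ?_, by rw [map_add, ha.2.2, hb.2.2, add_zero]⟩
    simp only [Prod.fst_add, Prod.snd_add, inner_add_left, inner_add_right]
    linear_combination ha.2.1 + hb.2.1
  smul_mem' := fun c a ha ↦ by
    rw [mem_tangentUnitBundle] at *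
    refine ⟨Submodule.smul_mem _ c ha.1, ?_, by rw [map_smul, ha.2.2, smul_zero]⟩
    simp only [Prod.smul_fst, Prod.smul_snd, inner_smul_left, inner_smul_right]
    simp only [conj_trivial]
    linear_combination c * ha.2.1

/-- The connection form as a linear functional. -/
def psiL (p : E6) : E6 →ₗ[ℝ] ℝ :=
  ((M.g p.1).flip (M.rot p.1 p.2)).toLinearMap ∘ₗ LinearMap.snd ℝ E3 E3
    + ((M.christoffel p).flip (M.rot p.1 p.2)) ∘ₗ LinearMap.fst ℝ E3 E3

/-- The one-form `α` as a linear functional. -/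
def alphaL (p : E6) : E6 →ₗ[ℝ] ℝ := (M.g p.1 p.2).toLinearMap ∘ₗ LinearMap.fst ℝ E3 E3

/-- The one-form `η` as a linear functional. -/
def etaL (p : E6) : E6 →ₗ[ℝ] ℝ :=
  (M.g p.1 (M.rot p.1 p.2)).toLinearMap ∘ₗ LinearMap.fst ℝ E3 E3

theorem alphaL_apply (p ξ : E6) : M.alphaL p ξ = M.α p ![ξ] := rfl
theorem etaL_apply (p ξ : E6) : M.etaL p ξ = M.η p ξ := rfl

variable {M} {p : E6}

theorem psiL_apply (hp : p ∈ M.unitBundle) (ξ : E6) : M.psiL p ξ = M.ψ p ξ :=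
  (psi_eq hp ξ).symm

/-- The horizontal field of the coframe. -/
def H (M : MagneticSystem) (p : E6) : E6 := M.horizontalLift p (M.rot p.1 p.2)

theorem X_mem (hp : p ∈ M.unitBundle) : M.X p ∈ M.tangentUnitBundle p :=
  (horizontalLift_spec hp hp.2.1).1

theorem H_mem (hp : p ∈ M.unitBundle) : M.H p ∈ M.tangentUnitBundle p :=
  (horizontalLift_spec hp (rot_mem hp)).1

theorem V_mem (hp : p ∈ M.unitBundle) : M.V p ∈ M.tangentUnitBundle p := by
  rw [mem_tangentUnitBundle]
  refine ⟨by simp [V], by simpa [V] using mem_tangentS2.1 (rot_mem hp), ?_⟩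
  rw [fderiv_energy]
  simp [V, g_rot_snd hp]

theorem alphaL_X (hp : p ∈ M.unitBundle) : M.alphaL p (M.X p) = 1 := by
  change M.g p.1 p.2 (M.X p).1 = 1
  rw [X, (horizontalLift_spec hp hp.2.1).2.1, g_snd_snd hp]

theorem psiL_X (hp : p ∈ M.unitBundle) : M.psiL p (M.X p) = 0 := by
  rw [psiL_apply hp, ψ, X, (horizontalLift_spec hp hp.2.1).2.2]
  simp

theorem etaL_X (hp : p ∈ M.unitBundle) : M.etaL p (M.X p) = 0 := by
  change M.g p.1 (M.rot p.1 p.2) (M.X p).1 = 0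
  rw [X, (horizontalLift_spec hp hp.2.1).2.1, g_rot_snd hp]

theorem alphaL_V (p : E6) : M.alphaL p (M.V p) = 0 := by
  change M.g p.1 p.2 0 = 0
  simp

theorem psiL_V (hp : p ∈ M.unitBundle) : M.psiL p (M.V p) = 1 := by
  rw [psiL_apply hp, psi_eq hp]
  simp [V, g_rot_rot hp]

theorem etaL_V (p : E6) : M.etaL p (M.V p) = 0 := by
  change M.g p.1 (M.rot p.1 p.2) 0 = 0
  simp

theorem alphaL_H (hp : p ∈ M.unitBundle) : M.alphaL p (M.H p) = 0 := by
  change M.g p.1 p.2 (M.H p).1 = 0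
  rw [H, (horizontalLift_spec hp (rot_mem hp)).2.1, g_snd_rot hp]

theorem psiL_H (hp : p ∈ M.unitBundle) : M.psiL p (M.H p) = 0 := by
  rw [psiL_apply hp, ψ, H, (horizontalLift_spec hp (rot_mem hp)).2.2]
  simp

theorem etaL_H (hp : p ∈ M.unitBundle) : M.etaL p (M.H p) = 1 := by
  change M.g p.1 (M.rot p.1 p.2) (M.H p).1 = 1
  rw [H, (horizontalLift_spec hp (rot_mem hp)).2.1, g_rot_rot hp]

theorem frame_decomp (hp : p ∈ M.unitBundle) {ξ : E6} (hξ : ξ ∈ M.tangentUnitBundle p) :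
    ξ = M.alphaL p ξ • M.X p + M.psiL p ξ • M.V p + M.etaL p ξ • M.H p := by
  have hm : ξ - (M.alphaL p ξ • M.X p + M.psiL p ξ • M.V p + M.etaL p ξ • M.H p)
      ∈ M.tangentSubmodule p :=
    sub_mem hξ (add_mem (add_mem (Submodule.smul_mem _ _ (X_mem hp))
      (Submodule.smul_mem _ _ (V_mem hp))) (Submodule.smul_mem _ _ (H_mem hp)))
  refine sub_eq_zero.1 (eq_zero_of_coframe hp hm ?_ ?_ ?_)
  · rw [← alphaL_apply]
    simp [alphaL_X hp, alphaL_V, alphaL_H hp]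
  · rw [← psiL_apply hp]
    simp [psiL_X hp, psiL_V hp, psiL_H hp]
  · rw [← etaL_apply]
    simp [etaL_X hp, etaL_V, etaL_H hp]

theorem contDiff_alpha (M : MagneticSystem) : ContDiff ℝ ∞ M.α := by
  have h : ContDiff ℝ ∞ fun p : E6 ↦ (M.g p.1 p.2).comp (ContinuousLinearMap.fst ℝ E3 E3) :=
    ((M.g_smooth.comp contDiff_fst).clm_apply contDiff_snd).clm_comp contDiff_const
  exact h.continuousLinearMap_comp oneForm

/-- The structure equation `dα = ψ ∧ η`. Pair the covariant derivative of each vector with the base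
part of the other: in the difference the derivatives of `g` along `v` cancel, and the remaining
Christoffel terms combine to the base derivatives of `g` in `dα`. -/
theorem extDeriv_alpha (hp : p ∈ M.unitBundle) {a b : E6} (ha : a ∈ M.tangentUnitBundle p)
    (hb : b ∈ M.tangentUnitBundle p) :
    extDeriv M.α p ![a, b] = M.psiL p a * M.etaL p b - M.psiL p b * M.etaL p a := by
  have hd : ∀ a b : E6, fderiv ℝ (fun q ↦ M.α q ![b]) p a =
      fderiv ℝ M.g p.1 a.1 p.2 b.1 + M.g p.1 a.2 b.1 := fun a b ↦ by
    have h1 := (M.g_smooth.differentiable (by simp) p.1).hasFDerivAt.comp p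
      (hasFDerivAt_fst (𝕜 := ℝ) (p := p))
    have h2 := hasFDerivAt_snd (𝕜 := ℝ) (p := p)
    have h3 := (h1.clm_apply h2).clm_apply (hasFDerivAt_const b.1 p)
    have e : (fun q ↦ M.α q ![b]) = fun q : E6 ↦ (M.g ∘ Prod.fst) q q.2 b.1 := rfl
    rw [e, h3.fderiv]
    simp [add_comm]
  rw [extDeriv_pair (M.contDiff_alpha.differentiable (by simp) p), hd, hd]
  have ka := (connector_spec hp a).2 b.1 (M.mem_tangentUnitBundle.1 hb).1
  have kb := (connector_spec hp b).2 a.1 (M.mem_tangentUnitBundle.1 ha).1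
  rw [connector_eq hp ha, ← psiL_apply hp, christoffel, LinearMap.mk₂_apply, map_smul, smul_apply,
    smul_eq_mul] at ka
  rw [connector_eq hp hb, ← psiL_apply hp, christoffel, LinearMap.mk₂_apply, map_smul, smul_apply,
    smul_eq_mul] at kb
  rw [M.fderiv_g_symm p.1 b.1 a.1 p.2, M.fderiv_g_symm p.1 p.2 a.1 b.1] at ka
  rw [M.fderiv_g_symm p.1 a.1 b.1 p.2] at kb
  simp only [etaL, LinearMap.comp_apply, LinearMap.fst_apply, ContinuousLinearMap.coe_coe]
  linear_combination kb - ka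

theorem sigma_fst (hp : p ∈ M.unitBundle) {a b : E6} (ha : a ∈ M.tangentUnitBundle p)
    (hb : b ∈ M.tangentUnitBundle p) : M.σ p.1 ![a.1, b.1] =
      M.strength p.1 * (M.alphaL p a * M.etaL p b - M.etaL p a * M.alphaL p b) := by
  rw [sigma_apply hp (M.mem_tangentUnitBundle.1 ha).1 (M.mem_tangentUnitBundle.1 hb).1,
    strength_eq hp]
  rfl

theorem strength_pos (hp : p ∈ M.unitBundle) : 0 < M.strength p.1 := by
  rw [strength_eq hp]; exact sigma_snd_rot_pos hp

theorem omega_apply (m : ℝ) (p a b : E6) :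
    M.omega m p ![a, b] = m * extDeriv M.α p ![a, b] - M.σ p.1 ![a.1, b.1] := by
  have : Prod.fst ∘ ![a, b] = ![a.1, b.1] := by
    ext i; fin_cases i <;> rfl
  simp [omega, this]

theorem omega_eq (hp : p ∈ M.unitBundle) (m : ℝ) {a b : E6} (ha : a ∈ M.tangentUnitBundle p)
    (hb : b ∈ M.tangentUnitBundle p) : M.omega m p ![a, b] =
      m * (M.psiL p a * M.etaL p b - M.psiL p b * M.etaL p a) -
        M.strength p.1 * (M.alphaL p a * M.etaL p b - M.etaL p a * M.alphaL p b) := by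
  rw [omega_apply, extDeriv_alpha hp ha hb, sigma_fst hp ha hb]

theorem liouvilleForm_eq (hp : p ∈ M.unitBundle) (ξ : Fin 3 → E6) :
    M.liouvilleForm p ξ = M.alphaL p (ξ 0) * (M.psiL p (ξ 1) * M.etaL p (ξ 2)
      - M.psiL p (ξ 2) * M.etaL p (ξ 1)) - M.alphaL p (ξ 1) * (M.psiL p (ξ 0) * M.etaL p (ξ 2)
      - M.psiL p (ξ 2) * M.etaL p (ξ 0)) + M.alphaL p (ξ 2) * (M.psiL p (ξ 0) * M.etaL p (ξ 1)
      - M.psiL p (ξ 1) * M.etaL p (ξ 0)) := by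
  rw [liouvilleForm, Matrix.det_fin_three]
  simp only [← alphaL_apply, ← psiL_apply hp, ← etaL_apply, Matrix.of_apply, Matrix.cons_val',
    Matrix.cons_val_zero, Matrix.cons_val_one, Matrix.cons_val]
  ring

/-- The wedge product of a one-form and a two-form, given by its values. -/
def wedge12 (t : E6 → ℝ) (w : E6 → E6 → ℝ) (ξ : Fin 3 → E6) : ℝ :=
  t (ξ 0) * w (ξ 1) (ξ 2) - t (ξ 1) * w (ξ 0) (ξ 2) + t (ξ 2) * w (ξ 0) (ξ 1)

/-- By the structure equation `ν = α ∧ dα`. Since `α` is a smooth ambient form, while `ψ` and `η`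
involve pointwise choices, this is how `ν` becomes accessible to calculus. -/
theorem liouvilleForm_eq_wedge (hp : p ∈ M.unitBundle) {ξ : Fin 3 → E6}
    (hξ : ∀ i, ξ i ∈ M.tangentUnitBundle p) : M.liouvilleForm p ξ =
      wedge12 (fun a ↦ M.α p ![a]) (fun a b ↦ extDeriv M.α p ![a, b]) ξ := by
  rw [liouvilleForm_eq hp, wedge12, extDeriv_alpha hp (hξ 1) (hξ 2), extDeriv_alpha hp (hξ 0) (hξ 2),
    extDeriv_alpha hp (hξ 0) (hξ 1)]
  rfl

theorem oneForm_decomp (hp : p ∈ M.unitBundle) (τ : E6 [⋀^Fin 1]→L[ℝ] ℝ) {ξ : E6}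
    (hξ : ξ ∈ M.tangentUnitBundle p) : τ ![ξ] = M.alphaL p ξ * τ ![M.X p]
      + M.psiL p ξ * τ ![M.V p] + M.etaL p ξ * τ ![M.H p] := by
  have add (a b) : τ ![a + b] = τ ![a] + τ ![b] := τ.map_vecCons_add _ a b
  have smul (r : ℝ) (a) : τ ![r • a] = r * τ ![a] := τ.map_vecCons_smul _ r a
  conv_lhs => rw [frame_decomp hp hξ]
  rw [add, add, smul, smul, smul]

theorem apply_magneticField (m : ℝ) (p : E6) (τ : E6 [⋀^Fin 1]→L[ℝ] ℝ) :
    τ ![M.magneticField m p] = m * τ ![M.X p] + M.strength p.1 * τ ![M.V p] := by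
  have add (a b) : τ ![a + b] = τ ![a] + τ ![b] := τ.map_vecCons_add _ a b
  have smul (r : ℝ) (a) : τ ![r • a] = r * τ ![a] := τ.map_vecCons_smul _ r a
  rw [magneticField, add, smul, smul]

/-- The contraction of the Liouville volume form with the magnetic vector field is `ω_m`. -/
theorem magneticField_mul_liouvilleForm (hp : p ∈ M.unitBundle) (m : ℝ)
    (τ : E6 [⋀^Fin 1]→L[ℝ] ℝ) {ξ : Fin 3 → E6} (hξ : ∀ i, ξ i ∈ M.tangentUnitBundle p) :
    τ ![M.magneticField m p] * M.liouvilleForm p ξ =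
      wedge12 (fun a ↦ τ ![a]) (fun a b ↦ M.omega m p ![a, b]) ξ := by
  rw [apply_magneticField, liouvilleForm_eq hp, wedge12]
  simp only [omega_eq hp m (hξ _) (hξ _), oneForm_decomp hp τ (hξ _)]
  ring

/-- The wedge product of a one-form with the magnetic form. -/
theorem wedge_sigma (hp : p ∈ M.unitBundle) (τ : E6 [⋀^Fin 1]→L[ℝ] ℝ) {ξ : Fin 3 → E6}
    (hξ : ∀ i, ξ i ∈ M.tangentUnitBundle p) :
    wedge12 (fun a ↦ τ ![a]) (fun a b ↦ M.σ p.1 ![a.1, b.1]) ξ =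
      -(M.strength p.1 * τ ![M.V p]) * M.liouvilleForm p ξ := by
  rw [liouvilleForm_eq hp, wedge12]
  simp only [sigma_fst hp (hξ _) (hξ _), oneForm_decomp hp τ (hξ _)]
  ring

/-- A form with the differential `ω_m` whose Reeb field is negative is negative on the magnetic
vector field. -/
theorem apply_magneticField_neg (hp : p ∈ M.unitBundle) {m : ℝ} (hm : 0 < m)
    (τ : E6 [⋀^Fin 1]→L[ℝ] ℝ) {Z : E6} (hZ : Z ∈ M.tangentUnitBundle p)
    (hker : ∀ b ∈ M.tangentUnitBundle p, M.omega m p ![Z, b] = 0)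
    (hpos : ∀ a ∈ M.tangentUnitBundle p, ∀ b ∈ M.tangentUnitBundle p,
      0 < M.omega m p ![a, b] → 0 < M.liouvilleForm p ![Z, a, b])
    (hτ : τ ![Z] < 0) : τ ![M.magneticField m p] < 0 := by
  -- Testing `Z` against `V` gives `η(Z) = 0`, and against `H` gives `m ψ(Z) = f α(Z)`. So `m Z =
  -- α(Z) X^m`, and since `ω_m(V, H) = m > 0`, positivity on `(V, H)` gives `α(Z) > 0`.
  have hV := hker _ (V_mem hp)
  have hH := hker _ (H_mem hp)
  have hVH := hpos _ (V_mem hp) _ (H_mem hp)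
  rw [omega_eq hp m hZ (V_mem hp)] at hV
  rw [omega_eq hp m hZ (H_mem hp)] at hH
  rw [omega_eq hp m (V_mem hp) (H_mem hp), liouvilleForm_eq hp] at hVH
  rw [oneForm_decomp hp τ hZ] at hτ
  simp only [psiL_V hp, etaL_V, alphaL_V, psiL_H hp, etaL_H hp, alphaL_H hp, Matrix.cons_val_zero,
    Matrix.cons_val_one, Matrix.cons_val] at hV hH hVH
  have hz : 0 < M.alphaL p Z := by
    have := hVH (by simpa using hm)
    linarith
  have h3 : M.etaL p Z = 0 := by
    have : m * M.etaL p Z = 0 := by linear_combination -hV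
    exact (mul_eq_zero.1 this).resolve_left hm.ne'
  rw [h3] at hτ hH
  rw [apply_magneticField]
  have h4 : m * (M.alphaL p Z * τ ![M.X p] + M.psiL p Z * τ ![M.V p]) =
      M.alphaL p Z * (m * τ ![M.X p] + M.strength p.1 * τ ![M.V p]) := by
    linear_combination τ ![M.V p] * hH
  have h5 : M.alphaL p Z * (m * τ ![M.X p] + M.strength p.1 * τ ![M.V p]) < 0 := by
    rw [← h4]
    exact mul_neg_of_pos_of_neg hm (by linarith)
  exact (pos_iff_neg_of_mul_neg h5).1 hz

end MagneticSystem

/-! ### Euler angles for round unit tangent vectors -/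

/-- The point of the sphere with the given Euler angles. -/
def eulerX (y : Fin 3 → ℝ) : E3 :=
  !₂[Real.cos (y 0) * Real.sin (y 1), Real.sin (y 0) * Real.sin (y 1), Real.cos (y 1)]

/-- The round unit tangent vector with the given Euler angles. -/
def eulerV (y : Fin 3 → ℝ) : E3 :=
  !₂[Real.cos (y 2) * (Real.cos (y 0) * Real.cos (y 1)) - Real.sin (y 2) * Real.sin (y 0),
    Real.cos (y 2) * (Real.sin (y 0) * Real.cos (y 1)) + Real.sin (y 2) * Real.cos (y 0),
    -(Real.cos (y 2) * Real.sin (y 1))]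

/-- The derivative of `eulerX`. -/
def eulerX' (y h : Fin 3 → ℝ) : E3 :=
  !₂[-Real.sin (y 0) * h 0 * Real.sin (y 1) + Real.cos (y 0) * (Real.cos (y 1) * h 1),
    Real.cos (y 0) * h 0 * Real.sin (y 1) + Real.sin (y 0) * (Real.cos (y 1) * h 1),
    -Real.sin (y 1) * h 1]

/-- The derivative of `eulerV`. -/
def eulerV' (y h : Fin 3 → ℝ) : E3 :=
  !₂[-Real.sin (y 2) * h 2 * (Real.cos (y 0) * Real.cos (y 1))
      + Real.cos (y 2) * (-Real.sin (y 0) * h 0 * Real.cos (y 1)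
        + Real.cos (y 0) * (-Real.sin (y 1) * h 1))
      - (Real.cos (y 2) * h 2 * Real.sin (y 0) + Real.sin (y 2) * (Real.cos (y 0) * h 0)),
    -Real.sin (y 2) * h 2 * (Real.sin (y 0) * Real.cos (y 1))
      + Real.cos (y 2) * (Real.cos (y 0) * h 0 * Real.cos (y 1)
        + Real.sin (y 0) * (-Real.sin (y 1) * h 1))
      + (Real.cos (y 2) * h 2 * Real.cos (y 0) + Real.sin (y 2) * (-Real.sin (y 0) * h 0)),
    -(-Real.sin (y 2) * h 2 * Real.sin (y 1) + Real.cos (y 2) * (Real.cos (y 1) * h 1))]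

section Coordinates
variable (y h : Fin 3 → ℝ)

@[simp] theorem eulerX_zero : eulerX y 0 = Real.cos (y 0) * Real.sin (y 1) := rfl
@[simp] theorem eulerX_one : eulerX y 1 = Real.sin (y 0) * Real.sin (y 1) := rfl
@[simp] theorem eulerX_two : eulerX y 2 = Real.cos (y 1) := rfl
@[simp] theorem eulerV_zero : eulerV y 0 = Real.cos (y 2) * (Real.cos (y 0) * Real.cos (y 1))
  - Real.sin (y 2) * Real.sin (y 0) := rfl
@[simp] theorem eulerV_one : eulerV y 1 = Real.cos (y 2) * (Real.sin (y 0) * Real.cos (y 1))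
  + Real.sin (y 2) * Real.cos (y 0) := rfl
@[simp] theorem eulerV_two : eulerV y 2 = -(Real.cos (y 2) * Real.sin (y 1)) := rfl

end Coordinates

theorem hasFDerivAt_E3 {f : (Fin 3 → ℝ) → E3} {y : Fin 3 → ℝ}
    {f' : Fin 3 → (Fin 3 → ℝ) →L[ℝ] ℝ} (h : ∀ i, HasFDerivAt (fun z ↦ f z i) (f' i) y) :
    ∃ D : (Fin 3 → ℝ) →L[ℝ] E3, HasFDerivAt f D y ∧ ∀ v i, D v i = f' i v := by
  refine ⟨((EuclideanSpace.equiv (Fin 3) ℝ).symm : (Fin 3 → ℝ) →L[ℝ] E3).comp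
    (ContinuousLinearMap.pi f'), ?_, fun v i ↦ rfl⟩
  exact ((EuclideanSpace.equiv (Fin 3) ℝ).symm : (Fin 3 → ℝ) →L[ℝ] E3).hasFDerivAt.comp y
    (hasFDerivAt_pi.2 h)

theorem hasFDerivAt_eulerX (y : Fin 3 → ℝ) : ∃ D : (Fin 3 → ℝ) →L[ℝ] E3,
    HasFDerivAt eulerX D y ∧ ∀ v, D v = eulerX' y v := by
  have p : ∀ i, HasFDerivAt (fun z : Fin 3 → ℝ ↦ z i)
      (ContinuousLinearMap.proj i : (Fin 3 → ℝ) →L[ℝ] ℝ) y := fun i ↦ hasFDerivAt_apply i y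
  have h0 := (p 0).cos.fun_mul (p 1).sin
  have h1 := (p 0).sin.fun_mul (p 1).sin
  have h2 := (p 1).cos
  obtain ⟨D, hD, hD'⟩ := hasFDerivAt_E3 (f := eulerX) (y := y) (f' := ![_, _, _])
    (by intro i; fin_cases i; exacts [h0, h1, h2])
  refine ⟨D, hD, fun v ↦ ext_coord ?_ ?_ ?_⟩ <;> rw [hD'] <;> simp [eulerX'] <;> ring

theorem hasFDerivAt_eulerV (y : Fin 3 → ℝ) : ∃ D : (Fin 3 → ℝ) →L[ℝ] E3,
    HasFDerivAt eulerV D y ∧ ∀ v, D v = eulerV' y v := by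
  have p : ∀ i, HasFDerivAt (fun z : Fin 3 → ℝ ↦ z i)
      (ContinuousLinearMap.proj i : (Fin 3 → ℝ) →L[ℝ] ℝ) y := fun i ↦ hasFDerivAt_apply i y
  have h0 := ((p 2).cos.fun_mul ((p 0).cos.fun_mul (p 1).cos)).fun_sub ((p 2).sin.fun_mul (p 0).sin)
  have h1 := ((p 2).cos.fun_mul ((p 0).sin.fun_mul (p 1).cos)).fun_add ((p 2).sin.fun_mul (p 0).cos)
  have h2 := ((p 2).cos.fun_mul (p 1).sin).fun_neg
  obtain ⟨D, hD, hD'⟩ := hasFDerivAt_E3 (f := eulerV) (y := y) (f' := ![_, _, _])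
    (by intro i; fin_cases i; exacts [h0, h1, h2])
  refine ⟨D, hD, fun v ↦ ext_coord ?_ ?_ ?_⟩ <;> rw [hD'] <;> simp [eulerV'] <;> ring

theorem contDiff_E3 {f : (Fin 3 → ℝ) → E3} (h : ∀ i, ContDiff ℝ ∞ fun z ↦ f z i) :
    ContDiff ℝ ∞ f :=
  ((EuclideanSpace.equiv (Fin 3) ℝ).symm : (Fin 3 → ℝ) →L[ℝ] E3).contDiff.comp (contDiff_pi.2 h)

theorem contDiff_eulerX : ContDiff ℝ ∞ eulerX := by
  have h (i : Fin 3) : ContDiff ℝ ∞ fun z : Fin 3 → ℝ ↦ z i := contDiff_apply ℝ ℝ i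
  refine contDiff_E3 fun i ↦ ?_
  fin_cases i
  · exact (h 0).cos.mul (h 1).sin
  · exact (h 0).sin.mul (h 1).sin
  · exact (h 1).cos

theorem contDiff_eulerV : ContDiff ℝ ∞ eulerV := by
  have h (i : Fin 3) : ContDiff ℝ ∞ fun z : Fin 3 → ℝ ↦ z i := contDiff_apply ℝ ℝ i
  refine contDiff_E3 fun i ↦ ?_
  fin_cases i
  · exact ((h 2).cos.mul ((h 0).cos.mul (h 1).cos)).sub ((h 2).sin.mul (h 0).sin)
  · exact ((h 2).cos.mul ((h 0).sin.mul (h 1).cos)).add ((h 2).sin.mul (h 0).cos)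
  · exact ((h 2).cos.mul (h 1).sin).neg

theorem eulerX_mem (y : Fin 3 → ℝ) : eulerX y ∈ S2 := by
  rw [mem_S2_iff]
  have h0 := Real.sin_sq_add_cos_sq (y 0)
  have h1 := Real.sin_sq_add_cos_sq (y 1)
  simp
  linear_combination Real.sin (y 1) ^ 2 * h0 + h1

theorem eulerV_mem (y : Fin 3 → ℝ) : eulerV y ∈ tangentS2 (eulerX y) := by
  rw [mem_tangentS2_iff]
  have h0 := Real.sin_sq_add_cos_sq (y 0)
  simp
  linear_combination Real.cos (y 2) * Real.cos (y 1) * Real.sin (y 1) * h0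

theorem eulerV_mem_S2 (y : Fin 3 → ℝ) : eulerV y ∈ S2 := by
  rw [mem_S2_iff]
  have h0 := Real.sin_sq_add_cos_sq (y 0)
  have h1 := Real.sin_sq_add_cos_sq (y 1)
  have h2 := Real.sin_sq_add_cos_sq (y 2)
  simp
  linear_combination (Real.cos (y 2) ^ 2 * Real.cos (y 1) ^ 2 + Real.sin (y 2) ^ 2) * h0
    + Real.cos (y 2) ^ 2 * h1 + h2

/-- The lower corner of the domain of the Euler angles. -/
def eulerLo : Fin 3 → ℝ := ![-Real.pi, 0, -Real.pi]
/-- The upper corner of the domain of the Euler angles. -/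
def eulerHi : Fin 3 → ℝ := ![Real.pi, Real.pi, Real.pi]
/-- The domain of the Euler angles. -/
def eulerBox : Set (Fin 3 → ℝ) := Set.pi univ fun i ↦ Ioo (eulerLo i) (eulerHi i)

theorem mem_eulerBox {y : Fin 3 → ℝ} : y ∈ eulerBox ↔ y 0 ∈ Ioo (-Real.pi) Real.pi ∧
    y 1 ∈ Ioo 0 Real.pi ∧ y 2 ∈ Ioo (-Real.pi) Real.pi := by
  simp only [eulerBox, mem_univ_pi, Fin.forall_fin_succ, eulerLo, eulerHi]
  simp

theorem isOpen_eulerBox : IsOpen eulerBox := isOpen_set_pi finite_univ fun _ _ ↦ isOpen_Ioo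

theorem eq_of_cos_eq_of_sin_eq {a b : ℝ} (ha : a ∈ Ioo (-Real.pi) Real.pi)
    (hb : b ∈ Ioo (-Real.pi) Real.pi) (hc : Real.cos a = Real.cos b)
    (hs : Real.sin a = Real.sin b) : a = b := by
  have h := Real.Angle.cos_sin_inj hc hs
  rw [← Real.Angle.toReal_coe_eq_self_iff_mem_Ioc.2 ⟨ha.1, ha.2.le⟩, h,
    Real.Angle.toReal_coe_eq_self_iff_mem_Ioc.2 ⟨hb.1, hb.2.le⟩]

theorem euler_injOn {y z : Fin 3 → ℝ} (hy : y ∈ eulerBox) (hz : z ∈ eulerBox)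
    (hX : eulerX y = eulerX z) (hV : eulerV y = eulerV z) : y = z := by
  rw [mem_eulerBox] at hy hz
  have x0 := congrArg (fun v : E3 ↦ v 0) hX
  have x1 := congrArg (fun v : E3 ↦ v 1) hX
  have x2 := congrArg (fun v : E3 ↦ v 2) hX
  have v0 := congrArg (fun v : E3 ↦ v 0) hV
  have v1 := congrArg (fun v : E3 ↦ v 1) hV
  have v2 := congrArg (fun v : E3 ↦ v 2) hV
  simp only [eulerX_zero, eulerX_one, eulerX_two, eulerV_zero, eulerV_one, eulerV_two] at *
  have e1 : y 1 = z 1 := Real.injOn_cos (Ioo_subset_Icc_self hy.2.1) (Ioo_subset_Icc_self hz.2.1) x2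
  have hs : Real.sin (z 1) ≠ 0 := (Real.sin_pos_of_pos_of_lt_pi hz.2.1.1 hz.2.1.2).ne'
  rw [e1] at x0 x1 v0 v1 v2
  have e0 : y 0 = z 0 := eq_of_cos_eq_of_sin_eq hy.1 hz.1 (mul_right_cancel₀ hs x0)
    (mul_right_cancel₀ hs x1)
  rw [e0] at v0 v1
  have e2 : y 2 = z 2 := by
    have h0 := Real.sin_sq_add_cos_sq (z 0)
    refine eq_of_cos_eq_of_sin_eq hy.2.2 hz.2.2 (mul_right_cancel₀ hs (neg_injective v2)) ?_
    -- Pairing with the azimuthal unit vector isolates the sine of the fibre angle.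
    linear_combination -Real.sin (z 0) * v0 + Real.cos (z 0) * v1
      - (Real.sin (y 2) - Real.sin (z 2)) * h0
  ext i; fin_cases i <;> assumption

theorem euler_immersion {y : Fin 3 → ℝ} (hy : y ∈ eulerBox) {h : Fin 3 → ℝ}
    (hX : eulerX' y h = 0) (hV : eulerV' y h = 0) : h = 0 := by
  rw [mem_eulerBox] at hy
  have x0 := congrArg (fun v : E3 ↦ v 0) hX
  have x1 := congrArg (fun v : E3 ↦ v 1) hX
  have x2 := congrArg (fun v : E3 ↦ v 2) hX
  have v0 := congrArg (fun v : E3 ↦ v 0) hV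
  have v1 := congrArg (fun v : E3 ↦ v 1) hV
  have v2 := congrArg (fun v : E3 ↦ v 2) hV
  simp [eulerX', eulerV'] at x0 x1 x2 v0 v1 v2
  have hs : Real.sin (y 1) ≠ 0 := (Real.sin_pos_of_pos_of_lt_pi hy.2.1.1 hy.2.1.2).ne'
  have e1 : h 1 = 0 := x2.resolve_left hs
  have s0 := Real.sin_sq_add_cos_sq (y 0)
  have s2 := Real.sin_sq_add_cos_sq (y 2)
  have e0 : h 0 = 0 := by
    have : Real.sin (y 1) * h 0 = 0 := by
      rw [e1] at x0 x1
      linear_combination -Real.sin (y 0) * x0 + Real.cos (y 0) * x1 - h 0 * Real.sin (y 1) * s0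
    exact (mul_eq_zero.1 this).resolve_left hs
  rw [e0, e1] at v0 v1
  rw [e1] at v2
  have e2 : h 2 = 0 := by
    have k1 : Real.sin (y 2) * h 2 = 0 := by
      have : Real.sin (y 1) * (Real.sin (y 2) * h 2) = 0 := by linear_combination v2
      exact (mul_eq_zero.1 this).resolve_left hs
    have k2 : Real.cos (y 2) * h 2 = 0 := by
      linear_combination -Real.sin (y 0) * v0 + Real.cos (y 0) * v1 - Real.cos (y 2) * h 2 * s0
    linear_combination Real.sin (y 2) * k1 + Real.cos (y 2) * k2 - h 2 * s2
  ext i; fin_cases i <;> assumption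

/-- Every round unit tangent vector has Euler angles. -/
theorem exists_euler {x v : E3} (hx : x ∈ S2) (hv : v ∈ tangentS2 x) (hv1 : v ∈ S2) :
    ∃ y ∈ Icc eulerLo eulerHi, eulerX y = x ∧ eulerV y = v := by
  have hx' := mem_S2_iff.1 hx
  have hv' := mem_tangentS2_iff.1 hv
  have hv1' := mem_S2_iff.1 hv1
  have hx2 : x 2 ^ 2 ≤ 1 := by nlinarith [sq_nonneg (x 0), sq_nonneg (x 1)]
  have cb : Real.cos (Real.arccos (x 2)) = x 2 :=
    Real.cos_arccos (abs_le_of_sq_le_sq' (by linarith) zero_le_one).1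
      (abs_le_of_sq_le_sq' (by linarith) zero_le_one).2
  set b := Real.arccos (x 2) with hb
  have hb0 : 0 ≤ b := Real.arccos_nonneg _
  have hb1 : b ≤ Real.pi := Real.arccos_le_pi _
  have hsb : 0 ≤ Real.sin b := Real.sin_nonneg_of_nonneg_of_le_pi hb0 hb1
  have hb2 := Real.sin_sq_add_cos_sq b
  rw [cb] at hb2
  have hz1 : ‖(⟨x 0, x 1⟩ : ℂ)‖ = Real.sin b := by
    rw [Complex.norm_def, Complex.normSq_mk, ← Real.sqrt_sq hsb]
    congr 1
    linear_combination hx' - hb2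
  set a := Complex.arg ⟨x 0, x 1⟩ with ha
  have ca := Complex.norm_mul_cos_arg ⟨x 0, x 1⟩
  have sa := Complex.norm_mul_sin_arg ⟨x 0, x 1⟩
  simp only [hz1, ← ha] at ca sa
  have a2 := Real.sin_sq_add_cos_sq a
  -- The coordinates of `v` in the frame of the two coordinate directions.
  set s := x 2 * (Real.cos a * v 0 + Real.sin a * v 1) - Real.sin b * v 2 with hs
  set t := Real.cos a * v 1 - Real.sin a * v 0 with ht
  have hv0 : Real.sin b * (Real.cos a * v 0 + Real.sin a * v 1) + x 2 * v 2 = 0 := by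
    linear_combination hv' + v 0 * ca + v 1 * sa
  have hz3 : ‖(⟨s, t⟩ : ℂ)‖ = 1 := by
    rw [Complex.norm_def, Complex.normSq_mk, Real.sqrt_eq_one, hs, ht]
    linear_combination ((Real.cos a * v 0 + Real.sin a * v 1) ^ 2 + v 2 ^ 2) * hb2
      - (Real.sin b * (Real.cos a * v 0 + Real.sin a * v 1) + x 2 * v 2) * hv0
      + (v 0 ^ 2 + v 1 ^ 2) * a2 + hv1'
  have cc := Complex.norm_mul_cos_arg ⟨s, t⟩
  have sc := Complex.norm_mul_sin_arg ⟨s, t⟩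
  simp only [hz3, one_mul] at cc sc
  set c := Complex.arg ⟨s, t⟩
  refine ⟨![a, b, c], ⟨fun i ↦ ?_, fun i ↦ ?_⟩, ?_, ?_⟩
  · fin_cases i
    exacts [(Complex.neg_pi_lt_arg _).le, hb0, (Complex.neg_pi_lt_arg _).le]
  · fin_cases i
    exacts [Complex.arg_le_pi _, hb1, Complex.arg_le_pi _]
  · apply ext_coord <;> simp [cb] <;> linarith
  · apply ext_coord <;> simp only [eulerV_zero, eulerV_one, eulerV_two, Matrix.cons_val_zero,
      Matrix.cons_val_one, Matrix.cons_val, cb, cc, sc]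
    · rw [hs, ht]
      linear_combination (Real.cos a * v 0 + Real.sin a * v 1) * Real.cos a * hb2
        - Real.sin b * Real.cos a * hv0 + v 0 * a2
    · rw [hs, ht]
      linear_combination (Real.cos a * v 0 + Real.sin a * v 1) * Real.sin a * hb2
        - Real.sin b * Real.sin a * hv0 + v 1 * a2
    · rw [hs]
      linear_combination v 2 * hb2 - x 2 * hv0

/-- The frames whose Euler angles are uniquely determined, up to the length of the vector. -/
def eulerSlit : Set E6 := {p | (⟨p.1 0, p.1 1⟩ : ℂ) ∈ Complex.slitPlane ∧
  (⟨-p.2 2, p.1 0 * p.2 1 - p.1 1 * p.2 0⟩ : ℂ) ∈ Complex.slitPlane}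

/-- The Euler angles of a frame. -/
def eulerCoord (p : E6) : Fin 3 → ℝ := ![Complex.arg ⟨p.1 0, p.1 1⟩, Real.arccos (p.1 2),
  Complex.arg ⟨-p.2 2, p.1 0 * p.2 1 - p.1 1 * p.2 0⟩]

/-- The two complex numbers of `eulerSlit` appear in polar form, with angles `y 0` and `y 2`, so the
Euler angles can be read off with `Complex.arg`. -/
theorem euler_complex (y : Fin 3 → ℝ) (c : ℝ) :
    (⟨eulerX y 0, eulerX y 1⟩ : ℂ) =
      (Real.sin (y 1) : ℂ) * (Complex.cos (y 0) + Complex.sin (y 0) * Complex.I) ∧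
    (⟨-(c • eulerV y) 2, eulerX y 0 * (c • eulerV y) 1 - eulerX y 1 * (c • eulerV y) 0⟩ : ℂ) =
      ((c * Real.sin (y 1) : ℝ) : ℂ) * (Complex.cos (y 2) + Complex.sin (y 2) * Complex.I) := by
  have h0 := Real.sin_sq_add_cos_sq (y 0)
  refine ⟨?_, ?_⟩ <;>
    rw [← Complex.ofReal_cos, ← Complex.ofReal_sin, Complex.ext_iff, Complex.re_ofReal_mul,
      Complex.im_ofReal_mul]
  · simpa using ⟨mul_comm _ _, mul_comm _ _⟩
  · simp [-Complex.ofReal_cos, -Complex.ofReal_sin]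
    exact ⟨by ring, by linear_combination c * Real.sin (y 1) * Real.sin (y 2) * h0⟩

theorem eulerCoord_euler {y : Fin 3 → ℝ} (hy : y ∈ eulerBox) {c : ℝ} (hc : 0 < c) :
    eulerCoord (eulerX y, c • eulerV y) = y := by
  rw [mem_eulerBox] at hy
  have hs : 0 < Real.sin (y 1) := Real.sin_pos_of_pos_of_lt_pi hy.2.1.1 hy.2.1.2
  simp only [eulerCoord, (euler_complex y c).1, (euler_complex y c).2,
    Complex.arg_mul_cos_add_sin_mul_I hs ⟨hy.1.1, hy.1.2.le⟩,
    Complex.arg_mul_cos_add_sin_mul_I (mul_pos hc hs) ⟨hy.2.2.1, hy.2.2.2.le⟩, eulerX_two,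
    Real.arccos_cos hy.2.1.1.le hy.2.1.2.le]
  ext i; fin_cases i <;> rfl

theorem euler_mem_eulerSlit {y : Fin 3 → ℝ} (hy : y ∈ eulerBox) {c : ℝ} (hc : 0 < c) :
    (eulerX y, c • eulerV y) ∈ eulerSlit := by
  rw [mem_eulerBox] at hy
  have hs : 0 < Real.sin (y 1) := Real.sin_pos_of_pos_of_lt_pi hy.2.1.1 hy.2.1.2
  have hn : ∀ {r t : ℝ}, 0 < r → (r : ℂ) * (Complex.cos t + Complex.sin t * Complex.I) ≠ 0 :=
    fun hr ↦ mul_ne_zero (Complex.ofReal_ne_zero.2 hr.ne')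
      (by rw [← Complex.exp_mul_I]; exact Complex.exp_ne_zero _)
  refine ⟨?_, ?_⟩ <;> simp only [(euler_complex y c).1, (euler_complex y c).2] <;>
    rw [Complex.mem_slitPlane_iff_arg]
  · rw [Complex.arg_mul_cos_add_sin_mul_I hs ⟨hy.1.1, hy.1.2.le⟩]
    exact ⟨hy.1.2.ne, hn hs⟩
  · rw [Complex.arg_mul_cos_add_sin_mul_I (mul_pos hc hs) ⟨hy.2.2.1, hy.2.2.2.le⟩]
    exact ⟨hy.2.2.2.ne, hn (mul_pos hc hs)⟩

/-- On the boundary of the box either `sin (y 1)` vanishes or one of the arguments is `±π`; the slit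
plane excludes both. -/
theorem mem_eulerBox_of_mem_eulerSlit {y : Fin 3 → ℝ} (hy : y ∈ Icc eulerLo eulerHi) {c : ℝ}
    (hc : 0 < c) (h : (eulerX y, c • eulerV y) ∈ eulerSlit) : y ∈ eulerBox := by
  have hlo := hy.1
  have hhi := hy.2
  simp only [Pi.le_def, Fin.forall_fin_succ, eulerLo, eulerHi] at hlo hhi
  simp at hlo hhi
  obtain ⟨h1, h2⟩ := h
  simp only [(euler_complex y c).1, (euler_complex y c).2] at h1 h2
  have hs0 : 0 ≤ Real.sin (y 1) := Real.sin_nonneg_of_nonneg_of_le_pi hlo.2.1 hhi.2.1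
  have hs : Real.sin (y 1) ≠ 0 := fun h0 ↦ by
    rw [h0] at h1
    simp at h1
  have key : ∀ {r t : ℝ}, 0 ≤ r → -Real.pi ≤ t → t ≤ Real.pi →
      (r : ℂ) * (Complex.cos t + Complex.sin t * Complex.I) ∈ Complex.slitPlane →
      t ∈ Ioo (-Real.pi) Real.pi := by
    intro r t hr ht1 ht2 hm
    refine ⟨lt_of_le_of_ne ht1 ?_, lt_of_le_of_ne ht2 ?_⟩ <;> rintro rfl <;>
      rw [Complex.mem_slitPlane_iff, Complex.re_ofReal_mul, Complex.im_ofReal_mul,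
        ← Complex.ofReal_cos, ← Complex.ofReal_sin] at hm <;> simp at hm <;> linarith
  refine mem_eulerBox.2 ⟨key hs0 hlo.1 hhi.1 h1, ⟨lt_of_le_of_ne hlo.2.1 ?_,
    lt_of_le_of_ne hhi.2.1 ?_⟩, key (mul_nonneg hc.le hs0) hlo.2.2 hhi.2.2 h2⟩
  · intro h0; rw [← h0] at hs; simp at hs
  · intro h0; rw [h0] at hs; simp at hs

theorem isOpen_eulerSlit : IsOpen eulerSlit := by
  have c1 (i : Fin 3) : Continuous fun p : E6 ↦ p.1 i := by fun_prop
  have c2 (i : Fin 3) : Continuous fun p : E6 ↦ p.2 i := by fun_prop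
  have hm : ∀ {f g : E6 → ℝ}, Continuous f → Continuous g →
      Continuous fun p ↦ (⟨f p, g p⟩ : ℂ) := fun hf hg ↦
    Complex.equivRealProdCLM.symm.continuous.comp (hf.prodMk hg)
  exact (Complex.isOpen_slitPlane.preimage (hm (c1 0) (c1 1))).inter
    (Complex.isOpen_slitPlane.preimage (hm (c2 2).neg
      (((c1 0).mul (c2 1)).sub ((c1 1).mul (c2 0)))))

/-- The argument is the imaginary part of the logarithm, and the slit condition also keeps `p.1`
away from the poles, where `arccos` is singular. -/
theorem differentiableAt_eulerCoord {p : E6} (hx : p.1 ∈ S2) (hp : p ∈ eulerSlit) :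
    DifferentiableAt ℝ eulerCoord p := by
  have d1 (i : Fin 3) : DifferentiableAt ℝ (fun p : E6 ↦ p.1 i) p := by fun_prop
  have d2 (i : Fin 3) : DifferentiableAt ℝ (fun p : E6 ↦ p.2 i) p := by fun_prop
  have hm : ∀ {f g : E6 → ℝ}, DifferentiableAt ℝ f p → DifferentiableAt ℝ g p →
      (⟨f p, g p⟩ : ℂ) ∈ Complex.slitPlane →
      DifferentiableAt ℝ (fun p ↦ Complex.arg ⟨f p, g p⟩) p := fun {f g} hf hg hs ↦ by
    have h1 : DifferentiableAt ℝ (fun p ↦ (⟨f p, g p⟩ : ℂ)) p :=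
      Complex.equivRealProdCLM.symm.differentiableAt.comp p (hf.prodMk hg)
    have h2 : DifferentiableAt ℝ Complex.log (⟨f p, g p⟩ : ℂ) :=
      (Complex.differentiableAt_log hs).restrictScalars ℝ
    have h3 := Complex.imCLM.differentiableAt.comp p (h2.comp p h1)
    exact h3.congr_of_eventuallyEq (Eventually.of_forall fun q ↦ (Complex.log_im _).symm)
  have hx' := mem_S2_iff.1 hx
  have hpos : p.1 0 ^ 2 + p.1 1 ^ 2 ≠ 0 := fun h0 ↦ by
    have e0 : p.1 0 = 0 := by nlinarith [sq_nonneg (p.1 0), sq_nonneg (p.1 1)]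
    have e1 : p.1 1 = 0 := by nlinarith [sq_nonneg (p.1 0), sq_nonneg (p.1 1)]
    exact Complex.slitPlane_ne_zero hp.1 (by rw [e0, e1]; rfl)
  have h2 : DifferentiableAt ℝ Real.arccos (p.1 2) := Real.differentiableAt_arccos.2
    ⟨fun h ↦ hpos (by rw [h] at hx'; linarith), fun h ↦ hpos (by rw [h] at hx'; linarith)⟩
  refine differentiableAt_pi.2 fun i ↦ ?_
  fin_cases i
  · exact hm (d1 0) (d1 1) hp.1
  · exact DifferentiableAt.comp (f := fun q : E6 ↦ q.1 2) p h2 (d1 2)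
  · exact hm (d2 2).neg (((d1 0).mul (d2 1)).sub ((d1 1).mul (d2 0))) hp.2

/-! ### Charts of the unit tangent bundle -/

theorem mem_S2_isometry (L : E3 ≃ₗᵢ[ℝ] E3) {x : E3} (hx : x ∈ S2) : L x ∈ S2 := by
  rw [mem_S2_iff_inner] at *
  rw [L.inner_map_map, hx]

theorem mem_tangentS2_isometry (L : E3 ≃ₗᵢ[ℝ] E3) {x v : E3} (hv : v ∈ tangentS2 x) :
    L v ∈ tangentS2 (L x) := by
  rw [mem_tangentS2] at *
  rw [L.inner_map_map, hv]

theorem ne_zero_of_mem_S2 {x : E3} (hx : x ∈ S2) : x ≠ 0 := fun h ↦ by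
  rw [mem_S2_iff_inner, h] at hx
  simp at hx

namespace MagneticSystem

variable (M : MagneticSystem)

/-- Rescaling of the fibre vector to a unit vector of the metric `g`. -/
def normalizeFibre (p : E6) : E6 := (p.1, (Real.sqrt (M.g p.1 p.2 p.2))⁻¹ • p.2)

theorem normalizeFibre_mem {p : E6} (hx : p.1 ∈ S2) (hv : p.2 ∈ tangentS2 p.1) (h0 : p.2 ≠ 0) :
    M.normalizeFibre p ∈ M.unitBundle := by
  have h := M.g_pos p.1 hx p.2 hv h0
  rw [mem_unitBundle]
  refine ⟨hx, Submodule.smul_mem _ _ hv, ?_⟩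
  simp only [normalizeFibre, map_smul, smul_apply, smul_eq_mul]
  rw [← mul_assoc, ← mul_inv, Real.mul_self_sqrt h.le, inv_mul_cancel₀ h.ne']

/-- Away from the tangent planes of the sphere `g(v, v)` may be negative; there `Real.sqrt` is `0`
and the fibre component is locally zero. -/
theorem contDiffAt_normalizeFibre {p : E6} (h : M.g p.1 p.2 p.2 ≠ 0) :
    ContDiffAt ℝ ∞ M.normalizeFibre p := by
  have hg : ContDiffAt ℝ ∞ (fun p : E6 ↦ M.g p.1 p.2 p.2) p :=
    (((M.g_smooth.comp contDiff_fst).clm_apply contDiff_snd).clm_apply contDiff_snd).contDiffAt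
  unfold normalizeFibre
  by_cases h0 : 0 < M.g p.1 p.2 p.2
  · exact contDiffAt_fst.prodMk (((hg.sqrt h).inv (Real.sqrt_pos.2 h0).ne').smul contDiffAt_snd)
  · have hlt : M.g p.1 p.2 p.2 < 0 := lt_of_le_of_ne (not_lt.1 h0) h
    have hev : ∀ᶠ q : E6 in 𝓝 p, M.g q.1 q.2 q.2 < 0 := hg.continuousAt.eventually_lt_const hlt
    refine (contDiffAt_fst.prodMk (contDiffAt_const (c := (0 : E3)))).congr_of_eventuallyEq ?_
    filter_upwards [hev] with q hq
    simp [Real.sqrt_eq_zero_of_nonpos hq.le]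

/-- The Euler angle parametrization of the unit tangent bundle, in the coordinates given by a
linear isometry. -/
def eulerChart (L : E3 ≃ₗᵢ[ℝ] E3) (y : Fin 3 → ℝ) : E6 :=
  M.normalizeFibre (L (eulerX y), L (eulerV y))

theorem g_euler_pos (L : E3 ≃ₗᵢ[ℝ] E3) (y : Fin 3 → ℝ) :
    0 < M.g (L (eulerX y)) (L (eulerV y)) (L (eulerV y)) :=
  M.g_pos _ (mem_S2_isometry L (eulerX_mem y)) _ (mem_tangentS2_isometry L (eulerV_mem y))
    (by simpa using ne_zero_of_mem_S2 (eulerV_mem_S2 y))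

theorem eulerChart_mem (L : E3 ≃ₗᵢ[ℝ] E3) (y : Fin 3 → ℝ) : M.eulerChart L y ∈ M.unitBundle :=
  M.normalizeFibre_mem (mem_S2_isometry L (eulerX_mem y))
    (mem_tangentS2_isometry L (eulerV_mem y)) (by simpa using ne_zero_of_mem_S2 (eulerV_mem_S2 y))

theorem contDiff_euler (L : E3 ≃ₗᵢ[ℝ] E3) :
    ContDiff ℝ ∞ fun y ↦ ((L (eulerX y), L (eulerV y)) : E6) :=
  (L.toContinuousLinearEquiv.contDiff.comp contDiff_eulerX).prodMk
    (L.toContinuousLinearEquiv.contDiff.comp contDiff_eulerV)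

theorem contDiff_eulerChart (L : E3 ≃ₗᵢ[ℝ] E3) : ContDiff ℝ ∞ (M.eulerChart L) :=
  contDiff_iff_contDiffAt.2 fun y ↦ ContDiffAt.comp y
    (M.contDiffAt_normalizeFibre (M.g_euler_pos L y).ne') (contDiff_euler L).contDiffAt

/-- Rescaling of the fibre vector to a round unit vector. -/
def roundFrame (L : E3 ≃ₗᵢ[ℝ] E3) (p : E6) : E6 := (L.symm p.1, ‖p.2‖⁻¹ • L.symm p.2)

/-- `roundFrame` undoes the isometry and the rescaling, so the chart inherits injectivity and the
immersion property from the Euler angles, where `g` plays no role. -/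
theorem roundFrame_eulerChart (L : E3 ≃ₗᵢ[ℝ] E3) (y : Fin 3 → ℝ) :
    roundFrame L (M.eulerChart L y) = (eulerX y, eulerV y) := by
  have h := Real.sqrt_pos.2 (M.g_euler_pos L y)
  have h1 : ‖eulerV y‖ = 1 := by simpa [S2] using eulerV_mem_S2 y
  simp only [roundFrame, eulerChart, normalizeFibre, L.symm_apply_apply, map_smul, norm_smul,
    L.norm_map, h1, mul_one, norm_inv, Real.norm_eq_abs, abs_of_pos h, inv_inv, smul_smul,
    mul_inv_cancel₀ h.ne', one_smul]

theorem differentiableAt_roundFrame (L : E3 ≃ₗᵢ[ℝ] E3) {p : E6} (h : p.2 ≠ 0) :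
    DifferentiableAt ℝ (roundFrame L) p := by
  have h1 : DifferentiableAt ℝ (fun p : E6 ↦ ‖p.2‖⁻¹) p :=
    (differentiableAt_snd.norm ℝ h).inv (norm_ne_zero_iff.2 h)
  exact (L.symm.toContinuousLinearEquiv.differentiableAt.comp p differentiableAt_fst).prodMk
    (h1.smul (L.symm.toContinuousLinearEquiv.differentiableAt.comp p differentiableAt_snd))

theorem injective_fderiv_eulerChart (L : E3 ≃ₗᵢ[ℝ] E3) {y : Fin 3 → ℝ} (hy : y ∈ eulerBox) :
    Function.Injective (fderiv ℝ (M.eulerChart L) y) := by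
  rw [injective_iff_map_eq_zero]
  intro h hh
  have h1 := ((M.contDiff_eulerChart L).differentiable (by simp) y).hasFDerivAt
  have h2 := (differentiableAt_roundFrame L (snd_ne_zero (M.eulerChart_mem L y))).hasFDerivAt
  have h3 := h2.comp y h1
  have e : roundFrame L ∘ M.eulerChart L = fun y ↦ (eulerX y, eulerV y) :=
    funext fun y ↦ M.roundFrame_eulerChart L y
  rw [e] at h3
  obtain ⟨D, hD, hD'⟩ := hasFDerivAt_eulerX y
  obtain ⟨G, hG, hG'⟩ := hasFDerivAt_eulerV y
  have h4 := congrArg (fun A : (Fin 3 → ℝ) →L[ℝ] E6 ↦ A h) (h3.unique (hD.prodMk hG))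
  simp only [ContinuousLinearMap.comp_apply, hh, map_zero, ContinuousLinearMap.prod_apply, hD', hG']
    at h4
  exact euler_immersion hy (congrArg Prod.fst h4).symm (congrArg Prod.snd h4).symm

theorem injOn_eulerChart (L : E3 ≃ₗᵢ[ℝ] E3) : InjOn (M.eulerChart L) eulerBox := by
  intro y hy z hz h
  have h1 := congrArg (roundFrame L) h
  rw [roundFrame_eulerChart, roundFrame_eulerChart] at h1
  exact euler_injOn hy hz (congrArg Prod.fst h1) (congrArg Prod.snd h1)

theorem isParametrization_eulerChart (L : E3 ≃ₗᵢ[ℝ] E3) :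
    IsParametrization M.unitBundle eulerBox (M.eulerChart L) :=
  ⟨isOpen_eulerBox, (M.contDiff_eulerChart L).contDiffOn, M.injOn_eulerChart L,
    fun y _ ↦ M.eulerChart_mem L y, fun _ hy ↦ M.injective_fderiv_eulerChart L hy⟩

/-- Velocities of maps into the unit tangent bundle are tangent to it. -/
theorem fderiv_mem_tangentUnitBundle {U : Set (Fin 3 → ℝ)} (hU : IsOpen U)
    {φ : (Fin 3 → ℝ) → E6} (hφ : ContDiffOn ℝ ∞ φ U) (hm : MapsTo φ U M.unitBundle)
    {y : Fin 3 → ℝ} (hy : y ∈ U) (h : Fin 3 → ℝ) :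
    fderiv ℝ φ y h ∈ M.tangentUnitBundle (φ y) := by
  have hd : HasFDerivAt φ (fderiv ℝ φ y) y :=
    ((hφ.contDiffAt (hU.mem_nhds hy)).differentiableAt (by simp)).hasFDerivAt
  have h1 : HasFDerivAt (fun z ↦ (φ z).1) ((ContinuousLinearMap.fst ℝ E3 E3).comp (fderiv ℝ φ y)) y :=
    hasFDerivAt_fst.comp y hd
  have h2 : HasFDerivAt (fun z ↦ (φ z).2) ((ContinuousLinearMap.snd ℝ E3 E3).comp (fderiv ℝ φ y)) y :=
    hasFDerivAt_snd.comp y hd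
  have hc : ∀ {F : (Fin 3 → ℝ) → ℝ} {F' : (Fin 3 → ℝ) →L[ℝ] ℝ} {c : ℝ}, HasFDerivAt F F' y →
      (∀ z ∈ U, F z = c) → F' = 0 := fun hF hFc ↦
    hF.unique ((hasFDerivAt_const _ y).congr_of_eventuallyEq
      (Filter.eventually_of_mem (hU.mem_nhds hy) hFc))
  have k1 := congrArg (fun A ↦ A h) (hc (h1.inner ℝ h1) fun z hz ↦ mem_S2_iff_inner.1 (hm hz).1)
  have k2 := congrArg (fun A ↦ A h) (hc (h1.inner ℝ h2) fun z hz ↦ mem_tangentS2.1 (hm hz).2.1)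
  have k3 := congrArg (fun A ↦ A h) (hc (((M.contDiff_energy.differentiable (by simp)
    (φ y)).hasFDerivAt).comp y hd) fun z hz ↦ (hm hz).2.2)
  rw [mem_tangentUnitBundle, mem_tangentS2]
  simp [real_inner_comm, ← two_mul] at k1 k2 k3
  refine ⟨by rw [real_inner_comm]; simpa [real_inner_comm] using k1, ?_, k3⟩
  rw [real_inner_comm] at k2
  simpa [real_inner_comm, add_comm] using k2

theorem eulerChart_tangent (L : E3 ≃ₗᵢ[ℝ] E3) (y h : Fin 3 → ℝ) :
    fderiv ℝ (M.eulerChart L) y h ∈ M.tangentUnitBundle (M.eulerChart L y) :=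
  M.fderiv_mem_tangentUnitBundle isOpen_univ (M.contDiff_eulerChart L).contDiffOn
    (fun y _ ↦ M.eulerChart_mem L y) (mem_univ y) h

theorem exists_eulerChart_eq (L : E3 ≃ₗᵢ[ℝ] E3) {p : E6} (hp : p ∈ M.unitBundle) :
    ∃ y ∈ Icc eulerLo eulerHi, M.eulerChart L y = p ∧
      L.symm p.1 = eulerX y ∧ ‖p.2‖⁻¹ • L.symm p.2 = eulerV y := by
  have hn : ‖p.2‖ ≠ 0 := norm_ne_zero_iff.2 (snd_ne_zero hp)
  obtain ⟨y, hy, hX, hV⟩ := exists_euler (x := L.symm p.1) (v := ‖p.2‖⁻¹ • L.symm p.2)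
    (mem_S2_isometry L.symm hp.1)
    (Submodule.smul_mem _ _ (mem_tangentS2_isometry L.symm hp.2.1))
    (by simp [S2, norm_smul, hn])
  refine ⟨y, hy, ?_, hX.symm, hV.symm⟩
  rw [eulerChart, hX, hV, normalizeFibre]
  simp only [map_smul, L.apply_symm_apply, smul_apply, smul_eq_mul, g_snd_snd hp, mul_one]
  rw [Real.sqrt_mul_self (by positivity), inv_inv, smul_smul, mul_inv_cancel₀ hn, one_smul]

theorem mem_image_eulerChart (L : E3 ≃ₗᵢ[ℝ] E3) {p : E6} (hp : p ∈ M.unitBundle)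
    (h : (L.symm p.1, L.symm p.2) ∈ eulerSlit) : p ∈ M.eulerChart L '' eulerBox := by
  have hn : 0 < ‖p.2‖ := norm_pos_iff.2 (snd_ne_zero hp)
  obtain ⟨y, hy, he, hX, hV⟩ := M.exists_eulerChart_eq L hp
  refine ⟨y, mem_eulerBox_of_mem_eulerSlit hy hn ?_, he⟩
  rwa [← hX, ← hV, smul_smul, mul_inv_cancel₀ hn.ne', one_smul]

theorem eulerChart_eq (L : E3 ≃ₗᵢ[ℝ] E3) (y : Fin 3 → ℝ) : ∃ c : ℝ, 0 < c ∧
    (L.symm (M.eulerChart L y).1, L.symm (M.eulerChart L y).2) = (eulerX y, c • eulerV y) :=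
  ⟨_, inv_pos.2 (Real.sqrt_pos.2 (M.g_euler_pos L y)), by simp [eulerChart, normalizeFibre]⟩

/-- The Euler angle charts in the permuted coordinates cover the unit tangent bundle. -/
theorem exists_perm_mem_image_eulerChart {p : E6} (hp : p ∈ M.unitBundle) :
    ∃ s : Equiv.Perm (Fin 3),
      p ∈ M.eulerChart (LinearIsometryEquiv.piLpCongrLeft 2 ℝ ℝ s) '' eulerBox := by
  have hx := mem_S2_iff.1 hp.1
  have hv := mem_tangentS2_iff.1 hp.2.1
  have hv0 := snd_ne_zero hp
  -- The two inequalities make the imaginary parts in `eulerSlit` non-zero. If no permutation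
  -- satisfied them, all two-by-two minors of `(x, v)` would vanish, and `v`, parallel and
  -- orthogonal to `x`, would be zero.
  have key : ∃ s : Equiv.Perm (Fin 3), p.1 (s 1) ≠ 0 ∧
      p.1 (s 0) * p.2 (s 1) - p.1 (s 1) * p.2 (s 0) ≠ 0 := by
    by_contra! h
    have hs : ∀ i j : Fin 3, i ≠ j → ∃ s : Equiv.Perm (Fin 3), s 0 = i ∧ s 1 = j := by decide
    have hij : ∀ i j : Fin 3, i ≠ j → p.1 j ≠ 0 → p.1 i * p.2 j - p.1 j * p.2 i = 0 := by
      intro i j hne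
      obtain ⟨s, rfl, rfl⟩ := hs i j hne
      exact h s
    have minor : ∀ i j : Fin 3, i ≠ j → p.1 i * p.2 j - p.1 j * p.2 i = 0 := by
      intro i j hne
      by_cases h0 : p.1 j = 0
      · by_cases h0' : p.1 i = 0
        · rw [h0, h0']; ring
        · linarith [hij j i hne.symm h0']
      · exact hij i j hne h0
    have m01 := minor 0 1 (by decide)
    have m02 := minor 0 2 (by decide)
    have m12 := minor 1 2 (by decide)
    refine hv0 (ext_coord ?_ ?_ ?_) <;> simp only [PiLp.zero_apply]
    · linear_combination -p.2 0 * hx + p.1 0 * hv - p.1 1 * m01 - p.1 2 * m02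
    · linear_combination -p.2 1 * hx + p.1 1 * hv + p.1 0 * m01 - p.1 2 * m12
    · linear_combination -p.2 2 * hx + p.1 2 * hv + p.1 0 * m02 + p.1 1 * m12
  obtain ⟨s, h1, h2⟩ := key
  have hs : ∀ (x : E3) i, (LinearIsometryEquiv.piLpCongrLeft 2 ℝ ℝ s).symm x i = x (s i) :=
    fun x i ↦ by simp [LinearIsometryEquiv.piLpCongrLeft_apply, Equiv.piCongrLeft']
  refine ⟨s, M.mem_image_eulerChart _ hp ⟨?_, ?_⟩⟩ <;> rw [Complex.mem_slitPlane_iff] <;>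
    simp only [hs]
  exacts [Or.inr h1, Or.inr h2]

end MagneticSystem

/-! ### Pull-backs and Stokes' theorem -/

section Covector

variable {E : Type*} [NormedAddCommGroup E] [NormedSpace ℝ E]

/-- The covector of an alternating form of degree one. -/
def toCovector : E [⋀^Fin 1]→L[ℝ] ℝ →L[ℝ] (E →L[ℝ] ℝ) :=
  (ContinuousAlternatingMap.ofSubsingletonLIE (𝕜 := ℝ) (E := E) (F := ℝ)
    (0 : Fin 1)).symm.toContinuousLinearEquiv.toContinuousLinearMap

theorem toCovector_apply (τ : E [⋀^Fin 1]→L[ℝ] ℝ) (a : E) : toCovector τ a = τ ![a] := by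
  have h : oneForm (toCovector τ) = τ :=
    (ContinuousAlternatingMap.ofSubsingletonLIE (𝕜 := ℝ) (E := E) (F := ℝ)
      (0 : Fin 1)).apply_symm_apply τ
  conv_rhs => rw [← h]
  simp

end Covector

section PullBack

variable {e : (Fin 3 → ℝ) → E6} {τ : E6 → E6 [⋀^Fin 1]→L[ℝ] ℝ}

/-- The components of the pull-back of a one-form. -/
def pullComp (e : (Fin 3 → ℝ) → E6) (τ : E6 → E6 [⋀^Fin 1]→L[ℝ] ℝ) (i : Fin 3) (y : Fin 3 → ℝ) :
    ℝ := τ (e y) ![fderiv ℝ e y (Pi.single i 1)]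

theorem contDiff_pull (he : ContDiff ℝ ∞ e) (hτ : ContDiff ℝ ∞ τ) :
    ContDiff ℝ ∞ fun y ↦ (toCovector (τ (e y))).comp (fderiv ℝ e y) :=
  ((hτ.comp he).continuousLinearMap_comp toCovector).clm_comp (he.fderiv_right (m := ∞) (by simp))

theorem pullComp_eq (i : Fin 3) : pullComp e τ i =
    fun y ↦ (toCovector (τ (e y))).comp (fderiv ℝ e y) (Pi.single i 1) := by
  ext y; simp [pullComp, toCovector_apply]

theorem contDiff_pullComp (he : ContDiff ℝ ∞ e) (hτ : ContDiff ℝ ∞ τ) (i : Fin 3) :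
    ContDiff ℝ ∞ (pullComp e τ i) := by
  rw [pullComp_eq]
  exact (contDiff_pull he hτ).clm_apply contDiff_const

/-- Naturality of `d` under pull-back, evaluated on coordinate vectors. -/
theorem extDeriv_pullComp (he : ContDiff ℝ ∞ e) (hτ : ContDiff ℝ ∞ τ) (i j : Fin 3)
    (y : Fin 3 → ℝ) :
    extDeriv τ (e y) ![fderiv ℝ e y (Pi.single i 1), fderiv ℝ e y (Pi.single j 1)] =
      fderiv ℝ (pullComp e τ j) y (Pi.single i 1) - fderiv ℝ (pullComp e τ i) y (Pi.single j 1) := by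
  have hd : DifferentiableAt ℝ τ (e y) := hτ.differentiable (by simp) (e y)
  have h := extDeriv_pullback (f := e) (x := y) (r := 2) hd (contDiff_infty.1 he 2).contDiffAt
    (by simp)
  have hP : (fun x ↦ (τ (e x)).compContinuousLinearMap (fderiv ℝ e x)) =
      fun x ↦ oneForm ((toCovector (τ (e x))).comp (fderiv ℝ e x)) := by
    ext x v
    simp only [ContinuousAlternatingMap.compContinuousLinearMap_apply, oneForm_apply,
      ContinuousLinearMap.comp_apply, toCovector_apply]
    congr 1
    ext i : 1; fin_cases i; rfl
  have hs : ContDiff ℝ ∞ fun x ↦ oneForm ((toCovector (τ (e x))).comp (fderiv ℝ e x)) :=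
    (contDiff_pull he hτ).continuousLinearMap_comp oneForm
  have h' := congrArg (fun A ↦ A ![Pi.single i 1, Pi.single j 1]) h
  rw [hP] at h'
  change extDeriv _ y ![Pi.single i 1, Pi.single j 1] = _ at h'
  rw [extDeriv_pair (hs.differentiable (by simp) y)] at h'
  simp only [oneForm_apply, Matrix.cons_val_zero, ← pullComp_eq] at h'
  rw [h', ContinuousAlternatingMap.compContinuousLinearMap_apply]
  congr 1
  ext i : 1; fin_cases i <;> rfl

end PullBack

namespace MagneticSystem

/-- The integrand of Stokes' theorem for the wedge product of two one-forms is a divergence. -/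
theorem wedge_eq_divergence {e : (Fin 3 → ℝ) → E6} {β τ : E6 → E6 [⋀^Fin 1]→L[ℝ] ℝ}
    (he : ContDiff ℝ ∞ e) (hβ : ContDiff ℝ ∞ β) (hτ : ContDiff ℝ ∞ τ) (y : Fin 3 → ℝ) :
    wedge12 (fun a ↦ τ (e y) ![a]) (fun a b ↦ extDeriv β (e y) ![a, b])
        (fun i ↦ fderiv ℝ e y (Pi.single i 1))
      - wedge12 (fun a ↦ β (e y) ![a]) (fun a b ↦ extDeriv τ (e y) ![a, b])
        (fun i ↦ fderiv ℝ e y (Pi.single i 1)) =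
    fderiv ℝ (fun y ↦ pullComp e β 1 y * pullComp e τ 2 y - pullComp e β 2 y * pullComp e τ 1 y) y
        (Pi.single 0 1)
      + fderiv ℝ (fun y ↦ pullComp e β 2 y * pullComp e τ 0 y
          - pullComp e β 0 y * pullComp e τ 2 y) y (Pi.single 1 1)
      + fderiv ℝ (fun y ↦ pullComp e β 0 y * pullComp e τ 1 y
          - pullComp e β 1 y * pullComp e τ 0 y) y (Pi.single 2 1) := by
  have dβ i := ((contDiff_pullComp he hβ i).differentiable (by simp) y).hasFDerivAt
  have dτ i := ((contDiff_pullComp he hτ i).differentiable (by simp) y).hasFDerivAt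
  have hd : ∀ i j h, fderiv ℝ (fun y ↦ pullComp e β i y * pullComp e τ j y
      - pullComp e β j y * pullComp e τ i y) y h =
      pullComp e β i y * fderiv ℝ (pullComp e τ j) y h + pullComp e τ j y * fderiv ℝ (pullComp e β i) y h
      - (pullComp e β j y * fderiv ℝ (pullComp e τ i) y h
        + pullComp e τ i y * fderiv ℝ (pullComp e β j) y h) := fun i j h ↦ by
    rw [(((dβ i).fun_mul (dτ j)).fun_sub ((dβ j).fun_mul (dτ i))).fderiv]
    simp
  rw [hd, hd, hd]
  simp only [wedge12, extDeriv_pullComp he hβ, extDeriv_pullComp he hτ]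
  simp only [← show ∀ i, pullComp e β i y = β (e y) ![fderiv ℝ e y (Pi.single i 1)] from fun _ ↦ rfl,
    ← show ∀ i, pullComp e τ i y = τ (e y) ![fderiv ℝ e y (Pi.single i 1)] from fun _ ↦ rfl]
  ring

variable (M : MagneticSystem)

/-- The Euler angle parametrization in the standard coordinates. -/
def chart : (Fin 3 → ℝ) → E6 := M.eulerChart (LinearIsometryEquiv.refl ℝ E3)

theorem contDiff_chart : ContDiff ℝ ∞ M.chart := M.contDiff_eulerChart _

theorem chart_periodic (i : Fin 3) (hi : i ≠ 1) (y : Fin 3 → ℝ) :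
    M.chart (y + Pi.single i (2 * Real.pi)) = M.chart y := by
  have h0 : eulerX (y + Pi.single i (2 * Real.pi)) = eulerX y := by
    fin_cases i <;> first | exact absurd rfl hi | (apply ext_coord <;> simp)
  have h1 : eulerV (y + Pi.single i (2 * Real.pi)) = eulerV y := by
    fin_cases i <;> first | exact absurd rfl hi | (apply ext_coord <;> simp)
  rw [chart, eulerChart, h0, h1, eulerChart]

theorem pullComp_periodic (τ : E6 → E6 [⋀^Fin 1]→L[ℝ] ℝ) (j i : Fin 3) (hi : i ≠ 1)
    (y : Fin 3 → ℝ) :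
    pullComp M.chart τ j (y + Pi.single i (2 * Real.pi)) = pullComp M.chart τ j y := by
  have h : fderiv ℝ M.chart (y + Pi.single i (2 * Real.pi)) = fderiv ℝ M.chart y := by
    rw [← fderiv_comp_add_right]
    congr 1
    exact funext fun z ↦ M.chart_periodic i hi z
  rw [pullComp, h, chart_periodic M i hi, pullComp]

/-- Over a pole the azimuth and the fibre angle both rotate the vector in its fibre, in the same or
in opposite directions according to the pole. -/
theorem fderiv_chart_pole {y : Fin 3 → ℝ} {ε : ℝ} (hs : Real.sin (y 1) = 0)
    (hε : Real.cos (y 1) = ε) (hε2 : ε ^ 2 = 1) :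
    fderiv ℝ M.chart y (Pi.single 0 1) = ε • fderiv ℝ M.chart y (Pi.single 2 1) := by
  obtain ⟨D, hD, hD'⟩ := hasFDerivAt_eulerX y
  obtain ⟨G, hG, hG'⟩ := hasFDerivAt_eulerV y
  have h1 := ((M.contDiffAt_normalizeFibre (p := (eulerX y, eulerV y))
    (M.g_euler_pos (LinearIsometryEquiv.refl ℝ E3) y).ne').differentiableAt (by simp)).hasFDerivAt
  have h2 := HasFDerivAt.comp (f := fun z ↦ (eulerX z, eulerV z)) y h1 (hD.prodMk hG)
  have h3 : M.chart = M.normalizeFibre ∘ fun z ↦ (eulerX z, eulerV z) := rfl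
  rw [h3, h2.fderiv]
  simp only [ContinuousLinearMap.comp_apply, ContinuousLinearMap.prod_apply, hD', hG', ← map_smul]
  congr 1
  refine Prod.ext (ext_coord ?_ ?_ ?_) (ext_coord ?_ ?_ ?_) <;>
    simp [eulerX', eulerV', hs, hε] <;> grind

theorem pullComp_pole (τ : E6 → E6 [⋀^Fin 1]→L[ℝ] ℝ) {y : Fin 3 → ℝ} {ε : ℝ}
    (hs : Real.sin (y 1) = 0) (hε : Real.cos (y 1) = ε) (hε2 : ε ^ 2 = 1) :
    pullComp M.chart τ 0 y = ε * pullComp M.chart τ 2 y := by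
  rw [pullComp, M.fderiv_chart_pole hs hε hε2, ← toCovector_apply, map_smul, toCovector_apply]
  rfl

theorem eulerLo_le_eulerHi : eulerLo ≤ eulerHi := by
  have := Real.pi_pos
  intro i
  fin_cases i <;> simp [eulerLo, eulerHi] <;> linarith

theorem insertNth_add_single (i : Fin 3) (a b : ℝ) (z : Fin 2 → ℝ) :
    (i.insertNth (a + b) z : Fin 3 → ℝ) = i.insertNth a z + Pi.single i b := by
  ext k
  refine Fin.succAboveCases i ?_ (fun j ↦ ?_) k
  · simp
  · simp [Fin.succAbove_ne]

/-- Stokes' theorem on the unit tangent bundle for the wedge product of two one-forms. -/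
theorem integral_wedge_sub_wedge {β τ : E6 → E6 [⋀^Fin 1]→L[ℝ] ℝ} (hβ : ContDiff ℝ ∞ β)
    (hτ : ContDiff ℝ ∞ τ) : ∫ y in Icc eulerLo eulerHi,
      (wedge12 (fun a ↦ τ (M.chart y) ![a]) (fun a b ↦ extDeriv β (M.chart y) ![a, b])
        (fun i ↦ fderiv ℝ M.chart y (Pi.single i 1))
      - wedge12 (fun a ↦ β (M.chart y) ![a]) (fun a b ↦ extDeriv τ (M.chart y) ![a, b])
        (fun i ↦ fderiv ℝ M.chart y (Pi.single i 1))) = 0 := by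
  have he := M.contDiff_chart
  simp only [wedge_eq_divergence he hβ hτ]
  set B := pullComp M.chart β
  set T := pullComp M.chart τ
  have cB i : ContDiff ℝ ∞ (B i) := contDiff_pullComp he hβ i
  have cT i : ContDiff ℝ ∞ (T i) := contDiff_pullComp he hτ i
  let f : Fin 3 → (Fin 3 → ℝ) → ℝ := ![fun y ↦ B 1 y * T 2 y - B 2 y * T 1 y,
    fun y ↦ B 2 y * T 0 y - B 0 y * T 2 y, fun y ↦ B 0 y * T 1 y - B 1 y * T 0 y]
  have cf : ∀ i, ContDiff ℝ ∞ (f i) := by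
    intro i
    fin_cases i <;> exact ((cB _).mul (cT _)).sub ((cB _).mul (cT _))
  have hcont : Continuous fun y ↦ ∑ i, fderiv ℝ (f i) y (Pi.single i 1) :=
    continuous_finsetSum _ fun i _ ↦ ((cf i).continuous_fderiv (by simp)).clm_apply continuous_const
  have key := (integral_divergence_of_hasFDerivAt_off_countable' eulerLo eulerHi eulerLo_le_eulerHi
    f (fun i y ↦ fderiv ℝ (f i) y) ∅ countable_empty (fun i ↦ (cf i).continuous.continuousOn)
    (fun y _ i ↦ ((cf i).differentiable (by simp) y).hasFDerivAt)
    (hcont.continuousOn.integrableOn_compact isCompact_Icc)).trans (Fin.sum_univ_three _)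
  simp_rw [show ∀ y, ∑ i, fderiv ℝ (f i) y (Pi.single i 1) = _ from
    fun y ↦ Fin.sum_univ_three _] at key
  -- The opposite faces in the azimuth and in the fibre angle differ by a full period, so their
  -- fluxes cancel.
  have per : ∀ i : Fin 3, i ≠ 1 → ∀ z : Fin 2 → ℝ,
      f i (i.insertNth (eulerHi i) z) = f i (i.insertNth (eulerLo i) z) := by
    intro i hi z
    have e : eulerHi i = eulerLo i + 2 * Real.pi := by
      fin_cases i <;> first | exact absurd rfl hi | (simp [eulerHi, eulerLo]; ring)
    have pB : ∀ j y, B j (y + Pi.single i (2 * Real.pi)) = B j y :=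
      fun j y ↦ M.pullComp_periodic β j i hi y
    have pT : ∀ j y, T j (y + Pi.single i (2 * Real.pi)) = T j y :=
      fun j y ↦ M.pullComp_periodic τ j i hi y
    have pf : ∀ k y, f k (y + Pi.single i (2 * Real.pi)) = f k y := by
      intro k y
      fin_cases k <;> simp [f, pB, pT]
    rw [e, insertNth_add_single, pf]
  -- On the polar faces the components `0` and `2` of both forms are proportional with the same
  -- factor, so the flux, a two-by-two determinant, is zero.
  have pole : ∀ y : Fin 3 → ℝ, Real.sin (y 1) = 0 → f 1 y = 0 := by
    intro y hs
    have hc : Real.cos (y 1) ^ 2 = 1 := by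
      have := Real.sin_sq_add_cos_sq (y 1)
      rw [hs] at this; linarith
    have h1 : B 0 y = _ := M.pullComp_pole β hs rfl hc
    have h2 : T 0 y = _ := M.pullComp_pole τ hs rfl hc
    simp only [f, Matrix.cons_val_one, Matrix.cons_val_zero]
    rw [h1, h2]
    ring
  have front : ∀ z : Fin 2 → ℝ, f 1 ((1 : Fin 3).insertNth (eulerHi 1) z) = 0 :=
    fun z ↦ pole _ (by simp [eulerHi])
  have back : ∀ z : Fin 2 → ℝ, f 1 ((1 : Fin 3).insertNth (eulerLo 1) z) = 0 :=
    fun z ↦ pole _ (by simp [eulerLo])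
  simp only [per 0 (by decide), per 2 (by decide), front, back, sub_self, integral_zero,
    add_zero] at key
  exact key

end MagneticSystem

/-! ### Existence of the Liouville measure -/

/-- The preimage under an immersion of the image of a null set under a differentiable map between
spaces of the same dimension is a null set. -/
theorem volume_immersion_preimage_eq_zero {U : Set (Fin 3 → ℝ)} (hU : IsOpen U)
    {φ : (Fin 3 → ℝ) → E6} (hφ : ContDiffOn ℝ ∞ φ U)
    (hi : ∀ y ∈ U, Function.Injective (fderiv ℝ φ y)) {e : (Fin 3 → ℝ) → E6}
    (he : Differentiable ℝ e) {F : Set (Fin 3 → ℝ)} (hF : volume F = 0) :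
    volume {y ∈ U | φ y ∈ e '' F} = 0 := by
  refine measure_null_of_locally_null _ fun y₀ hy₀ ↦ ?_
  -- Composed with a left inverse of its derivative, `φ` is a local diffeomorphism of three-space
  -- with inverse `L`. So the set lies locally in the image of `F` under `L ∘ A' ∘ e`, and
  -- differentiable maps of three-space preserve null sets.
  obtain ⟨A, hA⟩ := (fderiv ℝ φ y₀).toLinearMap.exists_leftInverse_of_injective
    (LinearMap.ker_eq_bot.2 (hi y₀ hy₀.1))
  let A' : E6 →L[ℝ] (Fin 3 → ℝ) := LinearMap.toContinuousLinearMap A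
  have hφ₀ : ContDiffAt ℝ ∞ φ y₀ := hφ.contDiffAt (hU.mem_nhds hy₀.1)
  have hg : ContDiffAt ℝ 1 (A' ∘ φ) y₀ :=
    A'.contDiff.contDiffAt.comp y₀ (hφ₀.of_le (by exact_mod_cast le_top))
  have hd : HasFDerivAt (A' ∘ φ)
      (ContinuousLinearEquiv.refl ℝ (Fin 3 → ℝ) : (Fin 3 → ℝ) →L[ℝ] (Fin 3 → ℝ)) y₀ := by
    have h := A'.hasFDerivAt.comp y₀ (hφ₀.differentiableAt (by simp)).hasFDerivAt
    refine h.congr_fderiv (ContinuousLinearMap.ext fun h ↦ ?_)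
    exact congrArg (fun B : (Fin 3 → ℝ) →ₗ[ℝ] (Fin 3 → ℝ) ↦ B h) hA
  set L := hg.localInverse hd one_ne_zero with hL
  have hL1 : ContDiffAt ℝ 1 L ((A' ∘ φ) y₀) := hg.to_localInverse hd one_ne_zero
  have hL2 : ∀ᶠ y in 𝓝 y₀, L ((A' ∘ φ) y) = y :=
    (hg.hasStrictFDerivAt' hd one_ne_zero).eventually_left_inverse
  have hL3 : ∀ᶠ z in 𝓝 ((A' ∘ φ) y₀), DifferentiableAt ℝ L z :=
    (hL1.eventually (by simp)).mono fun z hz ↦ hz.differentiableAt one_ne_zero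
  have hev := hL2.and (hg.continuousAt.eventually hL3)
  refine ⟨{y ∈ U | φ y ∈ e '' F} ∩ {y | L ((A' ∘ φ) y) = y ∧ DifferentiableAt ℝ L ((A' ∘ φ) y)},
    inter_mem_nhdsWithin _ hev, ?_⟩
  have hn : volume (L '' ({z | DifferentiableAt ℝ L z} ∩ (fun x ↦ A' (e x)) '' F)) = 0 := by
    refine addHaar_image_eq_zero_of_differentiableOn_of_addHaar_eq_zero volume
      (fun z hz ↦ hz.1.differentiableWithinAt) (measure_mono_null inter_subset_right ?_)
    exact addHaar_image_eq_zero_of_differentiableOn_of_addHaar_eq_zero volume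
      (A'.differentiable.comp he).differentiableOn hF
  refine measure_mono_null ?_ hn
  rintro y ⟨⟨-, x, hx, hxy⟩, h1, h2⟩
  exact ⟨_, ⟨h2, x, hx, by simp [hxy]⟩, h1⟩

theorem measurableSet_inter_preimage {U : Set (Fin 3 → ℝ)} (hU : IsOpen U)
    {φ : (Fin 3 → ℝ) → E6} (hφ : ContinuousOn φ U) {B : Set (Fin 3 → ℝ)} (hBU : B ⊆ U)
    (hB : MeasurableSet B) {O : Set E6} (hO : IsOpen O) : MeasurableSet (B ∩ φ ⁻¹' O) := by
  have h := hB.inter (hφ.isOpen_inter_preimage hU hO).measurableSet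
  rwa [← inter_assoc, inter_eq_left.2 hBU] at h

theorem volume_Icc_diff_eulerBox : volume (Icc eulerLo eulerHi \ eulerBox) = 0 :=
  ae_le_set.1 (Measure.univ_pi_Ioo_ae_eq_Icc (μ := fun _ : Fin 3 ↦ volume)).symm.le

namespace MagneticSystem

variable (M : MagneticSystem)

/-- The coframe `(α, ψ, η)` as a linear map. -/
def coframe (p : E6) : E6 →ₗ[ℝ] (Fin 3 → ℝ) :=
  LinearMap.pi ![M.alphaL p, M.psiL p, M.etaL p]

variable {M}

theorem liouvilleForm_eq_det {p : E6} (hp : p ∈ M.unitBundle) (D : (Fin 3 → ℝ) →L[ℝ] E6) :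
    M.liouvilleForm p (fun i ↦ D (Pi.single i 1)) =
      LinearMap.det (M.coframe p ∘ₗ (D : (Fin 3 → ℝ) →ₗ[ℝ] E6)) := by
  refine Eq.trans ?_ (LinearMap.det_toMatrix' (M.coframe p ∘ₗ (D : (Fin 3 → ℝ) →ₗ[ℝ] E6)))
  rw [liouvilleForm]
  congr 1
  ext i j
  fin_cases i <;> fin_cases j <;> simp [LinearMap.toMatrix'_apply, coframe, alphaL_apply, psiL_apply hp, etaL_apply]

/-- The transformation rule for densities, by multiplicativity of the determinant. -/
theorem liouvilleForm_comp {p : E6} (hp : p ∈ M.unitBundle) (D : (Fin 3 → ℝ) →L[ℝ] E6)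
    (Q : (Fin 3 → ℝ) →L[ℝ] (Fin 3 → ℝ)) :
    M.liouvilleForm p (fun i ↦ D.comp Q (Pi.single i 1)) =
      Q.det * M.liouvilleForm p (fun i ↦ D (Pi.single i 1)) := by
  rw [liouvilleForm_eq_det hp, liouvilleForm_eq_det hp, mul_comm]
  exact LinearMap.det_comp (M.coframe p ∘ₗ (D : (Fin 3 → ℝ) →ₗ[ℝ] E6))
    (Q : (Fin 3 → ℝ) →ₗ[ℝ] (Fin 3 → ℝ))

theorem liouvilleForm_ne_zero {p : E6} (hp : p ∈ M.unitBundle) {D : (Fin 3 → ℝ) →L[ℝ] E6}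
    (hD : Function.Injective D) (hT : ∀ h, D h ∈ M.tangentUnitBundle p) :
    M.liouvilleForm p (fun i ↦ D (Pi.single i 1)) ≠ 0 := by
  rw [liouvilleForm_eq_det hp]
  have hi : Function.Injective (M.coframe p ∘ₗ (D : (Fin 3 → ℝ) →ₗ[ℝ] E6)) := by
    rw [injective_iff_map_eq_zero]
    intro h hh
    have h0 : M.coframe p (D h) = 0 := hh
    have hz := eq_zero_of_coframe hp (hT h) (congrFun h0 0)
      ((psiL_apply hp _).symm.trans (congrFun h0 1)) (congrFun h0 2)
    exact hD (hz.trans (map_zero D).symm)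
  have hu := (LinearEquiv.ofInjectiveEndo _ hi).isUnit_det'
  exact hu.ne_zero

variable (M)

theorem image_chart_eulerBox : M.chart '' eulerBox = M.unitBundle ∩ eulerSlit := by
  ext p
  constructor
  · rintro ⟨y, hy, rfl⟩
    obtain ⟨c, hc, h⟩ := M.eulerChart_eq (LinearIsometryEquiv.refl ℝ E3) y
    exact ⟨M.eulerChart_mem _ y, by rw [← Prod.mk.eta (p := M.chart y)]
                                    exact h ▸ euler_mem_eulerSlit hy hc⟩
  · rintro ⟨hp, hs⟩
    exact M.mem_image_eulerChart (LinearIsometryEquiv.refl ℝ E3) hp hs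

theorem eulerCoord_chart {y : Fin 3 → ℝ} (hy : y ∈ eulerBox) : eulerCoord (M.chart y) = y := by
  obtain ⟨c, hc, h⟩ := M.eulerChart_eq (LinearIsometryEquiv.refl ℝ E3) y
  rw [← Prod.mk.eta (p := M.chart y)]
  exact (congrArg eulerCoord h).trans (eulerCoord_euler hy hc)

theorem chart_mem (y : Fin 3 → ℝ) : M.chart y ∈ M.unitBundle := M.eulerChart_mem _ y

theorem injOn_chart : InjOn M.chart eulerBox := M.injOn_eulerChart _

theorem fderiv_chart_mem (y h : Fin 3 → ℝ) :
    fderiv ℝ M.chart y h ∈ M.tangentUnitBundle (M.chart y) := M.eulerChart_tangent _ y h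

theorem image_chart_Icc : M.chart '' Icc eulerLo eulerHi = M.unitBundle := by
  refine Subset.antisymm (image_subset_iff.2 fun y _ ↦ M.chart_mem y) fun p hp ↦ ?_
  obtain ⟨y, hy, he, -⟩ := M.exists_eulerChart_eq (LinearIsometryEquiv.refl ℝ E3) hp
  exact ⟨y, hy, he⟩

theorem measurableSet_unitBundle : MeasurableSet M.unitBundle := by
  rw [← image_chart_Icc]
  exact (isCompact_Icc.image M.contDiff_chart.continuous).measurableSet

theorem measurableSet_image_chart : MeasurableSet (M.chart '' eulerBox) :=
  isOpen_eulerBox.measurableSet.image_of_continuousOn_injOn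
    M.contDiff_chart.continuous.continuousOn M.injOn_chart

/-- Points of the bundle outside the open chart are images of the boundary of the box, which is a
null set. -/
theorem volume_preimage_diff_eq_zero {U : Set (Fin 3 → ℝ)} {φ : (Fin 3 → ℝ) → E6}
    (hφ : IsParametrization M.unitBundle U φ) :
    volume {y ∈ U | φ y ∉ M.chart '' eulerBox} = 0 := by
  refine measure_mono_null ?_ (volume_immersion_preimage_eq_zero hφ.1 hφ.2.1 hφ.2.2.2.2
    (M.contDiff_chart.differentiable (by simp)) volume_Icc_diff_eulerBox)
  rintro y ⟨hy, hn⟩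
  have h := hφ.2.2.2.1 hy
  rw [← image_chart_Icc] at h
  obtain ⟨x, hx, hxy⟩ := h
  exact ⟨hy, x, ⟨hx, fun hb ↦ hn ⟨x, hb, hxy⟩⟩, hxy⟩

/-- The density of the Liouville volume in Euler angles. -/
def chartForm (y : Fin 3 → ℝ) : ℝ :=
  M.liouvilleForm (M.chart y) fun i ↦ fderiv ℝ M.chart y (Pi.single i 1)

/-- The Liouville volume form defines a measure on the unit tangent bundle. -/
theorem isVolumeMeasure_map_chart : IsVolumeMeasure M.unitBundle M.liouvilleForm
    (((volume.restrict eulerBox).withDensity fun y ↦ ENNReal.ofReal |M.chartForm y|).map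
      M.chart) := by
  have hm : Measurable M.chart := M.contDiff_chart.continuous.measurable
  refine ⟨?_, fun U φ hφ B hBU hB ↦ ?_⟩
  · rw [Measure.map_apply hm M.measurableSet_unitBundle.compl]
    have h : M.chart ⁻¹' M.unitBundleᶜ = ∅ := by
      ext y
      simp [M.chart_mem y]
    rw [h, measure_empty]
  · obtain ⟨hU, hs, hinj, hmaps, himm⟩ := id hφ
    have hBm : MeasurableSet (φ '' B) :=
      hB.image_of_continuousOn_injOn (hs.continuousOn.mono hBU) (hinj.mono hBU)
    set C := B ∩ φ ⁻¹' eulerSlit with hC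
    have hCm : MeasurableSet C :=
      measurableSet_inter_preimage hU hs.continuousOn hBU hB isOpen_eulerSlit
    have hW : IsOpen (U ∩ φ ⁻¹' eulerSlit) :=
      hs.continuousOn.isOpen_inter_preimage hU isOpen_eulerSlit
    -- `ψ` is here the transition map from `φ` to the Euler angles. The change of variables formula
    -- for it compares the two densities, and the part of `B` outside its domain is null.
    let ψ : (Fin 3 → ℝ) → (Fin 3 → ℝ) := fun z ↦ eulerCoord (φ z)
    have hψ : ∀ z ∈ U ∩ φ ⁻¹' eulerSlit, ψ z ∈ eulerBox ∧ M.chart (ψ z) = φ z := by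
      intro z hz
      have h : φ z ∈ M.unitBundle ∩ eulerSlit := ⟨hmaps hz.1, hz.2⟩
      rw [← image_chart_eulerBox] at h
      obtain ⟨y, hy, hyz⟩ := h
      have : ψ z = y := by simp only [ψ, ← hyz, M.eulerCoord_chart hy]
      rw [this]
      exact ⟨hy, hyz⟩
    have hCW : C ⊆ U ∩ φ ⁻¹' eulerSlit := inter_subset_inter_left _ hBU
    have hset : M.chart ⁻¹' (φ '' B) ∩ eulerBox = ψ '' C := by
      ext y
      constructor
      · rintro ⟨⟨z, hz, hzy⟩, hy⟩
        have h : M.chart y ∈ M.unitBundle ∩ eulerSlit := by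
          rw [← image_chart_eulerBox]; exact mem_image_of_mem _ hy
        refine ⟨z, ⟨hz, ?_⟩, ?_⟩
        · rw [mem_preimage, hzy]; exact h.2
        · simp only [ψ, hzy, M.eulerCoord_chart hy]
      · rintro ⟨z, hz, rfl⟩
        exact ⟨⟨z, hz.1, (hψ z (hCW hz)).2.symm⟩, (hψ z (hCW hz)).1⟩
    have hd : ∀ z ∈ U ∩ φ ⁻¹' eulerSlit, HasFDerivAt ψ (fderiv ℝ ψ z) z := fun z hz ↦
      ((differentiableAt_eulerCoord (hmaps hz.1).1 hz.2).comp z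
        ((hs.contDiffAt (hU.mem_nhds hz.1)).differentiableAt (by simp))).hasFDerivAt
    have hψinj : InjOn ψ C := by
      intro a ha b hb hab
      refine hinj (hBU ha.1) (hBU hb.1) ?_
      rw [← (hψ a (hCW ha)).2, ← (hψ b (hCW hb)).2, hab]
    have hBC : (C : Set (Fin 3 → ℝ)) =ᵐ[volume] B := by
      refine Filter.EventuallyLE.antisymm (LE.le.eventuallyLE inter_subset_left)
        (ae_le_set.2 (measure_mono_null ?_ (M.volume_preimage_diff_eq_zero hφ)))
      rintro y ⟨hy, hn⟩
      refine ⟨hBU hy, fun h ↦ hn ⟨hy, ?_⟩⟩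
      rw [image_chart_eulerBox] at h
      exact h.2
    rw [Measure.map_apply hm hBm, withDensity_apply _ (hm hBm),
      Measure.restrict_restrict (hm hBm), hset,
      lintegral_image_eq_lintegral_abs_det_fderiv_mul volume hCm
        (fun z hz ↦ (hd z (hCW hz)).hasFDerivWithinAt) hψinj, setLIntegral_congr hBC.symm]
    refine setLIntegral_congr_fun hCm fun z hz ↦ ?_
    have hz' := hCW hz
    have hfd : fderiv ℝ φ z = (fderiv ℝ M.chart (ψ z)).comp (fderiv ℝ ψ z) := by
      have h1 := ((M.contDiff_chart.differentiable (by simp) (ψ z)).hasFDerivAt.comp z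
        (hd z hz')).congr_of_eventuallyEq (f₁ := φ)
        (Filter.eventually_of_mem (hW.mem_nhds hz') fun w hw ↦ (hψ w hw).2.symm)
      exact h1.fderiv
    rw [hfd, ← (hψ z hz').2, liouvilleForm_comp (M.chart_mem _), abs_mul,
      ENNReal.ofReal_mul (abs_nonneg _)]
    rfl

theorem isVolumeMeasure_liouvilleVolume :
    IsVolumeMeasure M.unitBundle M.liouvilleForm M.liouvilleVolume :=
  Classical.epsilon_spec ⟨_, M.isVolumeMeasure_map_chart⟩

end MagneticSystem

/-! ### Integrals over the Liouville measure in Euler angles -/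

/-- A continuous function without zeros on a preconnected set is equal to its absolute value up to
a constant sign. -/
theorem exists_sign_of_isPreconnected {S : Set (Fin 3 → ℝ)} (hS : IsPreconnected S)
    {F : (Fin 3 → ℝ) → ℝ} (hF : ContinuousOn F S) (h0 : ∀ y ∈ S, F y ≠ 0) :
    ∃ s : ℝ, ∀ y ∈ S, |F y| = s * F y := by
  by_cases h : ∃ a ∈ S, F a < 0
  · obtain ⟨a, ha, hneg⟩ := h
    refine ⟨-1, fun b hb ↦ ?_⟩
    rw [neg_one_mul, abs_of_nonpos]
    by_contra! hpos
    obtain ⟨c, hc, hc0⟩ := hS.intermediate_value ha hb hF ⟨hneg.le, hpos.le⟩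
    exact h0 c hc hc0
  · push Not at h
    exact ⟨1, fun b hb ↦ by rw [one_mul, abs_of_nonneg (h b hb)]⟩

namespace MagneticSystem

variable (M : MagneticSystem)

/-- The wedge product `β ∧ dτ` in Euler angles. -/
def wedgeD (β τ : E6 → E6 [⋀^Fin 1]→L[ℝ] ℝ) (y : Fin 3 → ℝ) : ℝ :=
  wedge12 (fun a ↦ β (M.chart y) ![a]) (fun a b ↦ extDeriv τ (M.chart y) ![a, b])
    fun i ↦ fderiv ℝ M.chart y (Pi.single i 1)

variable {β τ : E6 → E6 [⋀^Fin 1]→L[ℝ] ℝ}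

theorem continuous_wedgeD (hβ : ContDiff ℝ ∞ β) (hτ : ContDiff ℝ ∞ τ) :
    Continuous (M.wedgeD β τ) := by
  have he := M.contDiff_chart
  have c1 (i : Fin 3) : Continuous (pullComp M.chart β i) := (contDiff_pullComp he hβ i).continuous
  have c2 (i j : Fin 3) : Continuous fun y ↦ extDeriv τ (M.chart y)
      ![fderiv ℝ M.chart y (Pi.single i 1), fderiv ℝ M.chart y (Pi.single j 1)] := by
    simp only [extDeriv_pullComp he hτ]
    exact ((((contDiff_pullComp he hτ j).continuous_fderiv (by simp)).clm_apply
      continuous_const).sub (((contDiff_pullComp he hτ i).continuous_fderiv (by simp)).clm_apply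
      continuous_const))
  exact (((c1 0).mul (c2 1 2)).sub ((c1 1).mul (c2 0 2))).add ((c1 2).mul (c2 0 1))

theorem integrableOn_wedgeD (hβ : ContDiff ℝ ∞ β) (hτ : ContDiff ℝ ∞ τ) :
    IntegrableOn (M.wedgeD β τ) (Icc eulerLo eulerHi) :=
  (M.continuous_wedgeD hβ hτ).continuousOn.integrableOn_compact isCompact_Icc

theorem integral_wedgeD_comm (hβ : ContDiff ℝ ∞ β) (hτ : ContDiff ℝ ∞ τ) :
    ∫ y in Icc eulerLo eulerHi, M.wedgeD β τ y = ∫ y in Icc eulerLo eulerHi, M.wedgeD τ β y := by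
  have h := M.integral_wedge_sub_wedge hτ hβ
  exact sub_eq_zero.1 ((integral_sub (M.integrableOn_wedgeD hβ hτ)
    (M.integrableOn_wedgeD hτ hβ)).symm.trans h)

theorem chartForm_eq (y : Fin 3 → ℝ) : M.chartForm y = M.wedgeD M.α M.α y :=
  liouvilleForm_eq_wedge (M.chart_mem y) fun _ ↦ M.fderiv_chart_mem y _

theorem continuous_chartForm : Continuous M.chartForm := by
  rw [show M.chartForm = M.wedgeD M.α M.α from funext M.chartForm_eq]
  exact M.continuous_wedgeD M.contDiff_alpha M.contDiff_alpha

theorem chartForm_ne_zero {y : Fin 3 → ℝ} (hy : y ∈ eulerBox) : M.chartForm y ≠ 0 :=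
  liouvilleForm_ne_zero (M.chart_mem y) (M.injective_fderiv_eulerChart _ hy)
    fun _ ↦ M.fderiv_chart_mem y _

theorem eulerBox_ae_eq : (eulerBox : Set (Fin 3 → ℝ)) =ᵐ[volume] Icc eulerLo eulerHi :=
  Measure.univ_pi_Ioo_ae_eq_Icc (μ := fun _ : Fin 3 ↦ volume)

theorem eulerBox_subset_Icc : eulerBox ⊆ Icc eulerLo eulerHi := by
  rw [← pi_univ_Icc]
  exact pi_mono fun _ _ ↦ Ioo_subset_Icc_self

theorem isPreconnected_eulerBox : IsPreconnected eulerBox :=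
  (convex_pi fun _ _ ↦ convex_Ioo _ _).isPreconnected

theorem volume_eulerBox_pos : 0 < volume eulerBox := by
  refine isOpen_eulerBox.measure_pos volume ⟨![0, 1, 0], mem_eulerBox.2 ?_⟩
  have := Real.pi_gt_three
  refine ⟨⟨?_, ?_⟩, ⟨?_, ?_⟩, ?_, ?_⟩ <;> simp <;> linarith

/-- The volume condition controls the measure only inside charts. The finitely many permuted Euler
charts cover the bundle, and in each the points missed by the standard chart form a null set. -/
theorem liouvilleVolume_compl_image_chart : M.liouvilleVolume (M.chart '' eulerBox)ᶜ = 0 := by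
  obtain ⟨h0, h1⟩ := M.isVolumeMeasure_liouvilleVolume
  let e (s : Equiv.Perm (Fin 3)) := M.eulerChart (LinearIsometryEquiv.piLpCongrLeft 2 ℝ ℝ s)
  let B (s : Equiv.Perm (Fin 3)) : Set (Fin 3 → ℝ) := {y ∈ eulerBox | e s y ∉ M.chart '' eulerBox}
  have hB (s) : M.liouvilleVolume (e s '' B s) = 0 := by
    have hφ := M.isParametrization_eulerChart (LinearIsometryEquiv.piLpCongrLeft 2 ℝ ℝ s)
    have hm : Measurable (e s) := (M.contDiff_eulerChart _).continuous.measurable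
    rw [h1 _ _ hφ (B s) (fun y hy ↦ hy.1)
      (isOpen_eulerBox.measurableSet.inter (hm M.measurableSet_image_chart.compl))]
    exact setLIntegral_measure_zero _ _ (M.volume_preimage_diff_eq_zero hφ)
  refine measure_mono_null (t := M.unitBundleᶜ ∪ ⋃ s, e s '' B s) (fun p hp ↦ ?_)
    (measure_union_null h0 (measure_iUnion_null hB))
  by_cases hpN : p ∈ M.unitBundle
  · obtain ⟨s, y, hy, rfl⟩ := M.exists_perm_mem_image_eulerChart hpN
    exact Or.inr (mem_iUnion.2 ⟨s, y, ⟨hy, hp⟩, rfl⟩)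
  · exact Or.inl hpN

/-- Uniqueness of the volume measure: it is determined on the image of one chart, and the complement
is null. -/
theorem liouvilleVolume_eq : M.liouvilleVolume =
    ((volume.restrict eulerBox).withDensity fun y ↦ ENNReal.ofReal |M.chartForm y|).map
      M.chart := by
  have hm : Measurable M.chart := M.contDiff_chart.continuous.measurable
  ext A hA
  have hset : A ∩ M.chart '' eulerBox = M.chart '' (M.chart ⁻¹' A ∩ eulerBox) := by
    rw [inter_comm A, inter_comm _ eulerBox, image_inter_preimage]
  have hnull : M.liouvilleVolume (A \ M.chart '' eulerBox) = 0 :=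
    measure_mono_null (fun p hp ↦ hp.2) M.liouvilleVolume_compl_image_chart
  rw [← measure_inter_add_sdiff A M.measurableSet_image_chart, hnull, add_zero,
    Measure.map_apply hm hA,
    withDensity_apply _ (hm hA), Measure.restrict_restrict (hm hA), hset]
  exact M.isVolumeMeasure_liouvilleVolume.2 _ _ (M.isParametrization_eulerChart
    (LinearIsometryEquiv.refl ℝ E3)) _ inter_subset_right
    ((hm hA).inter isOpen_eulerBox.measurableSet)

theorem measurable_density : Measurable fun y ↦ ENNReal.ofReal |M.chartForm y| :=
  (M.continuous_chartForm.abs.measurable).ennreal_ofReal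

/-- Restricted to the box the chart is a measurable embedding, so `G` needs no measurability. This
matters because `magneticField` is defined by choices. -/
theorem integral_liouvilleVolume (G : E6 → ℝ) : ∫ p, G p ∂M.liouvilleVolume =
    ∫ y in eulerBox, |M.chartForm y| * G (M.chart y) := by
  have hb : MeasurableSet eulerBox := isOpen_eulerBox.measurableSet
  have hemb : MeasurableEmbedding (eulerBox.domRestrict M.chart) :=
    ContinuousOn.measurableEmbedding hb M.contDiff_chart.continuous.continuousOn M.injOn_chart
  rw [liouvilleVolume_eq, ← restrict_withDensity hb, ← map_comap_subtype_coe hb,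
    Measure.map_map M.contDiff_chart.continuous.measurable measurable_subtype_coe]
  refine (hemb.integral_map _).trans ?_
  refine (integral_subtype_comap hb fun y ↦ G (M.chart y)).trans ?_
  rw [setIntegral_withDensity_eq_setIntegral_toReal_smul M.measurable_density
    (Eventually.of_forall fun _ ↦ ENNReal.ofReal_lt_top) _ hb]
  simp only [ENNReal.toReal_ofReal (abs_nonneg _), smul_eq_mul]

theorem liouvilleVolume_univ : M.liouvilleVolume univ =
    ∫⁻ y in eulerBox, ENNReal.ofReal |M.chartForm y| := by
  rw [liouvilleVolume_eq, Measure.map_apply M.contDiff_chart.continuous.measurable .univ,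
    preimage_univ, withDensity_apply _ .univ, Measure.restrict_univ]

theorem liouvilleVolume_univ_ne_top : M.liouvilleVolume univ ≠ ⊤ := by
  rw [liouvilleVolume_univ]
  have h : IntegrableOn (fun y ↦ |M.chartForm y|) eulerBox :=
    (M.continuous_chartForm.abs.continuousOn.integrableOn_compact isCompact_Icc).mono_set
      eulerBox_subset_Icc
  exact h.lintegral_lt_top.ne

theorem liouvilleVolume_univ_ne_zero : M.liouvilleVolume univ ≠ 0 := by
  rw [liouvilleVolume_univ]
  refine ((setLIntegral_pos_iff M.measurable_density).2 ?_).ne'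
  refine volume_eulerBox_pos.trans_le (measure_mono fun y hy ↦ ⟨?_, hy⟩)
  simpa using M.chartForm_ne_zero hy

/-- The integral of a one-form with the differential `τ₀` along the magnetic vector field, in Euler
angles. -/
theorem exists_integral_eq (m : ℝ) {τ₀ : E6 → E6 [⋀^Fin 1]→L[ℝ] ℝ}
    (h₀ : τ₀ ∈ Primitives M.unitBundle M.tangentUnitBundle (M.omega m)) :
    ∃ s : ℝ, (∀ y ∈ eulerBox, |M.chartForm y| = s * M.chartForm y) ∧
      ∀ τ : E6 → E6 [⋀^Fin 1]→L[ℝ] ℝ, ∫ p, τ p ![M.magneticField m p] ∂M.liouvilleVolume =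
        s * ∫ y in Icc eulerLo eulerHi, M.wedgeD τ τ₀ y := by
  -- The sign of the density is constant on the box, so the orientation of the chart need not be
  -- determined.
  obtain ⟨s, hs⟩ := exists_sign_of_isPreconnected isPreconnected_eulerBox
    M.continuous_chartForm.continuousOn fun y hy ↦ M.chartForm_ne_zero hy
  refine ⟨s, hs, fun τ ↦ ?_⟩
  rw [integral_liouvilleVolume, ← setIntegral_congr_set eulerBox_ae_eq, ← integral_const_mul]
  refine setIntegral_congr_fun isOpen_eulerBox.measurableSet fun y hy ↦ ?_
  have ht (h) := M.fderiv_chart_mem y h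
  have hp := M.chart_mem y
  simp only [hs y hy]
  rw [mul_assoc, mul_comm (M.chartForm y), chartForm,
    magneticField_mul_liouvilleForm hp m _ fun i ↦ ht _]
  simp only [wedgeD, wedge12, h₀.2 _ hp _ (ht _) _ (ht _)]

end MagneticSystem

/-! ### The four claims -/

namespace MagneticSystem

variable (M : MagneticSystem)

/-- The two-form `ω_m` has a primitive along which the integral over the Liouville volume is
positive. -/
theorem exists_primitive_integral_pos {m : ℝ} (hm : 0 < m) :
    ∃ τ₀ ∈ Primitives M.unitBundle M.tangentUnitBundle (M.omega m),
      0 < ∫ p, τ₀ p ![M.magneticField m p] ∂M.liouvilleVolume := by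
  obtain ⟨θ, hθ, hdθ, hneg⟩ := M.exists_primitive_magnetic
  have hα := M.contDiff_alpha
  have hτ : ContDiff ℝ ∞ (m • M.α + (-1 : ℝ) • θ) :=
    (contDiff_const.smul hα).add (contDiff_const.smul hθ)
  have hd : ∀ p, extDeriv (m • M.α + (-1 : ℝ) • θ) p = m • extDeriv M.α p + (-1 : ℝ) • extDeriv θ p :=
    fun p ↦ by
    have h1 : DifferentiableAt ℝ (m • M.α) p := (hα.differentiable (by simp) p).const_smul m
    have h2 : DifferentiableAt ℝ ((-1 : ℝ) • θ) p :=
      (hθ.differentiable (by simp) p).const_smul (-1 : ℝ)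
    rw [extDeriv_add h1 h2, extDeriv_smul, extDeriv_smul]
  have hprim : m • M.α + (-1 : ℝ) • θ ∈
      Primitives M.unitBundle M.tangentUnitBundle (M.omega m) := by
    refine ⟨hτ, fun p hp a ha b hb ↦ ?_⟩
    rw [hd, omega_apply, ← hdθ p hp a ha b hb]
    simp
    ring
  refine ⟨_, hprim, ?_⟩
  obtain ⟨s, hs, hint⟩ := M.exists_integral_eq m hprim
  rw [hint]
  have ht (y h) := M.fderiv_chart_mem y h
  have hσ : ∀ (β : E6 → E6 [⋀^Fin 1]→L[ℝ] ℝ) y, M.wedgeD β θ y =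
      -(M.strength (M.chart y).1 * β (M.chart y) ![M.V (M.chart y)]) * M.chartForm y := by
    intro β y
    rw [chartForm, ← wedge_sigma (M.chart_mem y) _ fun i ↦ ht y _]
    simp only [wedgeD, wedge12, hdθ _ (M.chart_mem y) _ (ht y _) _ (ht y _)]
  -- `π^*σ = f α ∧ η` contains the factor `α`. Stokes carries the vanishing over to the integral of
  -- `θ ∧ dα`, which need not be zero pointwise.
  have hαθ : ∀ y, M.wedgeD M.α θ y = 0 := fun y ↦ by
    rw [hσ, ← alphaL_apply, alphaL_V]
    ring
  have hθα : ∫ y in Icc eulerLo eulerHi, M.wedgeD θ M.α y = 0 := by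
    rw [M.integral_wedgeD_comm hθ hα]
    simp only [hαθ, integral_zero]
  have hexp : ∀ y, M.wedgeD (m • M.α + (-1 : ℝ) • θ) (m • M.α + (-1 : ℝ) • θ) y =
      (m ^ 2 * M.chartForm y + M.wedgeD θ θ y) - m * M.wedgeD θ M.α y := fun y ↦ by
    have h := hαθ y
    rw [chartForm_eq]
    simp only [wedgeD, wedge12] at h ⊢
    simp only [hd]
    simp
    linear_combination -m * h
  have iA : IntegrableOn (fun y ↦ m ^ 2 * M.chartForm y) (Icc eulerLo eulerHi) :=
    (continuous_const.mul M.continuous_chartForm).continuousOn.integrableOn_compact isCompact_Icc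
  have iB := (M.integrableOn_wedgeD hθ hα).const_mul m
  have iAC : IntegrableOn (fun y ↦ m ^ 2 * M.chartForm y + M.wedgeD θ θ y) (Icc eulerLo eulerHi) :=
    iA.add (M.integrableOn_wedgeD hθ hθ)
  simp only [hexp]
  rw [integral_sub iAC iB, integral_const_mul, hθα, mul_zero, sub_zero,
    ← setIntegral_congr_set eulerBox_ae_eq, ← integral_const_mul]
  -- Both terms are positive multiples of `ν`: `θ ∧ dθ = -f θ(V) ν`, where `f > 0` and `θ(V) < 0`.
  have hpos : ∀ y ∈ eulerBox, 0 < s * (m ^ 2 * M.chartForm y + M.wedgeD θ θ y) := by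
    intro y hy
    have hp := M.chart_mem y
    have h1 := hneg _ hp _ (rot_mem hp) (sigma_snd_rot_pos hp)
    have h2 := strength_pos hp
    have h3 : 0 < |M.chartForm y| := abs_pos.2 (M.chartForm_ne_zero hy)
    have h4 : s * (m ^ 2 * M.chartForm y + M.wedgeD θ θ y) = (m ^ 2 +
        M.strength (M.chart y).1 * -θ (M.chart y) ![M.V (M.chart y)]) * |M.chartForm y| := by
      rw [hσ, hs y hy]
      ring
    rw [h4]
    have h5 := mul_pos h2 (neg_pos.2 h1)
    exact mul_pos (add_pos (pow_pos hm 2) h5) h3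
  refine (setIntegral_pos_iff_support_of_nonneg_ae ?_ ?_).2 ?_
  · exact (ae_restrict_mem isOpen_eulerBox.measurableSet).mono fun y hy ↦ (hpos y hy).le
  · exact (iAC.mono_set eulerBox_subset_Icc).const_mul s
  · exact volume_eulerBox_pos.trans_le (measure_mono fun y hy ↦ ⟨(hpos y hy).ne', hy⟩)

theorem isProbabilityMeasure_liouvilleMeasure : IsProbabilityMeasure M.liouvilleMeasure :=
  ⟨by rw [liouvilleMeasure, Measure.smul_apply, smul_eq_mul,
    ENNReal.inv_mul_cancel M.liouvilleVolume_univ_ne_zero M.liouvilleVolume_univ_ne_top]⟩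

theorem liouvilleMeasure_compl : M.liouvilleMeasure M.unitBundleᶜ = 0 := by
  rw [liouvilleMeasure, Measure.smul_apply, M.isVolumeMeasure_liouvilleVolume.1, smul_zero]

theorem integral_liouvilleMeasure (G : E6 → ℝ) : ∫ p, G p ∂M.liouvilleMeasure =
    (M.liouvilleVolume univ).toReal⁻¹ * ∫ p, G p ∂M.liouvilleVolume := by
  rw [liouvilleMeasure, integral_smul_measure, ENNReal.toReal_inv, smul_eq_mul]

/-- `∫ β ∧ dτ₀ = ∫ τ₀ ∧ dβ` by Stokes, and `dβ = 0` on the bundle. -/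
theorem isNullHomologous_liouvilleMeasure {m : ℝ} (hm : 0 < m) :
    IsNullHomologous M.unitBundle M.tangentUnitBundle (M.magneticField m) M.liouvilleMeasure := by
  intro β hβ
  obtain ⟨τ₀, h₀, -⟩ := M.exists_primitive_integral_pos hm
  obtain ⟨s, -, hint⟩ := M.exists_integral_eq m h₀
  rw [integral_liouvilleMeasure, hint, M.integral_wedgeD_comm hβ.1 h₀.1]
  have h : ∀ y, M.wedgeD τ₀ β y = 0 := fun y ↦ by
    simp [wedgeD, wedge12, hβ.2 _ (M.chart_mem y) _ (M.fderiv_chart_mem y _) _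
      (M.fderiv_chart_mem y _)]
  simp [h]

/-- For every primitive `τ`, `∫ τ ∧ dτ₀ = ∫ τ₀ ∧ dτ = ∫ τ₀ ∧ dτ₀`, so one primitive with a positive
integral suffices. -/
theorem exists_action_pos {m : ℝ} (hm : 0 < m) : ∃ A : ℝ, 0 < A ∧
    HasAction M.unitBundle M.tangentUnitBundle (M.omega m) (M.magneticField m)
      M.liouvilleMeasure A := by
  obtain ⟨τ₀, h₀, hpos⟩ := M.exists_primitive_integral_pos hm
  obtain ⟨s, -, hint⟩ := M.exists_integral_eq m h₀
  refine ⟨∫ p, τ₀ p ![M.magneticField m p] ∂M.liouvilleMeasure, ?_, ⟨τ₀, h₀⟩, fun τ hτ ↦ ?_⟩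
  · rw [integral_liouvilleMeasure]
    exact mul_pos (inv_pos.2 (ENNReal.toReal_pos M.liouvilleVolume_univ_ne_zero
      M.liouvilleVolume_univ_ne_top)) hpos
  · rw [integral_liouvilleMeasure, integral_liouvilleMeasure, hint, hint,
      M.integral_wedgeD_comm hτ.1 h₀.1]
    have h : ∀ y, M.wedgeD τ₀ τ y = M.wedgeD τ₀ τ₀ y := fun y ↦ by
      have ht (h) := M.fderiv_chart_mem y h
      simp only [wedgeD, wedge12, hτ.2 _ (M.chart_mem y) _ (ht _) _ (ht _),
        h₀.2 _ (M.chart_mem y) _ (ht _) _ (ht _)]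
    simp only [h]

/-- Null homology applied to `dh`, which is closed by the symmetry of second derivatives. -/
theorem isInvariantMeasure_liouvilleMeasure {m : ℝ} (hm : 0 < m) :
    IsInvariantMeasure M.unitBundle (M.magneticField m) M.liouvilleMeasure := by
  refine ⟨M.isProbabilityMeasure_liouvilleMeasure, M.liouvilleMeasure_compl, fun h hh ↦ ?_⟩
  have hβ : ContDiff ℝ ∞ fun p ↦ oneForm (fderiv ℝ h p) :=
    (hh.fderiv_right (m := ∞) (by simp)).continuousLinearMap_comp oneForm
  have key := M.isNullHomologous_liouvilleMeasure hm (fun p ↦ oneForm (fderiv ℝ h p))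
    ⟨hβ, fun p _ a _ b _ ↦ ?_⟩
  · simpa using key
  · rw [extDeriv_pair (hβ.differentiable (by simp) p)]
    have hs : IsSymmSndFDerivAt ℝ h p := 
      (contDiff_infty.1 hh 2).contDiffAt.isSymmSndFDerivAt (by simp)
    have hd : ∀ a b, fderiv ℝ (fun q ↦ oneForm (fderiv ℝ h q) ![b]) p a =
        fderiv ℝ (fderiv ℝ h) p a b := fun a b ↦ by
      have h1 := (((hh.fderiv_right (m := ∞) (by simp)).differentiable (by simp) p).hasFDerivAt
        ).clm_apply (hasFDerivAt_const b p)
      simp only [oneForm_apply, Matrix.cons_val_zero]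
      rw [h1.fderiv]
      simp
    rw [hd, hd, hs.eq a b]
    simp

/-- As `τ(-R) = -1` and `-R` is a positive multiple of `X^m`, `τ(X^m)` is negative everywhere and
its integral cannot be the positive action. -/
theorem not_isNegativeContactType {m : ℝ} (hm : 0 < m) :
    ¬ IsNegativeContactType M.unitBundle M.tangentUnitBundle M.liouvilleForm (M.omega m) := by
  rintro ⟨τ, hτ, -, R, hR, hZ⟩
  obtain ⟨A, hA, -, hact⟩ := M.exists_action_pos hm
  have h := hact τ hτ
  have hle : ∫ p, τ p ![M.magneticField m p] ∂M.liouvilleMeasure ≤ 0 := by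
    refine integral_nonpos_of_ae ?_
    have hae : ∀ᵐ p ∂M.liouvilleMeasure, p ∈ M.unitBundle := M.liouvilleMeasure_compl
    filter_upwards [hae] with p hp
    obtain ⟨h1, -, h2, h3⟩ := hZ p hp
    refine (apply_magneticField_neg hp hm (τ p) h1 h2 h3 ?_).le
    rw [← toCovector_apply, map_neg, toCovector_apply, (hR p hp).2.2]
    norm_num
  linarith

end MagneticSystem

end MagneticSphere
end

open MagneticSphere in
theorem proposition3p2 (M : MagneticSystem) (m : ℝ) (hm : 0 < m) :
    IsVolumeMeasure M.unitBundle M.liouvilleForm M.liouvilleVolume ∧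
    IsInvariantMeasure M.unitBundle (M.magneticField m) M.liouvilleMeasure ∧
    IsNullHomologous M.unitBundle M.tangentUnitBundle (M.magneticField m) M.liouvilleMeasure ∧
    (∃ A : ℝ, 0 < A ∧ HasAction M.unitBundle M.tangentUnitBundle (M.omega m) (M.magneticField m)
      M.liouvilleMeasure A) ∧
    ¬ IsNegativeContactType M.unitBundle M.tangentUnitBundle M.liouvilleForm (M.omega m) :=
  ⟨M.isVolumeMeasure_liouvilleVolume, M.isInvariantMeasure_liouvilleMeasure hm,
    M.isNullHomologous_liouvilleMeasure hm, M.exists_action_pos hm,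
    M.not_isNegativeContactType hm⟩
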